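/- **Setting.** Let $\mathsf Z$ be a Polish space with its Borel $\sigma$-field, $\mathrm Q$ a Markov kernel on $\mathsf Z$ with invariant probability measure $\pi$, and let $t_{\rm mix}\ge 1$ be an integer with $\Delta(\mathrm Q^k)\le(1/4)^{\lfloor k/t_{\rm mix}\rfloor}$ for all $k\ge1$, where $\Delta(\mathrm Q^k)=\sup_{z,z'}\frac12\|\mathrm Q^k(z,\cdot)-\mathrm Q^k(z',\cdot)\|_{\rm TV}$ and $\|\mu\|_{\rm TV}=|\mu|(\mathsf Z)$. For a probability measure $\xi$ on $\mathsf Z$, $\mathbb E_\xi$ is the expectation for the canonical chain $(Z_k)_{k\ge0}$ with kernel $\mathrm Q$ and $Z_0\sim\xi$. Let $d\ge1$, and let $\mathbf A:\mathsf Z\to\mathbb R^{d\times d}$ and $\mathbf b:\mathsf Z\to\mathbb R^d$ be measurable with $\int\mathbf A\,d\pi=\bar{\mathbf A}$, $\int\mathbf b\,d\pi=\bar{\mathbf b}$. Norms are Euclidean, resp. spectral. Assume that $C_A=\sup_z\|\mathbf A(z)\|\vee\sup_z\|\mathbf A(z)-\bar{\mathbf A}\|<\infty$, that $-\bar{\mathbf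 A}$ is Hurwitz (all its eigenvalues have negative real part), and, with $\theta^\star$ the solution of $\bar{\mathbf A}\theta^\star=\bar{\mathbf b}$ and $\varepsilon(z)=(\mathbf A(z)-\bar{\mathbf A})\theta^\star-(\mathbf b(z)-\bar{\mathbf b})$, that $\|\varepsilon\|_\infty=\sup_z\|\varepsilon(z)\|<\infty$. Put $$\Sigma_\varepsilon^{(\mathrm M)}=\mathbb E_\pi[\varepsilon(Z_0)\varepsilon(Z_0)^\top]+2\sum_{\ell\ge1}\mathbb E_\pi[\varepsilon(Z_0)\varepsilon(Z_\ell)^\top].$$ **Step-size threshold.** Let $Q$ be the symmetric positive definite solution of $\bar{\mathbf A}^\top Q+Q\bar{\mathbf A}=\mathrm I$, let $\|\cdot\|_Q$ be the operator norm induced by $\|x\|_Q=(x^\top Qx)^{1/2}$, and set $\kappa=\lambda_{\max}(Q)/\lambda_{\min}(Q)$, $a=\|Q\|^{-1}/2$, $\alpha_\infty=\tfrac12\|\bar{\mathbf A}\|_Q^{-2}\|Q\|^{-1}\wedge\|Q\|$, $h=\lceil 8\kappa^{1/2}C_A/a\rceil$, $\alpha_\infty^{(\mathrm M)}=h^{-1}\bigl[\alpha_\infty\wedge\kappa^{-1/2}C_A^{-1}\wedge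 a/(6e\kappa C_A)\bigr]$, $C_\Gamma=4(\kappa^{1/2}C_A+a/6)^2h$, $\alpha_{q,\infty}^{(\mathrm M)}=\alpha_\infty^{(\mathrm M)}\wedge a/(12C_\Gamma q)$, and $$\alpha_{p,\infty}^{(\mathsf b)}=\Bigl(\alpha_{p(1+\log d),\infty}^{(\mathrm M)}\wedge\frac1{1+C_A}\wedge\frac1{ap}\Bigr)t_{\rm mix}^{-1}.$$ **Iterates.** For $\alpha>0$ and $\theta_0\in\mathbb R^d$ let $\theta^{(\alpha)}_0=\theta_0$, $\theta_k^{(\alpha)}=\theta_{k-1}^{(\alpha)}-\alpha\{\mathbf A(Z_k)\theta_{k-1}^{(\alpha)}-\mathbf b(Z_k)\}$ for $k\ge1$, let $\bar\theta_n^{(\alpha)}=(n-n_0)^{-1}\sum_{k=n_0}^{n-1}\theta_k^{(\alpha)}$ with burn-in $n_0=\lfloor n/2\rfloor$, and let $\bar\theta_n^{(\alpha,\mathsf{RR})}=2\bar\theta_n^{(\alpha)}-\bar\theta_n^{(2\alpha)}$, both averages being driven by the same chain from the same $\theta_0$. **Theorem.** The series defining $\Sigma_\varepsilon^{(\mathrm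 M)}$ converges, and there are constants $C_{\sf fl},C_{\sf tr}$ depending only on $t_{\rm mix},a,\kappa,C_A,\|\varepsilon\|_\infty$ (in particular not on $p,n,\alpha,\xi,\theta_0,d$) such that for all $2\le p<\infty$, all $n\ge t_{\rm mix}$, all $\alpha\in(0,\alpha_{p,\infty}^{(\mathsf b)})$, all initial distributions $\xi$ on $\mathsf Z$ and all $\theta_0\in\mathbb R^d$, $$\mathbb E_\xi^{1/p}\bigl[\|\bar{\mathbf A}(\bar\theta_n^{(\alpha,\mathsf{RR})}-\theta^\star)\|^p\bigr]\le 2\cdot 60e\,\{\operatorname{Tr}\Sigma_\varepsilon^{(\mathrm M)}\}^{1/2}p^{1/2}n^{-1/2}+R^{(\sf fl)}_{n,p,\alpha}+R^{(\sf tr)}_{n,p,\alpha}\|\theta_0-\theta^\star\|e^{-\alpha an/24},$$ where $$R^{(\sf fl)}_{n,p,\alpha}=C_{\sf fl}\Bigl\{p\,n^{-3/4}+\bigl(p^{3/2}(\alpha n)^{-1/2}+\alpha^{1/2}\bigr)p^{3/2}n^{-1/2}+p^{7/2}\alpha^{3/2}\log^{3/2}\bigl(1/(\alpha a)\bigr)\Bigr\},\qquad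 R^{(\sf tr)}_{n,p,\alpha}=C_{\sf tr}(\alpha n)^{-1}.$$ -/

import Mathlib

open MeasureTheory ProbabilityTheory
open scoped ENNReal

universe u

noncomputable section

namespace MarkovLSA

/-- `ℝ^d` with its Euclidean norm. -/
abbrev Vec (d : ℕ) : Type := EuclideanSpace ℝ (Fin d)

/-- Real `d × d` matrices, as linear maps of Euclidean space; the norm is the spectral norm. -/
abbrev Mat (d : ℕ) : Type := Vec d →L[ℝ] Vec d

section Chain

variable {Z : Type u} [MeasurableSpace Z]

/-- The law `ℙ_ξ` on `Z^ℕ` of the canonical Markov chain with kernel `Q` and `Z_0 ∼ ξ`. -/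
def chainLaw (Q : Kernel Z Z) [IsMarkovKernel Q] (ξ : Measure Z) : Measure (ℕ → Z) :=
  Kernel.trajMeasure (X := fun _ => Z) ξ
    (fun n => Q.comap (fun h : (∀ _ : Finset.Iic n, Z) => h ⟨n, Finset.mem_Iic.2 le_rfl⟩)
      (measurable_pi_apply _))

/-- The Dobrushin coefficient `sup_{z, z'} (1/2) ‖K(z, ·) - K(z', ·)‖_TV`, where
`‖μ‖_TV = |μ|(Z)`. -/
def dobrushin (K : Kernel Z Z) [IsMarkovKernel K] : ℝ≥0∞ :=
  ⨆ z, ⨆ z', (1 / 2) *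
    ((K z).toSignedMeasure - (K z').toSignedMeasure).totalVariation Set.univ

instance isMarkovKernel_pow (Q : Kernel Z Z) [IsMarkovKernel Q] (k : ℕ) :
    IsMarkovKernel (Q ^ k) := by
  induction k with
  | zero =>
    rw [pow_zero]
    exact (inferInstance : IsMarkovKernel (Kernel.id : Kernel Z Z))
  | succ k ih =>
    rw [pow_succ]
    exact (inferInstance : IsMarkovKernel ((Q ^ k) ∘ₖ Q))

/-- `π` is an invariant probability measure of `Q`, and `Q` is uniformly geometrically ergodic with
mixing time `tmix`: `Δ(Q^k) ≤ (1/4)^⌊k / tmix⌋` for all `k ≥ 1`. -/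
structure UniformlyGeometricallyErgodic (Q : Kernel Z Z) [IsMarkovKernel Q] (π : Measure Z)
    (tmix : ℕ) : Prop where
  invariant : Q.Invariant π
  tmix_pos : 0 < tmix
  mixing : ∀ k : ℕ, 1 ≤ k → dobrushin (Q ^ k) ≤ (1 / 4) ^ (k / tmix)

end Chain

section Lyapunov

variable {d : ℕ}

/-- A real matrix is Hurwitz if all its complex eigenvalues have negative real part. -/
def IsHurwitz (M : Mat d) : Prop :=
  ∀ μ : ℂ, Polynomial.aeval μ (LinearMap.charpoly (M : Vec d →ₗ[ℝ] Vec d)) = 0 → μ.re < 0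

/-- `P` is symmetric positive definite and solves the Lyapunov equation `Mᵀ P + P M = I`. -/
structure IsLyapunovSolution (M P : Mat d) : Prop where
  symm : IsSelfAdjoint P
  posDef : ∀ x : Vec d, x ≠ 0 → 0 < inner ℝ x (P x)
  eqn : (ContinuousLinearMap.adjoint M).comp P + P.comp M = ContinuousLinearMap.id ℝ (Vec d)

/-- The solution of the Lyapunov equation of `M`; it exists and is unique when `-M` is Hurwitz. -/
def lyapunov (M : Mat d) : Mat d := Classical.epsilon (IsLyapunovSolution M)

/-- The condition number `κ_P = λ_max(P) / λ_min(P)` of a symmetric matrix. -/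
def condNumber (P : Mat d) : ℝ := sSup (spectrum ℝ P) / sInf (spectrum ℝ P)

/-- `‖x‖_P = (xᵀ P x)^{1/2}`. -/
def weightedNorm (P : Mat d) (x : Vec d) : ℝ := √(inner ℝ x (P x))

/-- The operator norm of `M` with respect to `‖·‖_P`. -/
def weightedOpNorm (P M : Mat d) : ℝ :=
  sSup {r : ℝ | ∃ x : Vec d, weightedNorm P x = 1 ∧ r = weightedNorm P (M x)}

/-- `a = ‖P‖⁻¹ / 2`, where `P` is the Lyapunov solution of `M`. -/
def decayRate (M : Mat d) : ℝ := ‖lyapunov M‖⁻¹ / 2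

/-- `κ_P` for the Lyapunov solution `P` of `M`. -/
def kappa (M : Mat d) : ℝ := condNumber (lyapunov M)

/-- `α_∞ = ((1/2) ‖M‖_P⁻² ‖P‖⁻¹) ∧ ‖P‖` for the Lyapunov solution `P` of `M`. -/
def alphaInf (M : Mat d) : ℝ :=
  min ((1 / 2) * (weightedOpNorm (lyapunov M) M ^ 2)⁻¹ * ‖lyapunov M‖⁻¹) ‖lyapunov M‖

/-- `⌈8 κ^{1/2} C_A / a⌉`. -/
def blockLength (M : Mat d) (CA : ℝ) : ℝ := (⌈8 * √(kappa M) * CA / decayRate M⌉₊ : ℝ)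

/-- `α_∞^{(M)}`. -/
def alphaInfM (M : Mat d) (CA : ℝ) : ℝ :=
  min (min (alphaInf M) ((√(kappa M))⁻¹ * CA⁻¹))
    (decayRate M / (6 * Real.exp 1 * kappa M * CA)) * (blockLength M CA)⁻¹

/-- `C_Γ = 4 (κ^{1/2} C_A + a / 6)² ⌈8 κ^{1/2} C_A / a⌉`. -/
def CGamma (M : Mat d) (CA : ℝ) : ℝ :=
  4 * (√(kappa M) * CA + decayRate M / 6) ^ 2 * blockLength M CA

/-- `α_{q,∞}^{(M)} = α_∞^{(M)} ∧ (a / (12 C_Γ)) / q`. -/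
def alphaInfMq (M : Mat d) (CA q : ℝ) : ℝ :=
  min (alphaInfM M CA) (decayRate M / (12 * CGamma M CA) / q)

/-- `α_{p,∞}^{(b)} = (α_{p(1 + log d),∞}^{(M)} ∧ 1 / (1 + C_A) ∧ 1 / (a p)) / tmix`. -/
def alphaInfB (M : Mat d) (CA : ℝ) (tmix : ℕ) (p : ℝ) : ℝ :=
  min (min (alphaInfMq M CA (p * (1 + Real.log d))) (1 / (1 + CA)))
    (1 / (decayRate M * p)) * (tmix : ℝ)⁻¹

end Lyapunov

section LSA

variable {Z : Type u} [MeasurableSpace Z] {d : ℕ}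

/-- `C_A = sup_z ‖A(z)‖ ∨ sup_z ‖A(z) - Ā‖`. -/
def boundA (A : Z → Mat d) (Abar : Mat d) : ℝ :=
  max (⨆ z, ‖A z‖) (⨆ z, ‖A z - Abar‖)

/-- The noise `ε(z) = (A(z) - Ā) θ* - (b(z) - b̄)`. -/
def noise (A : Z → Mat d) (b : Z → Vec d) (Abar : Mat d) (bbar θs : Vec d) (z : Z) : Vec d :=
  (A z - Abar) θs - (b z - bbar)

/-- The assumptions on a linear stochastic approximation problem: `A`, `b` are measurable with
`π`-means `Ā`, `b̄`; `-Ā` is Hurwitz; `θ*` solves `Ā θ = b̄`; and `A`, `A - Ā` and the noise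
are bounded. -/
structure LSAAssumptions (π : Measure Z) (A : Z → Mat d) (b : Z → Vec d) (Abar : Mat d)
    (bbar θs : Vec d) : Prop where
  measurable_A : Measurable A
  measurable_b : Measurable b
  bounded_A : BddAbove (Set.range fun z => ‖A z‖)
  bounded_A_sub : BddAbove (Set.range fun z => ‖A z - Abar‖)
  hurwitz : IsHurwitz (-Abar)
  mean_A : ∫ z, A z ∂π = Abar
  mean_b : ∫ z, b z ∂π = bbar
  solution : Abar θs = bbar
  bounded_noise : BddAbove (Set.range fun z => ‖noise A b Abar bbar θs z‖)

/-- `E_π[f(Z_0) f(Z_ℓ)ᵀ]` for the chain started from `π`. -/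
def autoCov (Q : Kernel Z Z) [IsMarkovKernel Q] (π : Measure Z) (f : Z → Vec d) (ℓ : ℕ) :
    Matrix (Fin d) (Fin d) ℝ :=
  Matrix.of fun i j => ∫ ω, f (ω 0) i * f (ω ℓ) j ∂(chainLaw Q π)

/-- `Σ_f^{(M)} = E_π[f(Z_0) f(Z_0)ᵀ] + 2 ∑_{ℓ ≥ 1} E_π[f(Z_0) f(Z_ℓ)ᵀ]`. -/
def markovCov (Q : Kernel Z Z) [IsMarkovKernel Q] (π : Measure Z) (f : Z → Vec d) :
    Matrix (Fin d) (Fin d) ℝ :=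
  autoCov Q π f 0 + (2 : ℝ) • ∑' ℓ : ℕ, autoCov Q π f (ℓ + 1)

/-- The constant step-size iterates
`θ_k = θ_{k-1} - α (A(Z_k) θ_{k-1} - b(Z_k))` along the trajectory `ω = (Z_k)_k`. -/
def iterate (A : Z → Mat d) (b : Z → Vec d) (α : ℝ) (θ₀ : Vec d) (ω : ℕ → Z) : ℕ → Vec d
  | 0 => θ₀
  | k + 1 => iterate A b α θ₀ ω k -
      α • (A (ω (k + 1)) (iterate A b α θ₀ ω k) - b (ω (k + 1)))

/-- The Polyak–Ruppert average `(n - n₀)⁻¹ ∑_{k=n₀}^{n-1} θ_k` with burn-in `n₀ = ⌊n / 2⌋`. -/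
def averaged (A : Z → Mat d) (b : Z → Vec d) (α : ℝ) (θ₀ : Vec d) (n : ℕ) (ω : ℕ → Z) : Vec d :=
  ((n : ℝ) - ((n / 2 : ℕ) : ℝ))⁻¹ • ∑ k ∈ Finset.Ico (n / 2) n, iterate A b α θ₀ ω k

/-- The Richardson–Romberg iterate: twice the average for step `α` minus the average for step
`2 α`, along the same trajectory. -/
def richardsonRomberg (A : Z → Mat d) (b : Z → Vec d) (α : ℝ) (θ₀ : Vec d) (n : ℕ)
    (ω : ℕ → Z) : Vec d :=
  (2 : ℝ) • averaged A b α θ₀ n ω - averaged A b (2 * α) θ₀ n ω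

end LSA

/-- `p n^{-3/4} + (p^{3/2} (αn)^{-1/2} + α^{1/2}) p^{3/2} n^{-1/2}
+ p^{7/2} α^{3/2} log^{3/2}(1/(αa))`. -/
def fluctuationRate (a p α : ℝ) (n : ℕ) : ℝ :=
  p * (n : ℝ) ^ (-(3 / 4) : ℝ)
    + (p ^ (3 / 2 : ℝ) * (α * n) ^ (-(1 / 2) : ℝ) + α ^ (1 / 2 : ℝ)) * p ^ (3 / 2 : ℝ)
        * (n : ℝ) ^ (-(1 / 2) : ℝ)
    + p ^ (7 / 2 : ℝ) * α ^ (3 / 2 : ℝ) * Real.log (1 / (α * a)) ^ (3 / 2 : ℝ)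

end MarkovLSA

end

/-! Put e_k = θ_k − θ⋆, so that e_{k+1} = e_k − γ(A(Z_{k+1}) e_k + ε(Z_{k+1})) for step γ. Summing
the recursion over a window expresses Σ Ā e_k through γ⁻¹(e_s − e_{s+N}), −Σ ε(Z_{k+1}) and −Σ
(A(Z_{k+1}) − Ā) e_k. Let G solve the Poisson equation G − QG = A − Ā. The last sum then becomes a
martingale with increments (G(Z_{k+1}) − QG(Z_k)) e_k, two boundary terms, and terms produced by
e_{k+1} − e_k = −γ(A e_k + ε). Apart from −Σ ε, everything carries a factor e_k except γ Σ
QG(Z_{k+1}) ε(Z_{k+1}) (`sum_map_err_eq`). That exceptional sum carries the first-order bias. It is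
exactly linear in γ and free of the iterates, so twice step α minus step 2α cancels it path by path,
while −Σ ε survives with weight 2 − 1 = 1 (`map_richardsonRomberg_sub_eq`). Three estimates remain.

Moments of e_k. In a Lyapunov inner product, after subtracting γ times a Poisson correction of the
noise, one looks at blocks of length m of order t_mix C_A √κ / a. Over a block the conditional mean
contracts, since mixing makes the mean of A − Ā small against a m, and the fluctuation is bounded
pathwise. A two-point inequality expressing the 2-uniform smoothness of L^p turns this into a scalar
recursion in L^{p/2}, with no dimension in the constants. The result is ‖e_k‖_p ≲ e^{−aγk/12}‖e_0‖ +
√(pγ) (`eLpNorm_sq_err_le`). The same inequality gives a Burkholder bound for the matrix martingale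
(`eLpNorm_matrixMart_le`).

The leading sum Σ ε. Its Poisson martingale is treated by a Hilbert-space cosh supermartingale
compensated by the sum of conditional variances. This sum is itself an additive functional of the
chain, so its deviation from N v, with v the stationary conditional variance, has exponential
moments by the scalar case of the same argument. This yields √(pNv) + p N^{1/4}
(`UniformlyGeometricallyErgodic.eLpNorm_sum_le`), and v is the trace of the asymptotic covariance
(`UniformlyGeometricallyErgodic.trace_markovCov`).

Rates. Inserting √(pγ) for e_k in the remainder and dividing by the window length, of order n, gives
√p/(√α n), p√(α/n) and √p α^{3/2}, with no logarithm and with smaller powers of p than claimed;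
`simpleRate_le` passes to the claimed rate. -/

noncomputable section

namespace MarkovLSA

/-! ### Lyapunov equation and the adapted inner product -/

section LyapunovTheory

variable {d : ℕ}

/-- The complexification of a real operator on Euclidean space. -/
def complexify : Mat d →+* (EuclideanSpace ℂ (Fin d) →L[ℂ] EuclideanSpace ℂ (Fin d)) :=
  ((Matrix.toEuclideanCLM (n := Fin d) (𝕜 := ℂ)).toRingEquiv.toRingHom.comp
    (RingHom.mapMatrix Complex.ofRealHom)).comp
    (Matrix.toEuclideanCLM (n := Fin d) (𝕜 := ℝ)).symm.toRingEquiv.toRingHom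

lemma complexify_apply (T : Mat d) : complexify T = Matrix.toEuclideanCLM (n := Fin d) (𝕜 := ℂ)
    (((Matrix.toEuclideanCLM (n := Fin d) (𝕜 := ℝ)).symm T).map Complex.ofRealHom) := rfl

/-- The inclusion of `ℝ^d` in `ℂ^d`. -/
def complexVec (x : Vec d) : EuclideanSpace ℂ (Fin d) := WithLp.toLp 2 fun i => (x i : ℂ)

lemma norm_complexVec (x : Vec d) : ‖complexVec x‖ = ‖x‖ := by
  simp [complexVec, EuclideanSpace.norm_eq]

lemma complexify_complexVec (T : Mat d) (x : Vec d) :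
    complexify T (complexVec x) = complexVec (T x) := by
  obtain ⟨X, rfl⟩ : ∃ X, Matrix.toEuclideanCLM (n := Fin d) (𝕜 := ℝ) X = T :=
    (Matrix.toEuclideanCLM (n := Fin d) (𝕜 := ℝ)).surjective T
  rw [complexify_apply, StarAlgEquiv.symm_apply_apply]
  obtain ⟨y, rfl⟩ := (WithLp.toLp_surjective 2 x)
  ext i
  simp [complexVec, Matrix.mulVec, dotProduct]

lemma norm_le_norm_complexify (T : Mat d) : ‖T‖ ≤ ‖complexify T‖ := by
  refine ContinuousLinearMap.opNorm_le_bound _ (norm_nonneg _) fun x => ?_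
  rw [← norm_complexVec, ← norm_complexVec x, ← complexify_complexVec]
  exact ContinuousLinearMap.le_opNorm _ _

/-- The characteristic polynomial commutes with extension of scalars; this connects `IsHurwitz`,
phrased with the real polynomial, to complex spectral theory. -/
lemma mem_spectrum_complexify_iff (T : Mat d) (μ : ℂ) : μ ∈ spectrum ℂ (complexify T) ↔
    Polynomial.aeval μ (LinearMap.charpoly (T : Vec d →ₗ[ℝ] Vec d)) = 0 := by
  obtain ⟨X, rfl⟩ : ∃ X, Matrix.toEuclideanCLM (n := Fin d) (𝕜 := ℝ) X = T :=
    (Matrix.toEuclideanCLM (n := Fin d) (𝕜 := ℝ)).surjective T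
  rw [complexify_apply, StarAlgEquiv.symm_apply_apply,
    AlgEquiv.spectrum_eq (Matrix.toEuclideanCLM (n := Fin d) (𝕜 := ℂ)),
    Matrix.mem_spectrum_iff_isRoot_charpoly, Matrix.charpoly_map, Polynomial.IsRoot,
    Polynomial.eval_map, Polynomial.aeval_def]
  have : ((Matrix.toEuclideanCLM (n := Fin d) (𝕜 := ℝ) X : Mat d) : Vec d →ₗ[ℝ] Vec d).charpoly
      = X.charpoly := by
    rw [Matrix.coe_toEuclideanCLM_eq_toEuclideanLin, Matrix.toEuclideanLin,
      Matrix.toLpLin_eq_toLin, ← LinearMap.charpoly_toMatrix _ (PiLp.basisFun 2 ℝ (Fin d)), LinearMap.toMatrix_toLin]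
  rw [this]
  rfl

lemma isUnit_of_isUnit_complexify {T : Mat d} (h : IsUnit (complexify T)) : IsUnit T := by
  obtain ⟨X, rfl⟩ : ∃ X, Matrix.toEuclideanCLM (n := Fin d) (𝕜 := ℝ) X = T :=
    (Matrix.toEuclideanCLM (n := Fin d) (𝕜 := ℝ)).surjective T
  rw [complexify_apply, StarAlgEquiv.symm_apply_apply] at h
  replace h := (MulEquiv.isUnit_map (Matrix.toEuclideanCLM (n := Fin d) (𝕜 := ℂ))).1 h
  refine IsUnit.map _ ?_
  rw [Matrix.isUnit_iff_isUnit_det, isUnit_iff_ne_zero] at h ⊢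
  intro h0
  apply h
  have := RingHom.map_det Complex.ofRealHom X
  rw [h0, map_zero] at this
  exact this.symm

/-- Powers of an operator whose complex spectrum lies in the open unit disc decay
geometrically. -/
lemma exists_norm_pow_le_of_spectrum (hd : 1 ≤ d) (T : Mat d)
    (h : ∀ μ ∈ spectrum ℂ (complexify T), ‖μ‖ < 1) :
    ∃ r : ℝ, 0 ≤ r ∧ r < 1 ∧ ∀ᶠ k : ℕ in Filter.atTop, ‖T ^ k‖ ≤ r ^ k := by
  have : NeZero d := ⟨by omega⟩
  have hlt : spectralRadius ℂ (complexify T) < ((1 : NNReal) : ℝ≥0∞) :=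
    spectrum.spectralRadius_lt_of_forall_lt _ fun z hz => by
      rw [← NNReal.coe_lt_coe]; simpa using h z hz
  obtain ⟨r, hr1, hr2⟩ := ENNReal.lt_iff_exists_nnreal_btwn.1 hlt
  refine ⟨r, r.2, by exact_mod_cast hr2, ?_⟩
  -- Gelfand's formula, with `r` strictly between the spectral radius and 1.
  filter_upwards [(spectrum.pow_norm_pow_one_div_tendsto_nhds_spectralRadius
    (complexify T)).eventually_lt_const hr1, Filter.eventually_gt_atTop 0] with k hk hk0
  have hk' : ‖complexify T ^ k‖ ^ (1 / (k : ℝ)) ≤ r := by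
    have := hk.le
    rw [ENNReal.ofReal_le_iff_le_toReal ENNReal.coe_ne_top] at this
    simpa using this
  have h2 : ‖complexify T ^ k‖ ≤ (r : ℝ) ^ k := by
    have h3 := pow_le_pow_left₀ (by positivity) hk' k
    rwa [one_div, Real.rpow_inv_natCast_pow (norm_nonneg _) hk0.ne'] at h3
  calc ‖T ^ k‖ ≤ ‖complexify (T ^ k)‖ := norm_le_norm_complexify _
    _ = ‖complexify T ^ k‖ := by rw [map_pow]
    _ ≤ _ := h2

/-- The Cayley transform maps the open right half plane to the open unit disc. -/
lemma norm_lt_one_of_mem_spectrum_cayley {B : Type*} [Ring B] [Algebra ℂ B] {m w : B}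
    (hw : (m + 1) * w = 1) (hw' : w * (m + 1) = 1)
    (hm : ∀ μ ∈ spectrum ℂ m, 0 < μ.re) {μ : ℂ} (hμ : μ ∈ spectrum ℂ ((m - 1) * w)) :
    ‖μ‖ < 1 := by
  by_contra! hge
  apply hμ
  have hwu : IsUnit w := ⟨⟨w, m + 1, hw', hw⟩, rfl⟩
  have key : algebraMap ℂ B μ - (m - 1) * w
      = (algebraMap ℂ B (1 + μ) - algebraMap ℂ B (1 - μ) * m) * w := by
    have : algebraMap ℂ B μ = algebraMap ℂ B μ * ((m + 1) * w) := by rw [hw, mul_one]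
    rw [this, map_add, map_sub, map_one]
    noncomm_ring
  change IsUnit _
  rw [key]
  refine IsUnit.mul ?_ hwu
  by_cases h1 : μ = 1
  · subst h1
    rw [sub_self, map_zero, zero_mul, sub_zero]
    exact (isUnit_iff_ne_zero.2 (by norm_num)).map _
  · have h1' : (1 - μ) ≠ 0 := sub_ne_zero.2 (Ne.symm h1)
    -- This is the inverse Cayley image of μ. Its real part has the sign of 1 − |μ|², hence is
    -- nonpositive when |μ| ≥ 1.
    have hl : (1 + μ) / (1 - μ) ∉ spectrum ℂ m := by
      intro hmem
      have := hm _ hmem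
      rw [Complex.div_re] at this
      have hn : 0 < Complex.normSq (1 - μ) := Complex.normSq_pos.2 h1'
      rw [← add_div, lt_div_iff₀ hn] at this
      have h3 : 1 ≤ Complex.normSq μ := by
        rw [Complex.normSq_eq_norm_sq]; nlinarith
      rw [Complex.normSq_apply] at h3
      simp at this
      nlinarith
    have : algebraMap ℂ B (1 + μ) - algebraMap ℂ B (1 - μ) * m
        = algebraMap ℂ B (1 - μ) * (algebraMap ℂ B ((1 + μ) / (1 - μ)) - m) := by
      rw [mul_sub, ← map_mul, mul_div_cancel₀ _ h1']
    rw [this]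
    exact ((isUnit_iff_ne_zero.2 h1').map _).mul (spectrum.notMem_iff.1 hl)

/-- The Lyapunov equation is solved by a series in the powers of the Cayley transform. -/
lemma exists_lyapunov_series {B : Type*} [NormedRing B] [NormedAlgebra ℝ B] [StarRing B]
    [StarModule ℝ B] [NormedStarGroup B] [CompleteSpace B] {m w : B}
    (hw' : w * (m + 1) = 1) {r : ℝ} (hr0 : 0 ≤ r) (hr1 : r < 1)
    (hpow : ∀ᶠ k : ℕ in Filter.atTop, ‖((m - 1) * w) ^ k‖ ≤ r ^ k) :
    ∃ P : B, star P = P ∧ star m * P + P * m = 1 ∧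
      HasSum (fun k => star (((m - 1) * w) ^ k) * ((2 : ℝ) • (star w * w)) * ((m - 1) * w) ^ k)
        P := by
  set C : B := (m - 1) * w with hC
  set R : B := (2 : ℝ) • (star w * w) with hR
  set F : ℕ → B := fun k => star (C ^ k) * R * C ^ k with hF
  have hsum : Summable F := by
    have hg : Summable fun k : ℕ => ‖R‖ * (r ^ 2) ^ k :=
      (summable_geometric_of_lt_one (by positivity) (by nlinarith)).mul_left _
    refine Summable.of_norm_bounded_eventually_nat hg ?_
    filter_upwards [hpow] with k hk
    calc ‖F k‖ ≤ ‖star (C ^ k)‖ * ‖R‖ * ‖C ^ k‖ := by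
            refine (norm_mul_le _ _).trans ?_
            gcongr
            exact norm_mul_le _ _
      _ = ‖C ^ k‖ * ‖R‖ * ‖C ^ k‖ := by rw [norm_star]
      _ ≤ r ^ k * ‖R‖ * r ^ k := by gcongr
      _ = _ := by rw [← pow_mul, mul_comm 2 k, pow_mul]; ring
  obtain ⟨P, hP⟩ := hsum
  refine ⟨P, ?_, ?_, hP⟩
  · have hsF : ∀ k, star (F k) = F k := by
      intro k
      simp only [hF, hR, star_mul, star_star, star_smul, star_trivial]
      noncomm_ring
    have := hP.star
    simp only [hsF] at this
    exact this.unique hP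
  -- Shifting the series by one term gives the Stein equation. Conjugating it by m + 1 and using C(m
  -- + 1) = m − 1 turns it into the Lyapunov equation.
  · have hstein : P = R + star C * P * C := by
      have h1 : HasSum (fun k => F (k + 1)) (star C * P * C) := by
        convert! (hP.mul_left (star C)).mul_right C using 2 with k
        simp only [hF, pow_succ, star_mul]
        noncomm_ring
      have h2 := (hasSum_nat_add_iff 1).1 h1
      refine (hP.unique h2).trans ?_
      simp [hF, add_comm]
    have h1 : star (m + 1) * P * (m + 1) = star (m + 1) * R * (m + 1)
        + star (m - 1) * P * (m - 1) := by
      conv_lhs => rw [hstein]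
      have h2 : C * (m + 1) = m - 1 := by rw [hC, mul_assoc, hw', mul_one]
      have h3 : star (m + 1) * star C = star (m - 1) := by rw [← star_mul, h2]
      calc star (m + 1) * (R + star C * P * C) * (m + 1)
          = star (m + 1) * R * (m + 1) + (star (m + 1) * star C) * P * (C * (m + 1)) := by
            noncomm_ring
        _ = _ := by rw [h2, h3]
    have h4 : star (m + 1) * R * (m + 1) = (2 : ℝ) • (1 : B) := by
      rw [hR, mul_smul_comm, smul_mul_assoc]
      congr 1
      calc star (m + 1) * (star w * w) * (m + 1) = star (w * (m + 1)) * (w * (m + 1)) := by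
            rw [star_mul]; noncomm_ring
        _ = 1 := by rw [hw']; simp
    rw [h4] at h1
    have h5 : (2 : ℝ) • (star m * P + P * m) = (2 : ℝ) • (1 : B) := by
      have h6 : star (m + 1) * P * (m + 1) - star (m - 1) * P * (m - 1)
          = (2 : ℝ) • (star m * P + P * m) := by
        simp only [star_add, star_sub, star_one, two_smul]
        noncomm_ring
      rw [← h6, h1]; abel
    exact smul_right_injective _ (two_ne_zero) h5

/-- The Cayley transform (M − 1)(M + 1)⁻¹ has spectrum in the open disc, so the series of
`exists_lyapunov_series` converges. Its quadratic form is a sum of squares whose zeroth term 2‖(M +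
1)⁻¹x‖² is already positive, whence definiteness. A discrete series replaces the usual integral of
matrix exponentials. -/
theorem exists_isLyapunovSolution (hd : 1 ≤ d) {M : Mat d} (hM : IsHurwitz (-M)) :
    ∃ P, IsLyapunovSolution M P := by
  have hspec : ∀ μ ∈ spectrum ℂ (complexify M), 0 < μ.re := by
    intro μ hμ
    have h1 : -μ ∈ spectrum ℂ (complexify (-M)) := by
      rw [map_neg, ← spectrum.neg_eq]; simpa using hμ
    have := hM _ ((mem_spectrum_complexify_iff _ _).1 h1)
    simpa using this
  have hU : IsUnit (M + 1) := by
    apply isUnit_of_isUnit_complexify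
    rw [map_add, map_one]
    have : (-1 : ℂ) ∉ spectrum ℂ (complexify M) := fun h => by
      have := hspec _ h; norm_num at this
    rw [spectrum.notMem_iff] at this
    have h2 := this.neg
    simpa [add_comm] using h2
  obtain ⟨w, hw, hw'⟩ : ∃ w, (M + 1) * w = 1 ∧ w * (M + 1) = 1 :=
    ⟨_, hU.mul_val_inv, hU.val_inv_mul⟩
  obtain ⟨r, hr0, hr1, hpow⟩ := exists_norm_pow_le_of_spectrum hd ((M - 1) * w) fun μ hμ =>
    norm_lt_one_of_mem_spectrum_cayley (m := complexify M) (w := complexify w)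
      (by rw [← map_one complexify, ← map_add, ← map_mul, hw])
      (by rw [← map_one complexify, ← map_add, ← map_mul, hw']) hspec
      (by rwa [map_mul, map_sub, map_one] at hμ)
  obtain ⟨P, hP1, hP2, hP3⟩ := exists_lyapunov_series (B := Mat d) hw' hr0 hr1 hpow
  refine ⟨P, hP1, fun x hx => ?_, hP2⟩
  have hinner : HasSum (fun k => 2 * ‖w ((((M - 1) * w) ^ k : Mat d) x)‖ ^ 2) (inner ℝ x (P x)) := by
    have h1 := hP3.mapL ((innerSL ℝ x).comp (ContinuousLinearMap.apply ℝ (Vec d) x))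
    convert! h1 using 2 with k
    rw [ContinuousLinearMap.comp_apply, ContinuousLinearMap.apply_apply, innerSL_apply_apply,
      mul_apply_eq_comp, mul_apply_eq_comp,
      ContinuousLinearMap.star_eq_adjoint, ContinuousLinearMap.adjoint_inner_right,
      smul_apply, inner_smul_right, mul_apply_eq_comp,
      ContinuousLinearMap.star_eq_adjoint, ContinuousLinearMap.adjoint_inner_right,
      real_inner_self_eq_norm_sq]
  have h0 : 0 < 2 * ‖w ((((M - 1) * w) ^ 0 : Mat d) x)‖ ^ 2 := by
    have : w x ≠ 0 := by
      intro h
      apply hx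
      have h3 : ((M + 1) * w) x = (M + 1) (w x) := rfl
      rw [h, map_zero, hw] at h3
      simpa using h3
    have := norm_pos_iff.2 this
    simp only [pow_zero, one_apply_eq_self]
    positivity
  exact h0.trans_le (le_hasSum hinner 0 fun k _ => by positivity)

lemma isLyapunovSolution_lyapunov (hd : 1 ≤ d) {M : Mat d} (hM : IsHurwitz (-M)) :
    IsLyapunovSolution M (lyapunov M) :=
  Classical.epsilon_spec (exists_isLyapunovSolution hd hM)

lemma IsLyapunovSolution.inner_comm {M P : Mat d} (h : IsLyapunovSolution M P) (x y : Vec d) :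
    inner ℝ x (P y) = inner ℝ y (P x) := by
  rw [← ContinuousLinearMap.adjoint_inner_left, ← ContinuousLinearMap.star_eq_adjoint, h.symm.star_eq,
    real_inner_comm]

lemma IsLyapunovSolution.inner_eqn {M P : Mat d} (h : IsLyapunovSolution M P) (x : Vec d) :
    2 * inner ℝ x (P (M x)) = ‖x‖ ^ 2 := by
  have h1 := congrArg (fun T : Mat d => inner ℝ x (T x)) h.eqn
  simp only [add_apply, ContinuousLinearMap.comp_apply, inner_add_right,
    ContinuousLinearMap.adjoint_inner_right, ContinuousLinearMap.id_apply,
    real_inner_self_eq_norm_sq] at h1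
  rw [h.inner_comm (M x) x] at h1
  linarith

/-- The quadratic form of a symmetric positive definite matrix is bounded by the extreme points of
the spectrum. -/
lemma condNumber_bounds (hd : 1 ≤ d) {P : Mat d} (hs : IsSelfAdjoint P)
    (hp : ∀ x : Vec d, x ≠ 0 → 0 < inner ℝ x (P x)) :
    1 ≤ condNumber P ∧ 0 < ‖P‖ ∧
      ∀ x : Vec d, ‖P‖ * ‖x‖ ^ 2 ≤ condNumber P * inner ℝ x (P x) := by
  have hsym : (P : Vec d →ₗ[ℝ] Vec d).IsSymmetric := hs.isSymmetric
  have hn : Module.finrank ℝ (Vec d) = d := by simp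
  set v := hsym.eigenvectorBasis hn with hv
  set l := hsym.eigenvalues hn with hl
  have hPv : ∀ i, P (v i) = l i • v i := fun i => hsym.apply_eigenvectorBasis hn i
  have hlpos : ∀ i, 0 < l i := by
    intro i
    have h1 := hp (v i) (v.orthonormal.ne_zero i)
    rw [hPv, inner_smul_right, real_inner_self_eq_norm_sq, v.orthonormal.1 i] at h1
    simpa using h1
  have hspec : ∀ i, l i ∈ spectrum ℝ P := by
    intro i hu
    obtain ⟨u, hu⟩ := hu
    have h1 : (u : Mat d) (v i) = 0 := by
      rw [hu]
      simp [Algebra.algebraMap_eq_smul_one, hPv]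
    have h2 : ((↑u⁻¹ : Mat d) * (u : Mat d)) (v i) = 0 := by
      rw [mul_apply_eq_comp, h1, map_zero]
    rw [Units.inv_mul] at h2
    exact v.orthonormal.ne_zero i (by simpa using h2)
  have hrange : ∀ μ ∈ spectrum ℝ P, ∃ i, μ = l i := by
    intro μ hμ
    by_contra! hne
    apply hμ
    -- If μ is none of the eigenvalues `l i`, a kernel vector of μ − P is orthogonal to the whole
    -- eigenbasis.
    have hinj : Function.Injective (algebraMap ℝ (Mat d) μ - P) := by
      rw [injective_iff_map_eq_zero]
      intro x hx
      have h3 : ∀ i, inner ℝ (v i) x = 0 := by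
        intro i
        have h4 : inner ℝ (v i) ((algebraMap ℝ (Mat d) μ - P) x) = 0 := by rw [hx, inner_zero_right]
        have h5 : inner ℝ (v i) (P x) = l i * inner ℝ (v i) x := by
          rw [← ContinuousLinearMap.adjoint_inner_left, ← ContinuousLinearMap.star_eq_adjoint,
            hs.star_eq, hPv, inner_smul_left]; simp
        rw [sub_apply, inner_sub_right, h5] at h4
        simp only [Algebra.algebraMap_eq_smul_one, smul_apply,
          one_apply_eq_self, inner_smul_right] at h4
        rw [← sub_mul] at h4
        exact (mul_eq_zero.1 h4).resolve_left (sub_ne_zero.2 (hne i))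
      rw [← v.sum_repr' x]
      simp [h3]
    change IsUnit _
    rw [ContinuousLinearMap.isUnit_iff_bijective]
    exact ⟨hinj, (LinearMap.injective_iff_surjective
      (f := ((algebraMap ℝ (Mat d) μ - P : Mat d) : Vec d →ₗ[ℝ] Vec d))).1 hinj⟩
  have hset : spectrum ℝ P = Set.range l := by
    ext μ
    exact ⟨fun h => (hrange μ h).imp fun i hi => hi.symm, by rintro ⟨i, rfl⟩; exact hspec i⟩
  have hfin : (Set.range l).Finite := Set.finite_range l
  have hne : (Set.range l).Nonempty := ⟨l ⟨0, by omega⟩, Set.mem_range_self _⟩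
  obtain ⟨imin, himin⟩ := hne.csInf_mem hfin
  obtain ⟨imax, himax⟩ := hne.csSup_mem hfin
  have hle : ∀ i, l imin ≤ l i := fun i => by
    rw [himin]; exact csInf_le hfin.bddBelow (Set.mem_range_self i)
  have hge : ∀ i, l i ≤ l imax := fun i => by
    rw [himax]; exact le_csSup hfin.bddAbove (Set.mem_range_self i)
  have hcond : condNumber P = l imax / l imin := by
    rw [condNumber, hset, ← himin, ← himax]
  have hP : ∀ x, P x = ∑ i, (l i * inner ℝ (v i) x) • v i := by
    intro x
    conv_lhs => rw [← v.sum_repr' x]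
    rw [map_sum]
    refine Finset.sum_congr rfl fun i _ => ?_
    rw [map_smul, hPv, smul_smul, mul_comm]
  have hq : ∀ x, inner ℝ x (P x) = ∑ i, l i * inner ℝ (v i) x ^ 2 := by
    intro x
    rw [hP, inner_sum]
    refine Finset.sum_congr rfl fun i _ => ?_
    rw [inner_smul_right, real_inner_comm]; ring
  have hnorm : ∀ x : Vec d, ‖x‖ ^ 2 = ∑ i, inner ℝ (v i) x ^ 2 := by
    intro x
    rw [← v.sum_sq_norm_inner_right x]
    simp
  have hnormP : ‖P‖ ≤ l imax := by
    refine ContinuousLinearMap.opNorm_le_bound _ (hlpos _).le fun x => ?_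
    refine le_of_sq_le_sq ?_ (by have := hlpos imax; positivity)
    rw [mul_pow, hnorm x, hnorm (P x), Finset.mul_sum]
    refine Finset.sum_le_sum fun i _ => ?_
    have h5 : inner ℝ (v i) (P x) = l i * inner ℝ (v i) x := by
      rw [← ContinuousLinearMap.adjoint_inner_left, ← ContinuousLinearMap.star_eq_adjoint,
        hs.star_eq, hPv, inner_smul_left]; simp
    rw [h5, mul_pow]
    have := hge i
    have := (hlpos i).le
    gcongr
  have hlb : ∀ x, l imin * ‖x‖ ^ 2 ≤ inner ℝ x (P x) := by
    intro x
    rw [hq, hnorm, Finset.mul_sum]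
    exact Finset.sum_le_sum fun i _ => mul_le_mul_of_nonneg_right (hle i) (sq_nonneg _)
  refine ⟨?_, ?_, ?_⟩
  · rw [hcond, one_le_div (hlpos _)]; exact hle _
  · rw [norm_pos_iff]
    rintro rfl
    have := hp (v imin) (v.orthonormal.ne_zero _)
    simp at this
  · intro x
    rw [hcond, div_mul_eq_mul_div, le_div_iff₀ (hlpos _)]
    have h1 := hlb x
    have h2 := (hlpos imax).le
    have h3 := (hlpos imin).le
    calc ‖P‖ * ‖x‖ ^ 2 * l imin ≤ l imax * ‖x‖ ^ 2 * l imin := by gcongr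
      _ = l imax * (l imin * ‖x‖ ^ 2) := by ring
      _ ≤ _ := by gcongr

/-- The inner product `(x, y) ↦ 2 a ⟨x, P y⟩` for the Lyapunov solution `P` of `M`. -/
structure IsAdaptedForm (M : Mat d) (a κ : ℝ) (P : Mat d) : Prop where
  a_pos : 0 < a
  one_le_kappa : 1 ≤ κ
  symm : ∀ x y : Vec d, inner ℝ x (P y) = inner ℝ y (P x)
  le_norm : ∀ x : Vec d, inner ℝ x (P x) ≤ ‖x‖ ^ 2
  norm_le : ∀ x : Vec d, ‖x‖ ^ 2 ≤ κ * inner ℝ x (P x)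
  inner_eq : ∀ x : Vec d, inner ℝ x (P (M x)) = a * ‖x‖ ^ 2

/-- Scaling by 2a = ‖Q‖⁻¹ makes the form at most the Euclidean one, so pathwise Euclidean bounds
pass to it at no cost, and turns the Lyapunov equation into an exact drift a‖x‖². The factor κ is
paid only when returning to the Euclidean norm. -/
lemma exists_isAdaptedForm (hd : 1 ≤ d) {M : Mat d} (hM : IsHurwitz (-M)) :
    ∃ P, IsAdaptedForm M (decayRate M) (kappa M) P := by
  have h := isLyapunovSolution_lyapunov hd hM
  obtain ⟨h1, h2, h3⟩ := condNumber_bounds hd h.symm h.posDef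
  have ha : 2 * decayRate M * ‖lyapunov M‖ = 1 := by
    rw [decayRate]; field_simp
  have hapos : 0 < decayRate M := by rw [decayRate]; positivity
  refine ⟨(2 * decayRate M) • lyapunov M, hapos, h1, fun x y => ?_, fun x => ?_, fun x => ?_,
    fun x => ?_⟩
  · simp only [smul_apply, inner_smul_right, h.inner_comm x y]
  · simp only [smul_apply, inner_smul_right]
    calc 2 * decayRate M * inner ℝ x (lyapunov M x)
        ≤ 2 * decayRate M * (‖x‖ * (‖lyapunov M‖ * ‖x‖)) := by
          gcongr
          exact (real_inner_le_norm _ _).trans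
            (mul_le_mul_of_nonneg_left (ContinuousLinearMap.le_opNorm _ _) (norm_nonneg _))
      _ = 2 * decayRate M * ‖lyapunov M‖ * ‖x‖ ^ 2 := by ring
      _ = ‖x‖ ^ 2 := by rw [ha, one_mul]
  · simp only [smul_apply, inner_smul_right]
    calc ‖x‖ ^ 2 = 2 * decayRate M * (‖lyapunov M‖ * ‖x‖ ^ 2) := by rw [← mul_assoc, ha, one_mul]
      _ ≤ 2 * decayRate M * (condNumber (lyapunov M) * inner ℝ x (lyapunov M x)) := by
          exact mul_le_mul_of_nonneg_left (h3 x) (by positivity)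
      _ = _ := by rw [kappa]; ring
  · simp only [smul_apply, inner_smul_right]
    rw [← h.inner_eqn x]; ring

lemma IsAdaptedForm.nonneg {M P : Mat d} {a κ : ℝ} (h : IsAdaptedForm M a κ P) (x : Vec d) :
    0 ≤ inner ℝ x (P x) := by
  have h1 := h.norm_le x
  have h2 := h.one_le_kappa
  by_contra! h3
  nlinarith [sq_nonneg ‖x‖]

/-- Cauchy–Schwarz for the form, by the discriminant of t ↦ form(x + t y). -/
lemma IsAdaptedForm.inner_sq_le {M P : Mat d} {a κ : ℝ} (h : IsAdaptedForm M a κ P)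
    (x y : Vec d) : inner ℝ x (P y) ^ 2 ≤ inner ℝ x (P x) * inner ℝ y (P y) := by
  have h1 : ∀ t : ℝ, 0 ≤ inner ℝ y (P y) * (t * t) + (2 * inner ℝ x (P y)) * t
      + inner ℝ x (P x) := by
    intro t
    have := h.nonneg (x + t • y)
    simp only [map_add, map_smul, inner_add_left, inner_add_right, inner_smul_left,
      inner_smul_right, h.symm y x, RCLike.conj_to_real] at this
    linarith
  have := discrim_le_zero h1
  rw [discrim] at this
  linarith

lemma IsAdaptedForm.abs_inner_le {M P : Mat d} {a κ : ℝ} (h : IsAdaptedForm M a κ P)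
    (x y : Vec d) : |inner ℝ x (P y)| ≤ ‖x‖ * ‖y‖ := by
  refine abs_le_of_sq_le_sq ?_ (by positivity)
  rw [mul_pow]
  exact (h.inner_sq_le x y).trans
    (mul_le_mul (h.le_norm x) (h.le_norm y) (h.nonneg y) (sq_nonneg _))

lemma IsAdaptedForm.a_le {M P : Mat d} {a κ CA : ℝ} (h : IsAdaptedForm M a κ P) (hd : 1 ≤ d)
    (hM : ‖M‖ ≤ CA) : a ≤ CA := by
  have : Nonempty (Fin d) := ⟨⟨0, by omega⟩⟩
  obtain ⟨x, hx⟩ := exists_ne (0 : Vec d)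
  have hx' : 0 < ‖x‖ ^ 2 := by positivity
  have h1 := (le_abs_self _).trans (h.abs_inner_le x (M x))
  rw [h.inner_eq] at h1
  have h2 : ‖x‖ * ‖M x‖ ≤ CA * ‖x‖ ^ 2 := by
    calc ‖x‖ * ‖M x‖ ≤ ‖x‖ * (CA * ‖x‖) := by
          gcongr
          exact (M.le_opNorm x).trans (by gcongr)
      _ = _ := by ring
  exact le_of_mul_le_mul_right (h1.trans h2) hx'

end LyapunovTheory

/-! ### The Markov property of the canonical chain -/

section ConditionalChain

variable {Z : Type u} [MeasurableSpace Z]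

/-- The one-step transitions of the canonical chain, as kernels from the past. -/
abbrev pastKernel (Q : Kernel Z Z) (n : ℕ) : Kernel (∀ _ : Finset.Iic n, Z) Z :=
  Q.comap (fun h : (∀ _ : Finset.Iic n, Z) => h ⟨n, Finset.mem_Iic.2 le_rfl⟩)
    (measurable_pi_apply _)

/-- The conditional law of the canonical chain given its trajectory up to time `k`. -/
def condChain (Q : Kernel Z Z) [IsMarkovKernel Q] (k : ℕ) : Kernel (ℕ → Z) (ℕ → Z) :=
  (Kernel.traj (X := fun _ => Z) (pastKernel Q) k).comap (Preorder.frestrictLe (π := fun _ => Z) k)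
    (by fun_prop)

variable (Q : Kernel Z Z) [IsMarkovKernel Q]

instance (k : ℕ) : IsMarkovKernel (condChain Q k) := by
  unfold condChain; infer_instance

instance isProbabilityMeasure_chainLaw (ξ : Measure Z) [IsProbabilityMeasure ξ] :
    IsProbabilityMeasure (chainLaw Q ξ) := by
  unfold chainLaw; infer_instance

/-- The tower property: resampling the future after time k from its conditional law does not change
the law of the chain. Every conditional argument below enters through this identity. -/
lemma condChain_comp_chainLaw (ξ : Measure Z) (k : ℕ) :
    (condChain Q k) ∘ₘ (chainLaw Q ξ) = chainLaw Q ξ := by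
  have h1 : (condChain Q k) ∘ₘ (chainLaw Q ξ) =
      (Kernel.traj (X := fun _ => Z) (pastKernel Q) k) ∘ₘ
        ((chainLaw Q ξ).map (Preorder.frestrictLe (π := fun _ => Z) k)) := by
    rw [← Measure.deterministic_comp_eq_map (by fun_prop), Measure.comp_assoc,
      Kernel.comp_deterministic_eq_comap]
    rfl
  rw [h1, chainLaw, Kernel.trajMeasure, Measure.map_comp _ _ (by fun_prop),
    Kernel.traj_map_frestrictLe, Measure.comp_assoc, Kernel.traj_comp_partialTraj (Nat.zero_le k)]

lemma condChain_comp_condChain {k l : ℕ} (h : k ≤ l) :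
    (condChain Q l) ∘ₖ (condChain Q k) = condChain Q k := by
  have h1 : (condChain Q l) ∘ₖ (condChain Q k) =
      ((Kernel.traj (X := fun _ => Z) (pastKernel Q) l) ∘ₖ
        ((Kernel.traj (X := fun _ => Z) (pastKernel Q) k).map
          (Preorder.frestrictLe (π := fun _ => Z) l))).comap
            (Preorder.frestrictLe (π := fun _ => Z) k) (by fun_prop) := by
    ext ω s hs
    rw [← Kernel.deterministic_comp_eq_map (by fun_prop), ← Kernel.comp_assoc,
      Kernel.comp_deterministic_eq_comap]
    simp only [Kernel.comap_apply, Kernel.comp_apply]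
    rfl
  rw [h1, Kernel.traj_map_frestrictLe, Kernel.traj_comp_partialTraj h]
  rfl

lemma condChain_map_succ (k : ℕ) :
    (condChain Q k).map (fun ω => ω (k + 1)) = Q.comap (fun ω : ℕ → Z => ω k)
      (measurable_pi_apply k) := by
  have h1 := Kernel.map_traj_succ_self (X := fun _ => Z) (κ := pastKernel Q) (a := k)
  ext ω : 1
  rw [Kernel.map_apply _ (measurable_pi_apply _), condChain, Kernel.comap_apply,
    ← Kernel.map_apply _ (measurable_pi_apply (k + 1)), h1]
  rfl

/-- The conditional law is carried by paths sharing the given past. Quantities that depend on the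
path up to time k may thus be frozen pointwise, which takes the place of a filtration. -/
lemma ae_condChain_eq [MeasurableSingletonClass Z] (k : ℕ) (ω : ℕ → Z) :
    ∀ᵐ ω' ∂(condChain Q k ω), ∀ j ≤ k, ω' j = ω j := by
  have h1 := Kernel.traj_map_updateFinset (X := fun _ => Z) (κ := pastKernel Q)
    (Preorder.frestrictLe (π := fun _ => Z) k ω)
  rw [condChain, Kernel.comap_apply, ← h1, ae_map_iff]
  · refine Filter.Eventually.of_forall fun ω' j hj => ?_
    simp [Function.updateFinset, hj]
  · exact measurable_updateFinset_left.aemeasurable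
  · have : {x : ℕ → Z | ∀ j ≤ k, x j = ω j} = ⋂ j, ⋂ (_ : j ≤ k), (fun x => x j) ⁻¹' {ω j} := by
      ext; simp
    rw [this]
    exact MeasurableSet.iInter fun j => MeasurableSet.iInter fun _ =>
      (measurable_pi_apply j) (measurableSet_singleton _)

/-- The Markov property. The induction conditions once more at time k + j and takes one step. -/
lemma condChain_map_add [MeasurableSingletonClass Z] (k j : ℕ) (ω : ℕ → Z) :
    (condChain Q k ω).map (fun ω' => ω' (k + j)) = (Q ^ j) (ω k) := by
  induction j with
  | zero =>
    rw [pow_zero]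
    have h1 : (fun ω' : ℕ → Z => ω' (k + 0)) =ᵐ[condChain Q k ω] fun _ => ω k := by
      filter_upwards [ae_condChain_eq Q k ω] with ω' h using h k le_rfl
    rw [Measure.map_congr h1, Measure.map_const, measure_univ, one_smul]
    rfl
  | succ j ih =>
    rw [pow_succ', ← condChain_comp_condChain Q (Nat.le_add_right k j), Kernel.comp_apply,
      Measure.map_comp _ _ (measurable_pi_apply _)]
    have h2 := condChain_map_succ Q (k + j)
    rw [add_assoc] at h2
    have h3 : (Q * Q ^ j) (ω k) = Q ∘ₘ ((Q ^ j) (ω k)) := Kernel.comp_apply _ _ _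
    rw [h2, h3, ← ih, ← Measure.deterministic_comp_eq_map (measurable_pi_apply (k + j)),
      Measure.comp_assoc, Kernel.comp_deterministic_eq_comap]

lemma chainLaw_map_zero (ξ : Measure Z) [IsProbabilityMeasure ξ] :
    (chainLaw Q ξ).map (fun ω => ω 0) = ξ := by
  have h : (fun ω : ℕ → Z => ω 0) = (fun h : (∀ _ : Finset.Iic 0, Z) =>
      h ⟨0, Finset.mem_Iic.2 le_rfl⟩) ∘ (Preorder.frestrictLe (π := fun _ => Z) 0) := rfl
  rw [h, ← Measure.map_map (by fun_prop) (by fun_prop), chainLaw, Kernel.trajMeasure,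
    Measure.map_comp _ _ (by fun_prop), Kernel.traj_map_frestrictLe, Kernel.partialTraj_self,
    Measure.id_comp, Measure.map_map (by fun_prop) (by fun_prop)]
  exact Measure.map_id

lemma lintegral_chainLaw_condChain (ξ : Measure Z) (k : ℕ) {F : (ℕ → Z) → ℝ≥0∞}
    (hF : Measurable F) :
    ∫⁻ ω, F ω ∂(chainLaw Q ξ) = ∫⁻ ω, ∫⁻ ω', F ω' ∂(condChain Q k ω) ∂(chainLaw Q ξ) := by
  conv_lhs => rw [← condChain_comp_chainLaw Q ξ k]
  exact Measure.lintegral_bind (Kernel.aemeasurable _) hF.aemeasurable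

variable {E : Type*} [NormedAddCommGroup E] [NormedSpace ℝ E]

lemma integral_condChain_add [MeasurableSingletonClass Z] (k j : ℕ) (ω : ℕ → Z) {f : Z → E}
    (hf : StronglyMeasurable f) :
    ∫ ω', f (ω' (k + j)) ∂(condChain Q k ω) = ∫ z, f z ∂((Q ^ j) (ω k)) := by
  rw [← condChain_map_add Q k j ω,
    integral_map (measurable_pi_apply _).aemeasurable hf.aestronglyMeasurable]

end ConditionalChain

/-! ### Mixing and the Poisson equation -/

section Mixing

variable {Z : Type u} [MeasurableSpace Z]
variable {E : Type*} [NormedAddCommGroup E] [NormedSpace ℝ E]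

omit [NormedSpace ℝ E] in
lemma integrable_of_bound {Ω : Type*} [MeasurableSpace Ω] {μ : Measure Ω} [IsFiniteMeasure μ]
    {f : Ω → E} (hf : StronglyMeasurable f) {F : ℝ} (hF : ∀ z, ‖f z‖ ≤ F) : Integrable f μ :=
  Integrable.of_bound hf.aestronglyMeasurable F (Filter.Eventually.of_forall hF)

lemma norm_integral_le_of_bound {Ω : Type*} [MeasurableSpace Ω] {μ : Measure Ω}
    [IsProbabilityMeasure μ] {f : Ω → E} {F : ℝ} (hF : ∀ z, ‖f z‖ ≤ F) :
    ‖∫ z, f z ∂μ‖ ≤ F := by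
  have := norm_integral_le_of_norm_le_const (μ := μ) (Filter.Eventually.of_forall hF)
  simpa using this

/-- Integrals of a bounded function against two probability measures differ by at most the total
variation distance. -/
lemma norm_integral_sub_integral_le_totalVariation (μ ν : Measure Z) [IsProbabilityMeasure μ]
    [IsProbabilityMeasure ν] {f : Z → E} (hf : StronglyMeasurable f) {F : ℝ}
    (hF : ∀ z, ‖f z‖ ≤ F) :
    ‖∫ z, f z ∂μ - ∫ z, f z ∂ν‖ ≤
      F * ((μ.toSignedMeasure - ν.toSignedMeasure).totalVariation Set.univ).toReal := by
  set s := μ.toSignedMeasure - ν.toSignedMeasure with hs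
  set j := s.toJordanDecomposition with hj
  have h1 : j.posPart.toSignedMeasure - j.negPart.toSignedMeasure = s :=
    SignedMeasure.toSignedMeasure_toJordanDecomposition s
  -- The Jordan decomposition is rewritten as an equality of positive measures, against which
  -- integrals add.
  have h2 : μ + j.negPart = ν + j.posPart := by
    rw [← Measure.toSignedMeasure_eq_toSignedMeasure_iff, Measure.toSignedMeasure_add,
      Measure.toSignedMeasure_add]
    rw [hs] at h1
    rw [← sub_eq_zero] at h1 ⊢
    rw [← neg_eq_zero, ← h1]
    abel
  have hint : ∀ (ρ : Measure Z) [IsFiniteMeasure ρ], Integrable f ρ :=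
    fun ρ _ => integrable_of_bound hf hF
  have h3 : ∫ z, f z ∂μ - ∫ z, f z ∂ν = ∫ z, f z ∂j.posPart - ∫ z, f z ∂j.negPart := by
    have h4 := congrArg (fun ρ => ∫ z, f z ∂ρ) h2
    rw [integral_add_measure (hint _) (hint _), integral_add_measure (hint _) (hint _)] at h4
    rw [sub_eq_sub_iff_add_eq_add, h4, add_comm]
  have hb : ∀ (ρ : Measure Z) [IsFiniteMeasure ρ], ‖∫ z, f z ∂ρ‖ ≤ F * (ρ Set.univ).toReal :=
    fun ρ _ => norm_integral_le_of_norm_le_const (Filter.Eventually.of_forall hF)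
  rw [h3, SignedMeasure.totalVariation, Measure.add_apply,
    ENNReal.toReal_add (measure_ne_top _ _) (measure_ne_top _ _), mul_add]
  exact (norm_sub_le _ _).trans (add_le_add (hb _) (hb _))

lemma integral_comp_measure {X Y : Type*} [MeasurableSpace X] [MeasurableSpace Y]
    {κ : Kernel X Y} {μ : Measure X} {f : Y → E} (hf : Integrable f (κ ∘ₘ μ)) :
    ∫ y, f y ∂(κ ∘ₘ μ) = ∫ x, ∫ y, f y ∂(κ x) ∂μ := by
  have h1 : κ ∘ₘ μ = (κ ∘ₖ Kernel.const Unit μ) () := by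
    rw [Kernel.comp_apply, Kernel.const_apply]
  rw [h1] at hf ⊢
  rw [Kernel.integral_comp hf, Kernel.const_apply]

variable {Q : Kernel Z Z} [IsMarkovKernel Q] {π : Measure Z} [IsProbabilityMeasure π] {t : ℕ}

/-- The function `z ↦ Q^j f (z)`. -/
def kernelAvg (Q : Kernel Z Z) (f : Z → E) (j : ℕ) (z : Z) : E := ∫ w, f w ∂((Q ^ j) z)

omit [IsMarkovKernel Q] in
lemma stronglyMeasurable_kernelAvg {f : Z → E} (hf : StronglyMeasurable f) (j : ℕ) :
    StronglyMeasurable (kernelAvg Q f j) :=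
  hf.integral_kernel

omit [IsMarkovKernel Q] in
lemma kernelAvg_zero [CompleteSpace E] {f : Z → E} (hf : StronglyMeasurable f) :
    kernelAvg Q f 0 = f := by
  ext z
  simp only [kernelAvg, pow_zero]
  exact integral_dirac' _ _ hf

lemma integral_kernelAvg {f : Z → E} (hf : StronglyMeasurable f) {F : ℝ}
    (hF : ∀ z, ‖f z‖ ≤ F) (j : ℕ) (z : Z) :
    ∫ w, kernelAvg Q f j w ∂(Q z) = kernelAvg Q f (j + 1) z := by
  have : (Q ^ (j + 1)) z = (Q ^ j) ∘ₘ (Q z) := by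
    rw [pow_succ]; exact Kernel.comp_apply _ _ _
  rw [kernelAvg, this, integral_comp_measure]
  · rfl
  · exact integrable_of_bound hf hF

omit [IsProbabilityMeasure π] in
lemma UniformlyGeometricallyErgodic.invariant_pow (h : UniformlyGeometricallyErgodic Q π t)
    (j : ℕ) : (Q ^ j) ∘ₘ π = π := by
  induction j with
  | zero => rw [pow_zero]; exact Measure.id_comp
  | succ j ih =>
    have : Q ^ (j + 1) = (Q ^ j) ∘ₖ Q := pow_succ _ _
    have h2 : Q ∘ₘ π = π := h.invariant
    rw [this, ← Measure.comp_assoc, h2, ih]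

omit [IsProbabilityMeasure π] in
lemma UniformlyGeometricallyErgodic.norm_kernelAvg_sub_le
    (h : UniformlyGeometricallyErgodic Q π t) {f : Z → E} (hf : StronglyMeasurable f) {F : ℝ}
    (hF : ∀ z, ‖f z‖ ≤ F) {j : ℕ} (hj : 1 ≤ j) (z z' : Z) :
    ‖kernelAvg Q f j z - kernelAvg Q f j z'‖ ≤ 2 * F * (1 / 4) ^ (j / t) := by
  have hF0 : 0 ≤ F := (norm_nonneg _).trans (hF z)
  refine (norm_integral_sub_integral_le_totalVariation _ _ hf hF).trans ?_
  have h1 := h.mixing j hj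
  have h2 : (1 / 2) * (((Q ^ j) z).toSignedMeasure
      - ((Q ^ j) z').toSignedMeasure).totalVariation Set.univ ≤ (1 / 4 : ℝ≥0∞) ^ (j / t) :=
    (le_iSup₂ (f := fun z z' => (1 / 2) * (((Q ^ j) z).toSignedMeasure
      - ((Q ^ j) z').toSignedMeasure).totalVariation Set.univ) z z').trans h1
  have h3 := ENNReal.toReal_mono (by finiteness) h2
  rw [ENNReal.toReal_mul, ENNReal.toReal_pow] at h3
  norm_num at h3
  have : ((((Q ^ j) z).toSignedMeasure
      - ((Q ^ j) z').toSignedMeasure).totalVariation Set.univ).toReal ≤ 2 * (1 / 4) ^ (j / t) := by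
    norm_num; linarith
  calc _ ≤ F * (2 * (1 / 4) ^ (j / t)) := by gcongr
    _ = _ := by ring

/-- By invariance Q^j f has π-mean zero, so Q^j f(z) is the π-average over z' of the differences Q^j
f(z) − Q^j f(z'). The case j = 0, which the mixing hypothesis does not cover, is trivial. -/
lemma UniformlyGeometricallyErgodic.norm_kernelAvg_le [CompleteSpace E]
    (h : UniformlyGeometricallyErgodic Q π t) {f : Z → E} (hf : StronglyMeasurable f) {F : ℝ}
    (hF : ∀ z, ‖f z‖ ≤ F) (h0 : ∫ z, f z ∂π = 0) (j : ℕ) (z : Z) :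
    ‖kernelAvg Q f j z‖ ≤ 2 * F * (1 / 4) ^ (j / t) := by
  have hF0 : 0 ≤ F := (norm_nonneg _).trans (hF z)
  rcases Nat.eq_zero_or_pos j with rfl | hj
  · rw [kernelAvg_zero hf]
    simp only [Nat.zero_div, pow_zero]
    linarith [hF z]
  have hb : ∀ z, ‖kernelAvg Q f j z‖ ≤ F := fun z => norm_integral_le_of_bound hF
  have h1 : ∫ z', kernelAvg Q f j z' ∂π = 0 := by
    rw [← h0]
    conv_rhs => rw [← h.invariant_pow j]
    rw [integral_comp_measure]
    · rfl
    · exact integrable_of_bound hf hF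
  have h2 : kernelAvg Q f j z = ∫ z', (kernelAvg Q f j z - kernelAvg Q f j z') ∂π := by
    rw [integral_sub (integrable_const _)
      (integrable_of_bound (stronglyMeasurable_kernelAvg hf j) hb), h1]
    simp
  rw [h2]
  exact norm_integral_le_of_bound fun z' => h.norm_kernelAvg_sub_le hf hF hj z z'

/-- The exponent is constant on blocks of length t, so the sum is at most t Σ 4⁻ⁱ. -/
lemma sum_range_quarter_pow_div_le (ht : 0 < t) (J : ℕ) :
    ∑ j ∈ Finset.range J, (1 / 4 : ℝ) ^ (j / t) ≤ 4 / 3 * t := by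
  have h1 : ∀ n : ℕ, ∑ j ∈ Finset.range (t * n), (1 / 4 : ℝ) ^ (j / t)
      = t * ∑ i ∈ Finset.range n, (1 / 4 : ℝ) ^ i := by
    intro n
    induction n with
    | zero => simp
    | succ n ih =>
      rw [Nat.mul_succ, Finset.sum_range_add, ih, Finset.sum_range_succ, mul_add]
      congr 1
      rw [Finset.sum_congr rfl (g := fun _ => (1 / 4 : ℝ) ^ n)]
      · simp
      · intro r hr
        rw [Nat.mul_add_div ht, Nat.div_eq_of_lt (Finset.mem_range.1 hr), add_zero]
  calc ∑ j ∈ Finset.range J, (1 / 4 : ℝ) ^ (j / t)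
      ≤ ∑ j ∈ Finset.range (t * J), (1 / 4 : ℝ) ^ (j / t) := by
        refine Finset.sum_le_sum_of_subset_of_nonneg ?_ fun _ _ _ => by positivity
        exact Finset.range_mono (Nat.le_mul_of_pos_left J ht)
    _ = t * ∑ i ∈ Finset.range J, (1 / 4 : ℝ) ^ i := h1 J
    _ ≤ t * (4 / 3) := by
        gcongr
        have := (summable_geometric_of_lt_one (r := (1 / 4 : ℝ)) (by norm_num)
          (by norm_num)).sum_le_tsum (Finset.range J) fun _ _ => by positivity
        rw [tsum_geometric_of_lt_one (by norm_num) (by norm_num)] at this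
        norm_num at this ⊢
        exact this
    _ = _ := by ring

lemma summable_quarter_pow_div (ht : 0 < t) : Summable fun j : ℕ => (1 / 4 : ℝ) ^ (j / t) :=
  summable_of_sum_range_le (fun _ => by positivity) (sum_range_quarter_pow_div_le ht)

lemma tsum_quarter_pow_div_le (ht : 0 < t) : ∑' j : ℕ, (1 / 4 : ℝ) ^ (j / t) ≤ 4 / 3 * t :=
  Real.tsum_le_of_sum_range_le (fun _ => by positivity) (sum_range_quarter_pow_div_le ht)

/-- The solution `∑_j Q^j f` of the Poisson equation `g - Q g = f`. -/
def poisson (Q : Kernel Z Z) (f : Z → E) (z : Z) : E := ∑' j, kernelAvg Q f j z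

variable [CompleteSpace E]

section

variable (h : UniformlyGeometricallyErgodic Q π t) {f : Z → E} (hf : StronglyMeasurable f) {F : ℝ}
  (hF : ∀ z, ‖f z‖ ≤ F) (h0 : ∫ z, f z ∂π = 0)
include h hf hF h0

lemma UniformlyGeometricallyErgodic.summable_norm_kernelAvg (z : Z) :
    Summable fun j => ‖kernelAvg Q f j z‖ :=
  Summable.of_nonneg_of_le (fun _ => norm_nonneg _) (fun j => h.norm_kernelAvg_le hf hF h0 j z)
    ((summable_quarter_pow_div h.tmix_pos).mul_left _)

lemma UniformlyGeometricallyErgodic.hasSum_poisson (z : Z) :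
    HasSum (fun j => kernelAvg Q f j z) (poisson Q f z) :=
  (h.summable_norm_kernelAvg hf hF h0 z).of_norm.hasSum

lemma UniformlyGeometricallyErgodic.norm_poisson_le (z : Z) : ‖poisson Q f z‖ ≤ 3 * t * F := by
  have hF0 : 0 ≤ F := (norm_nonneg _).trans (hF z)
  calc ‖poisson Q f z‖ ≤ ∑' j, ‖kernelAvg Q f j z‖ :=
        norm_tsum_le_tsum_norm (h.summable_norm_kernelAvg hf hF h0 z)
    _ ≤ ∑' j : ℕ, 2 * F * (1 / 4 : ℝ) ^ (j / t) :=
        Summable.tsum_le_tsum (fun j => h.norm_kernelAvg_le hf hF h0 j z)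
          (h.summable_norm_kernelAvg hf hF h0 z)
          ((summable_quarter_pow_div h.tmix_pos).mul_left _)
    _ = 2 * F * ∑' j : ℕ, (1 / 4 : ℝ) ^ (j / t) := tsum_mul_left
    _ ≤ 2 * F * (4 / 3 * t) := by gcongr; exact tsum_quarter_pow_div_le h.tmix_pos
    _ ≤ _ := by have : 0 ≤ (t : ℝ) * F := by positivity
                linarith

lemma UniformlyGeometricallyErgodic.stronglyMeasurable_poisson :
    StronglyMeasurable (poisson Q f) := by
  refine stronglyMeasurable_of_tendsto Filter.atTop
    (f := fun n z => ∑ j ∈ Finset.range n, kernelAvg Q f j z) (fun n => ?_) ?_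
  · exact Finset.stronglyMeasurable_fun_sum _ fun j _ => stronglyMeasurable_kernelAvg hf j
  · rw [tendsto_pi_nhds]
    exact fun z => (h.hasSum_poisson hf hF h0 z).tendsto_sum_nat

/-- Applying Q shifts the defining series by one index, which removes its zeroth term f; the
geometric bound justifies integrating term by term. -/
lemma UniformlyGeometricallyErgodic.integral_poisson (z : Z) :
    ∫ w, poisson Q f w ∂(Q z) = poisson Q f z - f z := by
  have hF0 : 0 ≤ F := (norm_nonneg _).trans (hF z)
  have h1 : HasSum (fun j => ∫ w, kernelAvg Q f j w ∂(Q z)) (∫ w, poisson Q f w ∂(Q z)) := by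
    refine hasSum_integral_of_summable_integral_norm
      (fun j => integrable_of_bound (stronglyMeasurable_kernelAvg hf j)
        fun w => norm_integral_le_of_bound hF) ?_
    refine Summable.of_nonneg_of_le (fun j => integral_nonneg fun _ => norm_nonneg _) (fun j => ?_)
      ((summable_quarter_pow_div h.tmix_pos).mul_left (2 * F))
    refine (le_abs_self _).trans ?_
    rw [← Real.norm_eq_abs]
    refine norm_integral_le_of_bound fun w => ?_
    rw [norm_norm]
    exact h.norm_kernelAvg_le hf hF h0 j w
  simp only [integral_kernelAvg hf hF] at h1
  have h2 := (hasSum_nat_add_iff (f := fun j => kernelAvg Q f j z) 1).1 h1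
  have h3 := h2.unique (h.hasSum_poisson hf hF h0 z)
  rw [← h3, Finset.sum_range_one, kernelAvg_zero hf]
  abel

end

end Mixing

/-! ### Two-point inequalities for powers and for cosh -/

section PointwiseInequalities

lemma exp_le_add_exp_sq (v : ℝ) : Real.exp v ≤ v + Real.exp (v ^ 2) := by
  have h1 := Real.add_one_le_exp (v ^ 2)
  rcases le_or_gt |v| 1 with h | h
  · have := (abs_le.1 (Real.abs_exp_sub_one_sub_id_le h)).2
    linarith
  · rcases lt_abs.1 h with h | h
    · have : Real.exp v ≤ Real.exp (v ^ 2) := Real.exp_le_exp.2 (by nlinarith)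
      linarith
    · have : Real.exp v ≤ 1 := Real.exp_le_one_iff.2 (by linarith)
      nlinarith

/-- The exponential lies below its chord on [0, 6/5], whose slope is at most 2 because e^{6/5} ≤
17/5. -/
lemma exp_two_mul_le {s : ℝ} (h0 : 0 ≤ s) (h1 : s ≤ 3 / 5) : Real.exp (2 * s) ≤ 1 + 4 * s := by
  have h2 : Real.exp (6 / 5) ≤ 17 / 5 := by
    have h3 : Real.exp (1 / 5) ≤ 5 / 4 := by
      have := Real.one_sub_le_exp_neg (1 / 5)
      rw [Real.exp_neg] at this
      rw [← inv_inv (Real.exp (1 / 5)), inv_le_comm₀ (by positivity) (by norm_num)]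
      norm_num at this ⊢
      exact this
    have h4 := Real.exp_one_lt_d9
    have h5 : Real.exp (6 / 5) = Real.exp 1 * Real.exp (1 / 5) := by
      rw [← Real.exp_add]; norm_num
    rw [h5]
    nlinarith [Real.exp_pos 1, Real.exp_pos (1 / 5)]
  have h6 := convexOn_exp.2 (Set.mem_univ 0) (Set.mem_univ (6 / 5))
    (show (0 : ℝ) ≤ 1 - 5 / 3 * s by linarith) (show (0 : ℝ) ≤ 5 / 3 * s by linarith) (by ring)
  simp only [smul_eq_mul, mul_zero, zero_add, Real.exp_zero, mul_one] at h6
  rw [show 5 / 3 * s * (6 / 5) = 2 * s by ring] at h6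
  nlinarith

/-- The scale is s = 2qσ². For s ≤ 3/5 both sides are compared through exponentials: e^v ≤ v +
e^{v²} with v = 2qσ, and e^{v²} = (e^{2s})^q. For larger s one has |σ| ≤ s, and crude bounds
suffice. -/
lemma abs_one_add_rpow_le {q : ℝ} (hq : 1 ≤ q) (σ : ℝ) :
    ((1 + σ) ^ 2) ^ q - 2 * q * σ ≤ (1 + 8 * q * σ ^ 2) ^ q := by
  set s := 2 * q * σ ^ 2 with hs
  have hs0 : 0 ≤ s := by positivity
  have hσs : 2 * σ ^ 2 ≤ s := by nlinarith [sq_nonneg σ]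
  have e1 : 1 + 8 * q * σ ^ 2 = 1 + 4 * s := by rw [hs]; ring
  rw [e1]
  rcases le_or_gt s (3 / 5) with h | h
  · have hσ : -1 ≤ σ := by nlinarith
    have h1 : ((1 + σ) ^ 2) ^ q ≤ Real.exp (2 * q * σ) := by
      have h2 : (1 + σ) ^ 2 ≤ Real.exp (2 * σ) := by
        have := Real.add_one_le_exp σ
        calc (1 + σ) ^ 2 ≤ Real.exp σ ^ 2 := by
              apply pow_le_pow_left₀ (by linarith); linarith
          _ = _ := by rw [← Real.exp_nat_mul]; norm_num
      calc ((1 + σ) ^ 2) ^ q ≤ (Real.exp (2 * σ)) ^ q := by gcongr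
        _ = _ := by rw [← Real.exp_mul]; ring_nf
    have h3 : Real.exp ((2 * q * σ) ^ 2) ≤ (1 + 4 * s) ^ q := by
      calc Real.exp ((2 * q * σ) ^ 2) = (Real.exp (2 * s)) ^ q := by
            rw [← Real.exp_mul, hs]; ring_nf
        _ ≤ _ := by
            gcongr
            exact exp_two_mul_le hs0 h
    have h4 := exp_le_add_exp_sq (2 * q * σ)
    linarith
  · rcases le_or_gt 0 σ with h0 | h0
    · have h1 : σ ≤ s := by
        refine le_of_sq_le_sq ?_ hs0
        nlinarith
      have h2 : ((1 + σ) ^ 2) ^ q ≤ (1 + 4 * s) ^ q := by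
        gcongr
        nlinarith
      have : 0 ≤ 2 * q * σ := by positivity
      linarith
    · have h1 : -σ ≤ s := by
        refine le_of_sq_le_sq ?_ hs0
        nlinarith
      have h2 : ((1 + σ) ^ 2) ^ q ≤ (1 + s / 2) ^ q := by
        gcongr
        nlinarith
      set A := 1 + s / 2 with hA
      have hA1 : 1 ≤ A := by linarith
      -- For σ < 0 the term −2qσ ≤ 2qs must be absorbed. Bernoulli's inequality shows that passing
      -- from base 1 + s/2 to 1 + 4s gains at least (7/2)qs.
      have h3 : A ^ q + q * (7 / 2 * s) ≤ (1 + 4 * s) ^ q := by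
        have h4 : 1 + 4 * s = A * (1 + 7 / 2 * s / A) := by
          field_simp; rw [hA]; ring
        have h5 := one_add_mul_self_le_rpow_one_add (s := 7 / 2 * s / A) (p := q)
          (by have : 0 ≤ 7 / 2 * s / A := by positivity
              linarith) hq
        rw [h4, Real.mul_rpow (by positivity) (by positivity)]
        have h6 : A ≤ A ^ q := by
          calc A = A ^ (1 : ℝ) := (Real.rpow_one A).symm
            _ ≤ A ^ q := Real.rpow_le_rpow_of_exponent_le hA1 hq
        calc A ^ q + q * (7 / 2 * s) = A ^ q + A * (q * (7 / 2 * s / A)) := by field_simp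
          _ ≤ A ^ q + A ^ q * (q * (7 / 2 * s / A)) := by gcongr
          _ = A ^ q * (1 + q * (7 / 2 * s / A)) := by ring
          _ ≤ _ := by gcongr
      nlinarith

/-- With u = √y and |ρ| ≤ u, the number 1 + 2ρ + y is a convex combination of (1 + u)² and (1 − u)².
Convexity of x ↦ x^q therefore reduces to the collinear case `abs_one_add_rpow_le`. -/
lemma one_add_two_mul_add_rpow_le {q ρ y : ℝ} (hq : 1 ≤ q) (hρ : ρ ^ 2 ≤ y) :
    (1 + 2 * ρ + y) ^ q ≤ 2 * q * ρ + (1 + 8 * q * y) ^ q := by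
  have hy : 0 ≤ y := (sq_nonneg _).trans hρ
  set u := √y with hu
  have hu2 : u ^ 2 = y := Real.sq_sqrt hy
  have hu0 : 0 ≤ u := Real.sqrt_nonneg y
  rcases hu0.eq_or_lt with h0 | hpos
  · rw [← h0] at hu2
    have hy0 : y = 0 := by rw [← hu2]; ring
    subst hy0
    have : ρ = 0 := by nlinarith
    subst this
    simp
  have hρu : |ρ| ≤ u := abs_le_of_sq_le_sq (by rw [hu2]; exact hρ) hu0
  obtain ⟨hρ1, hρ2⟩ := abs_le.1 hρu
  set l := (1 + ρ / u) / 2 with hl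
  have hl0 : 0 ≤ l := by
    have : -1 ≤ ρ / u := by rw [le_div_iff₀ hpos]; linarith
    rw [hl]; linarith
  have hl1 : 0 ≤ 1 - l := by
    have : ρ / u ≤ 1 := by rw [div_le_one hpos]; exact hρ2
    rw [hl]; linarith
  have hlu : l * u - (1 - l) * u = ρ := by rw [hl]; field_simp; ring
  have h1 := (convexOn_rpow hq).2 (x := (1 + u) ^ 2) (y := (1 + -u) ^ 2)
    (Set.mem_Ici.2 (sq_nonneg _)) (Set.mem_Ici.2 (sq_nonneg _)) hl0 hl1 (by ring)
  simp only [smul_eq_mul] at h1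
  have h2 : l * (1 + u) ^ 2 + (1 - l) * (1 + -u) ^ 2 = 1 + 2 * ρ + y := by
    rw [← hlu, ← hu2]; ring
  rw [h2] at h1
  have h3 := abs_one_add_rpow_le hq u
  have h4 := abs_one_add_rpow_le hq (-u)
  rw [hu2] at h3
  rw [neg_sq, hu2] at h4
  have h5 := mul_le_mul_of_nonneg_left h3 hl0
  have h6 := mul_le_mul_of_nonneg_left h4 hl1
  have h7 : 2 * q * ρ = 2 * q * (l * u - (1 - l) * u) := by rw [hlu]
  linarith

/-- The two-point inequality behind the `2`-uniform smoothness of `L^{2q}` of a Hilbert space, where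
`X`, `r`, `Y` stand for `|x|²`, `⟨x, y⟩`, `|y|²`. -/
lemma add_two_mul_add_rpow_le {q X r Y : ℝ} (hq : 1 ≤ q) (hX : 0 ≤ X) (hY : 0 ≤ Y)
    (hr : r ^ 2 ≤ X * Y) :
    (X + 2 * r + Y) ^ q ≤ 2 * q * X ^ (q - 1) * r + (X + 8 * q * Y) ^ q := by
  rcases hX.eq_or_lt with rfl | hX
  · have : r = 0 := by nlinarith
    subst this
    simp only [mul_zero, zero_add, add_zero]
    gcongr
    nlinarith
  have h1 := one_add_two_mul_add_rpow_le (ρ := r / X) (y := Y / X) hq (by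
    rw [div_pow, div_le_div_iff₀ (by positivity) hX]; nlinarith)
  have e0 : 0 ≤ 1 + 2 * (r / X) + Y / X := by
    have h2 : (r / X) ^ 2 ≤ Y / X := by
      rw [div_pow, div_le_div_iff₀ (by positivity) hX]; nlinarith
    nlinarith [sq_nonneg (1 + r / X)]
  have e1 : X + 2 * r + Y = X * (1 + 2 * (r / X) + Y / X) := by field_simp
  have e2 : X + 8 * q * Y = X * (1 + 8 * q * (Y / X)) := by field_simp
  rw [e1, e2, Real.mul_rpow hX.le e0, Real.mul_rpow hX.le (by positivity)]
  calc X ^ q * (1 + 2 * (r / X) + Y / X) ^ q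
      ≤ X ^ q * (2 * q * (r / X) + (1 + 8 * q * (Y / X)) ^ q) := by gcongr
    _ = _ := by
        rw [Real.rpow_sub_one hX.ne']; field_simp

/-- The function w ↦ cosh √w is a power series with nonnegative coefficients, hence convex on w ≥ 0,
and the argument is a convex combination of (s + t)² and (s − t)². Again the general angle reduces
to the collinear one. -/
lemma cosh_sqrt_le {s t θ : ℝ} (h1 : -1 ≤ θ) (h2 : θ ≤ 1) :
    Real.cosh √(s ^ 2 + 2 * θ * s * t + t ^ 2) ≤
      Real.cosh s * Real.cosh t + θ * (Real.sinh s * Real.sinh t) := by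
  set w := s ^ 2 + 2 * θ * s * t + t ^ 2 with hw
  set l := (1 + θ) / 2 with hl
  have hl0 : 0 ≤ l := by rw [hl]; linarith
  have hl1 : 0 ≤ 1 - l := by rw [hl]; linarith
  have hwl : w = l * (s + t) ^ 2 + (1 - l) * (s - t) ^ 2 := by rw [hw, hl]; ring
  have hw0 : 0 ≤ w := by rw [hwl]; positivity
  have key : Real.cosh √w ≤ l * Real.cosh (s + t) + (1 - l) * Real.cosh (s - t) := by
    refine hasSum_le (fun n => ?_) (Real.hasSum_cosh √w)
      (((Real.hasSum_cosh (s + t)).mul_left l).add ((Real.hasSum_cosh (s - t)).mul_left (1 - l)))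
    rw [pow_mul, pow_mul, pow_mul, Real.sq_sqrt hw0, ← mul_div_assoc, ← mul_div_assoc, ← add_div]
    gcongr
    rw [hwl]
    have := (convexOn_pow n).2 (x := (s + t) ^ 2) (y := (s - t) ^ 2)
      (Set.mem_Ici.2 (sq_nonneg _)) (Set.mem_Ici.2 (sq_nonneg _)) hl0 hl1 (by ring)
    simpa using this
  rw [Real.cosh_add, Real.cosh_sub] at key
  refine key.trans (le_of_eq ?_)
  rw [hl]; ring

/-- The constant 3/5 here and 2/5 in `sinh_sub_le` add up to the coefficient 1 of ‖y‖² in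
`cosh_norm_add_le`. -/
lemma cosh_le_one_add_sq {t : ℝ} (h0 : 0 ≤ t) (h1 : t ≤ 1) : Real.cosh t ≤ 1 + 3 / 5 * t ^ 2 := by
  have h2 := Real.exp_bound' h0 h1 (n := 4) (by norm_num)
  have h3 := (abs_le.1 (Real.exp_bound (x := -t) (by rw [abs_neg, abs_of_nonneg h0]; exact h1)
    (n := 4) (by norm_num))).2
  rw [abs_neg, abs_of_nonneg h0] at h3
  rw [Real.cosh_eq]
  norm_num [Finset.sum_range_succ, Nat.factorial] at h2 h3 ⊢
  nlinarith [pow_nonneg h0 2, pow_nonneg h0 4, mul_nonneg (pow_nonneg h0 2) (sub_nonneg.2 h1),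
    mul_nonneg (pow_nonneg h0 3) (sub_nonneg.2 h1)]

lemma sinh_sub_le {t : ℝ} (h0 : 0 ≤ t) (h1 : t ≤ 1) :
    0 ≤ Real.sinh t - t ∧ Real.sinh t - t ≤ 2 / 5 * t ^ 2 := by
  have hs := Real.self_le_sinh_iff.2 h0
  have h2 := Real.exp_bound' h0 h1 (n := 4) (by norm_num)
  have h3 := (abs_le.1 (Real.exp_bound (x := -t) (by rw [abs_neg, abs_of_nonneg h0]; exact h1)
    (n := 4) (by norm_num))).1
  rw [abs_neg, abs_of_nonneg h0] at h3
  refine ⟨by linarith, ?_⟩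
  rw [Real.sinh_eq]
  norm_num [Finset.sum_range_succ, Nat.factorial] at h2 h3 ⊢
  nlinarith [pow_nonneg h0 2, pow_nonneg h0 4, mul_nonneg (pow_nonneg h0 2) (sub_nonneg.2 h1),
    mul_nonneg (pow_nonneg h0 3) (sub_nonneg.2 h1)]

lemma sinh_le_cosh (x : ℝ) : Real.sinh x ≤ Real.cosh x := by
  rw [Real.sinh_eq, Real.cosh_eq]; have := Real.exp_pos (-x); linarith

/-- The first-order term is linear in y, so it disappears when y is a centred increment; what is
left is a growth factor 1 + ‖y‖², independent of the dimension. Replacing sinh ‖y‖ by ‖y‖ in the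
cross term costs at most (2/5)‖y‖² cosh ‖x‖, since sinh ≤ cosh. -/
lemma cosh_norm_add_le {E : Type*} [NormedAddCommGroup E] [InnerProductSpace ℝ E] (x y : E)
    (hy : ‖y‖ ≤ 1) :
    Real.cosh ‖x + y‖ ≤ Real.cosh ‖x‖ * (1 + ‖y‖ ^ 2)
      + Real.sinh ‖x‖ / ‖x‖ * inner ℝ x y := by
  have hc := cosh_le_one_add_sq (norm_nonneg y) hy
  obtain ⟨hs1, hs2⟩ := sinh_sub_le (norm_nonneg y) hy
  rcases eq_or_ne x 0 with rfl | hx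
  · simp only [zero_add, norm_zero, Real.cosh_zero, one_mul, inner_zero_left, mul_zero, add_zero]
    nlinarith [sq_nonneg ‖y‖]
  rcases eq_or_ne y 0 with rfl | hy0
  · simp
  have hx' : 0 < ‖x‖ := norm_pos_iff.2 hx
  have hy' : 0 < ‖y‖ := norm_pos_iff.2 hy0
  set θ := inner ℝ x y / (‖x‖ * ‖y‖) with hθ
  have hθe : inner ℝ x y = θ * ‖x‖ * ‖y‖ := by rw [hθ]; field_simp
  have hθb := abs_le.1 (abs_real_inner_div_norm_mul_norm_le_one x y)
  have h1 := cosh_sqrt_le (s := ‖x‖) (t := ‖y‖) hθb.1 hθb.2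
  have h2 : ‖x + y‖ = √(‖x‖ ^ 2 + 2 * θ * ‖x‖ * ‖y‖ + ‖y‖ ^ 2) := by
    rw [← Real.sqrt_sq (norm_nonneg (x + y)), norm_add_sq_real, hθe]; ring_nf
  rw [h2]
  refine h1.trans ?_
  have hsinh : 0 ≤ Real.sinh ‖x‖ := Real.sinh_nonneg_iff.2 hx'.le
  have h3 : Real.sinh ‖x‖ / ‖x‖ * inner ℝ x y = θ * (Real.sinh ‖x‖ * ‖y‖) := by
    rw [hθe]; field_simp
  rw [h3]
  have h4 : θ * (Real.sinh ‖x‖ * Real.sinh ‖y‖) - θ * (Real.sinh ‖x‖ * ‖y‖)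
      ≤ Real.cosh ‖x‖ * (2 / 5 * ‖y‖ ^ 2) := by
    calc θ * (Real.sinh ‖x‖ * Real.sinh ‖y‖) - θ * (Real.sinh ‖x‖ * ‖y‖)
        = θ * (Real.sinh ‖x‖ * (Real.sinh ‖y‖ - ‖y‖)) := by ring
      _ ≤ 1 * (Real.sinh ‖x‖ * (Real.sinh ‖y‖ - ‖y‖)) := by
          gcongr
          exact hθb.2
      _ ≤ 1 * (Real.cosh ‖x‖ * (2 / 5 * ‖y‖ ^ 2)) := by
          have := sinh_le_cosh ‖x‖
          gcongr
      _ = _ := one_mul _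
  have h5 : Real.cosh ‖x‖ * Real.cosh ‖y‖ ≤ Real.cosh ‖x‖ * (1 + 3 / 5 * ‖y‖ ^ 2) := by
    gcongr
  nlinarith

end PointwiseInequalities

/-! ### Moment inequalities for one conditional step -/

section IntegratedInequalities

variable {E : Type*} [NormedAddCommGroup E] [InnerProductSpace ℝ E]

/-- A symmetric positive semidefinite form `(x, y) ↦ ⟨x, P y⟩`. -/
structure IsPosForm (P : E →L[ℝ] E) : Prop where
  symm : ∀ x y : E, inner ℝ x (P y) = inner ℝ y (P x)
  nonneg : ∀ x : E, 0 ≤ inner ℝ x (P x)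
  inner_sq_le : ∀ x y : E, inner ℝ x (P y) ^ 2 ≤ inner ℝ x (P x) * inner ℝ y (P y)

lemma isPosForm_id : IsPosForm (ContinuousLinearMap.id ℝ E) where
  symm x y := real_inner_comm _ _
  nonneg x := real_inner_self_nonneg
  inner_sq_le x y := by
    have := real_inner_mul_inner_self_le x y
    simpa [sq] using this

lemma IsAdaptedForm.isPosForm {d : ℕ} {M P : Mat d} {a κ : ℝ} (h : IsAdaptedForm M a κ P) :
    IsPosForm P :=
  ⟨h.symm, h.nonneg, h.inner_sq_le⟩

lemma IsPosForm.inner_add {P : E →L[ℝ] E} (hP : IsPosForm P) (x y : E) :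
    inner ℝ (x + y) (P (x + y)) = inner ℝ x (P x) + 2 * inner ℝ x (P y) + inner ℝ y (P y) := by
  rw [map_add, inner_add_left, inner_add_right, inner_add_right, hP.symm y x]; ring

variable [CompleteSpace E] {Ω : Type*} [MeasurableSpace Ω]

/-- `add_two_mul_add_rpow_le` is integrated with x the mean c and y = V − c; the linear term has
integral zero. A fluctuation of squared size T thus adds only 8qT to the squared mean, inside the
q-th power. -/
lemma IsPosForm.lintegral_rpow_le {P : E →L[ℝ] E} (hP : IsPosForm P) {ν : Measure Ω}
    [IsProbabilityMeasure ν] {V : Ω → E} (hV : StronglyMeasurable V) {K : ℝ}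
    (hK : ∀ ω, ‖V ω‖ ≤ K) {q : ℝ} (hq : 1 ≤ q) {c : E} (hc : ∫ ω, V ω ∂ν = c) {T : ℝ}
    (hT : ∀ᵐ ω ∂ν, inner ℝ (V ω - c) (P (V ω - c)) ≤ T) :
    ∫⁻ ω, ENNReal.ofReal (inner ℝ (V ω) (P (V ω)) ^ q) ∂ν ≤
      ENNReal.ofReal ((inner ℝ c (P c) + 8 * q * T) ^ q) := by
  have hT0 : 0 ≤ T := by
    obtain ⟨ω, hω⟩ := hT.exists
    exact (hP.nonneg _).trans hω
  have hK0 : 0 ≤ K := by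
    obtain ⟨ω, -⟩ := hT.exists
    exact (norm_nonneg _).trans (hK ω)
  have hVi : Integrable V ν :=
    Integrable.of_bound hV.aestronglyMeasurable K (Filter.Eventually.of_forall hK)
  have hcent : ∫ ω, inner ℝ c (P (V ω - c)) ∂ν = 0 := by
    have h1 := ((innerSL ℝ c).comp P).integral_comp_comm (hVi.sub (integrable_const c))
    rw [show (∫ ω, inner ℝ c (P (V ω - c)) ∂ν)
      = ∫ ω, ((innerSL ℝ c).comp P) (V ω - c) ∂ν from rfl]
    refine h1.trans ?_
    rw [integral_sub' hVi (integrable_const c), hc]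
    simp
  have hpt : ∀ᵐ ω ∂ν, inner ℝ (V ω) (P (V ω)) ^ q ≤
      2 * q * (inner ℝ c (P c)) ^ (q - 1) * inner ℝ c (P (V ω - c))
        + (inner ℝ c (P c) + 8 * q * T) ^ q := by
    filter_upwards [hT] with ω hω
    have h1 := add_two_mul_add_rpow_le hq (hP.nonneg c) (hP.nonneg (V ω - c))
      (hP.inner_sq_le c (V ω - c))
    rw [← hP.inner_add, add_sub_cancel] at h1
    refine h1.trans ?_
    have h2 := hP.nonneg c
    have h3 := hP.nonneg (V ω - c)
    gcongr
  have hLi : Integrable (fun ω => inner ℝ c (P (V ω - c))) ν :=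
    ((innerSL ℝ c).comp P).integrable_comp (hVi.sub (integrable_const c))
  have hRi : Integrable (fun ω => 2 * q * (inner ℝ c (P c)) ^ (q - 1) * inner ℝ c (P (V ω - c))
        + (inner ℝ c (P c) + 8 * q * T) ^ q) ν :=
    (hLi.const_mul _).add (integrable_const _)
  have hVm : StronglyMeasurable fun ω => inner ℝ (V ω) (P (V ω)) :=
    hV.inner (P.continuous.comp_stronglyMeasurable hV)
  have hnn : ∀ ω, 0 ≤ inner ℝ (V ω) (P (V ω)) ^ q := fun ω => Real.rpow_nonneg (hP.nonneg _) _
  have hleft : Integrable (fun ω => inner ℝ (V ω) (P (V ω)) ^ q) ν := by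
    refine Integrable.of_bound (hVm.measurable.pow_const q).aestronglyMeasurable
      ((‖P‖ * K ^ 2) ^ q) (Filter.Eventually.of_forall fun ω => ?_)
    rw [Real.norm_of_nonneg (hnn ω)]
    refine Real.rpow_le_rpow (hP.nonneg _) ?_ (by linarith)
    calc inner ℝ (V ω) (P (V ω)) ≤ ‖V ω‖ * (‖P‖ * ‖V ω‖) :=
          (real_inner_le_norm _ _).trans
            (mul_le_mul_of_nonneg_left (P.le_opNorm _) (norm_nonneg _))
      _ ≤ K * (‖P‖ * K) := by gcongr <;> exact hK ω
      _ = _ := by ring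
  rw [← ofReal_integral_eq_lintegral_ofReal hleft (Filter.Eventually.of_forall hnn)]
  refine ENNReal.ofReal_le_ofReal ((integral_mono_ae hleft hRi hpt).trans ?_)
  rw [integral_add (hLi.const_mul _) (integrable_const _), integral_const_mul, hcent]
  simp

/-- `cosh_norm_add_le` is integrated around the mean. The variance enters through 1 + x ≤ eˣ, so
that it can later be compensated multiplicatively. -/
lemma lintegral_cosh_le {ν : Measure Ω} [IsProbabilityMeasure ν] {V : Ω → E}
    (hV : StronglyMeasurable V) {c : E} (hc : ∫ ω, V ω ∂ν = c) (hT : ∀ᵐ ω ∂ν, ‖V ω - c‖ ≤ 1) :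
    ∫⁻ ω, ENNReal.ofReal (Real.cosh ‖V ω‖) ∂ν ≤
      ENNReal.ofReal (Real.cosh ‖c‖ * Real.exp (∫ ω, ‖V ω - c‖ ^ 2 ∂ν)) := by
  have hVb : ∀ᵐ ω ∂ν, ‖V ω‖ ≤ ‖c‖ + 1 := by
    filter_upwards [hT] with ω hω
    calc ‖V ω‖ = ‖c + (V ω - c)‖ := by rw [add_sub_cancel]
      _ ≤ _ := (norm_add_le _ _).trans (by linarith)
  have hVi : Integrable V ν := Integrable.of_bound hV.aestronglyMeasurable _ hVb
  have hsq : Integrable (fun ω => ‖V ω - c‖ ^ 2) ν := by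
    refine Integrable.of_bound (C := 1)
      ((hV.sub stronglyMeasurable_const).norm.pow 2).aestronglyMeasurable ?_
    filter_upwards [hT] with ω hω
    rw [norm_pow, norm_norm]
    exact pow_le_one₀ (norm_nonneg _) hω
  have hcent : ∫ ω, inner ℝ c (V ω - c) ∂ν = 0 := by
    have h1 := (innerSL ℝ c).integral_comp_comm (hVi.sub (integrable_const c))
    refine h1.trans ?_
    rw [integral_sub' hVi (integrable_const c), hc]
    simp
  have hLi : Integrable (fun ω => inner ℝ c (V ω - c)) ν :=
    (innerSL ℝ c).integrable_comp (hVi.sub (integrable_const c))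
  have hleft : Integrable (fun ω => Real.cosh ‖V ω‖) ν := by
    refine Integrable.of_bound (C := Real.cosh (‖c‖ + 1))
      (Real.continuous_cosh.comp_stronglyMeasurable hV.norm).aestronglyMeasurable ?_
    filter_upwards [hVb] with ω hω
    rw [Real.norm_of_nonneg (Real.cosh_pos _).le, Real.cosh_le_cosh, abs_norm,
      abs_of_nonneg (by positivity)]
    exact hω
  have hA : Integrable (fun ω => Real.cosh ‖c‖ * (1 + ‖V ω - c‖ ^ 2)) ν :=
    ((integrable_const _).add hsq).const_mul _
  have hB : Integrable (fun ω => Real.sinh ‖c‖ / ‖c‖ * inner ℝ c (V ω - c)) ν := hLi.const_mul _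
  rw [← ofReal_integral_eq_lintegral_ofReal hleft
    (Filter.Eventually.of_forall fun _ => (Real.cosh_pos _).le)]
  refine ENNReal.ofReal_le_ofReal ?_
  calc ∫ ω, Real.cosh ‖V ω‖ ∂ν
      ≤ ∫ ω, (Real.cosh ‖c‖ * (1 + ‖V ω - c‖ ^ 2)
          + Real.sinh ‖c‖ / ‖c‖ * inner ℝ c (V ω - c)) ∂ν := by
        refine integral_mono_ae hleft (hA.add hB) ?_
        filter_upwards [hT] with ω hω
        have := cosh_norm_add_le c (V ω - c) hω
        rwa [add_sub_cancel] at this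
    _ = Real.cosh ‖c‖ * (1 + ∫ ω, ‖V ω - c‖ ^ 2 ∂ν) := by
        rw [integral_add hA hB, integral_const_mul, integral_const_mul, hcent,
          integral_add (integrable_const _) hsq]
        simp
    _ ≤ _ := by
        have := Real.add_one_le_exp (∫ ω, ‖V ω - c‖ ^ 2 ∂ν)
        have := (Real.cosh_pos ‖c‖).le
        gcongr
        linarith

omit [CompleteSpace E] in
lemma eLpNorm_eq_lintegral_ofReal {ν : Measure Ω} {G : Ω → ℝ} (hG : ∀ ω, 0 ≤ G ω) {q : ℝ}
    (hq : 0 < q) :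
    eLpNorm G (ENNReal.ofReal q) ν = (∫⁻ ω, ENNReal.ofReal (G ω ^ q) ∂ν) ^ (1 / q) := by
  rw [eLpNorm_eq_lintegral_rpow_enorm_toReal (by simpa using hq) (by simp),
    ENNReal.toReal_ofReal hq.le]
  congr 1
  refine lintegral_congr fun ω => ?_
  rw [Real.enorm_of_nonneg (hG ω), ENNReal.ofReal_rpow_of_nonneg (hG ω) hq.le]

omit [InnerProductSpace ℝ E] [CompleteSpace E] in
/-- An `L^q` bound on `|X|²` is an `L^{2q}` bound on `X`. -/
lemma eLpNorm_le_sqrt_of_sq_le {ν : Measure Ω} {X : Ω → E} {G : Ω → ℝ}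
    (hX : ∀ ω, ‖X ω‖ ^ 2 ≤ G ω) {q b : ℝ} (hq : 0 < q) (hb : 0 ≤ b)
    (hG : eLpNorm G (ENNReal.ofReal q) ν ≤ ENNReal.ofReal b) :
    eLpNorm X (ENNReal.ofReal (2 * q)) ν ≤ ENNReal.ofReal √b := by
  have hG0 : ∀ ω, 0 ≤ G ω := fun ω => (sq_nonneg _).trans (hX ω)
  rw [eLpNorm_eq_lintegral_ofReal hG0 hq, one_div, ENNReal.rpow_inv_le_iff hq] at hG
  rw [eLpNorm_eq_lintegral_rpow_enorm_toReal (by simpa using hq) ENNReal.ofReal_ne_top,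
    ENNReal.toReal_ofReal (by positivity), one_div, ENNReal.rpow_inv_le_iff (by positivity)]
  have h1 : ENNReal.ofReal √b ^ (2 * q) = ENNReal.ofReal b ^ q := by
    rw [ENNReal.rpow_mul, ENNReal.ofReal_rpow_of_nonneg (Real.sqrt_nonneg b) (by norm_num)]
    congr 2
    rw [Real.rpow_two, Real.sq_sqrt hb]
  rw [h1]
  refine (lintegral_mono fun ω => ?_).trans hG
  rw [← ofReal_norm, ENNReal.rpow_mul,
    ENNReal.ofReal_rpow_of_nonneg (norm_nonneg _) (by norm_num), Real.rpow_two,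
    ← ENNReal.ofReal_rpow_of_nonneg (hG0 ω) hq.le]
  gcongr
  exact hX ω

variable {Z : Type u} [MeasurableSpace Z] (Q : Kernel Z Z) [IsMarkovKernel Q] (ξ : Measure Z)
  [IsProbabilityMeasure ξ]

omit [IsProbabilityMeasure ξ] in
/-- The moment of order `2q` after time `k` is controlled by the conditional mean and an almost
sure bound on the conditional fluctuation. -/
lemma IsPosForm.eLpNorm_le_of_condChain {P : E →L[ℝ] E} (hP : IsPosForm P) (k : ℕ)
    {V : (ℕ → Z) → E} (hV : StronglyMeasurable V) {K : ℝ} (hK : ∀ ω, ‖V ω‖ ≤ K) {q : ℝ}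
    (hq : 1 ≤ q) {c : (ℕ → Z) → E} (hc : ∀ ω, ∫ ω', V ω' ∂(condChain Q k ω) = c ω)
    {T G : (ℕ → Z) → ℝ}
    (hT : ∀ ω, ∀ᵐ ω' ∂(condChain Q k ω), inner ℝ (V ω' - c ω) (P (V ω' - c ω)) ≤ T ω)
    (hG : ∀ ω, inner ℝ (c ω) (P (c ω)) + 8 * q * T ω ≤ G ω) :
    eLpNorm (fun ω => inner ℝ (V ω) (P (V ω))) (ENNReal.ofReal q) (chainLaw Q ξ) ≤
      eLpNorm G (ENNReal.ofReal q) (chainLaw Q ξ) := by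
  have hq0 : 0 < q := by linarith
  have hT0 : ∀ ω, 0 ≤ inner ℝ (c ω) (P (c ω)) + 8 * q * T ω := by
    intro ω
    obtain ⟨ω', hω⟩ := (hT ω).exists
    have h1 := (hP.nonneg _).trans hω
    have h2 := hP.nonneg (c ω)
    positivity
  have hVm : StronglyMeasurable fun ω => inner ℝ (V ω) (P (V ω)) :=
    hV.inner (P.continuous.comp_stronglyMeasurable hV)
  rw [eLpNorm_eq_lintegral_ofReal (fun ω => hP.nonneg _) hq0,
    eLpNorm_eq_lintegral_ofReal (fun ω => (hT0 ω).trans (hG ω)) hq0]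
  refine ENNReal.rpow_le_rpow ?_ (by positivity)
  rw [lintegral_chainLaw_condChain Q ξ k (hVm.measurable.pow_const q).ennreal_ofReal]
  refine lintegral_mono fun ω => (hP.lintegral_rpow_le hV hK hq (hc ω) (hT ω)).trans ?_
  exact ENNReal.ofReal_le_ofReal (Real.rpow_le_rpow (hT0 ω) (hG ω) hq0.le)

end IntegratedInequalities

/-! ### The centred problem and its error recursion -/

section ErrorProcess

variable {Z : Type u} [MeasurableSpace Z] {d : ℕ}

/-- A linear stochastic approximation problem, centred at its solution: bounded random matrices `A`
with mean `M`, bounded centred noise `ε`, and a form `P` adapted to `M`. -/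
structure CentredProblem (Q : Kernel Z Z) [IsMarkovKernel Q] (π : Measure Z) (t : ℕ)
    (A : Z → Mat d) (M : Mat d) (ε : Z → Vec d) (P : Mat d) (a κ CA S : ℝ) : Prop where
  ergodic : UniformlyGeometricallyErgodic Q π t
  adapted : IsAdaptedForm M a κ P
  a_le : a ≤ CA
  norm_mean_le : ‖M‖ ≤ CA
  stronglyMeasurable_A : StronglyMeasurable A
  stronglyMeasurable_noise : StronglyMeasurable ε
  norm_A_le : ∀ z, ‖A z‖ ≤ CA
  norm_A_sub_le : ∀ z, ‖A z - M‖ ≤ CA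
  norm_noise_le : ∀ z, ‖ε z‖ ≤ S
  integral_A_sub : ∫ z, (A z - M) ∂π = 0
  integral_noise : ∫ z, ε z ∂π = 0

/-- The error process `e_{k+1} = e_k - γ (A(Z_{k+1}) e_k + ε(Z_{k+1}))`. -/
def err (A : Z → Mat d) (ε : Z → Vec d) (γ : ℝ) (e₀ : Vec d) (ω : ℕ → Z) : ℕ → Vec d
  | 0 => e₀
  | k + 1 => err A ε γ e₀ ω k - γ • (A (ω (k + 1)) (err A ε γ e₀ ω k) + ε (ω (k + 1)))

omit [MeasurableSpace Z] in
lemma iterate_sub_eq_err {A : Z → Mat d} {b : Z → Vec d} {Abar : Mat d} {bbar θs : Vec d}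
    (hs : Abar θs = bbar) (α : ℝ) (θ₀ : Vec d) (ω : ℕ → Z) (k : ℕ) :
    iterate A b α θ₀ ω k - θs = err A (noise A b Abar bbar θs) α (θ₀ - θs) ω k := by
  induction k with
  | zero => rfl
  | succ k ih =>
    rw [iterate, err, ← ih, noise]
    have : A (ω (k + 1)) (iterate A b α θ₀ ω k - θs) + ((A (ω (k + 1)) - Abar) θs
        - (b (ω (k + 1)) - bbar)) = A (ω (k + 1)) (iterate A b α θ₀ ω k) - b (ω (k + 1)) := by
      rw [map_sub, sub_apply, hs]; abel
    rw [this]; abel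

variable {A : Z → Mat d} {ε : Z → Vec d}

omit [MeasurableSpace Z] in
lemma err_congr (γ : ℝ) (e₀ : Vec d) {ω ω' : ℕ → Z} {k : ℕ} (h : ∀ j ≤ k, ω' j = ω j) :
    err A ε γ e₀ ω' k = err A ε γ e₀ ω k := by
  induction k with
  | zero => rfl
  | succ k ih =>
    rw [err, err, ih fun j hj => h j (by omega), h (k + 1) le_rfl]

lemma stronglyMeasurable_err (hA : StronglyMeasurable A) (hε : StronglyMeasurable ε) (γ : ℝ)
    (e₀ : Vec d) (k : ℕ) : StronglyMeasurable fun ω : ℕ → Z => err A ε γ e₀ ω k := by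
  induction k with
  | zero => exact stronglyMeasurable_const
  | succ k ih =>
    have h1 : StronglyMeasurable fun ω : ℕ → Z => A (ω (k + 1)) :=
      hA.comp_measurable (measurable_pi_apply _)
    have h2 : StronglyMeasurable fun ω : ℕ → Z => ε (ω (k + 1)) :=
      hε.comp_measurable (measurable_pi_apply _)
    have h3 : StronglyMeasurable fun ω : ℕ → Z => A (ω (k + 1)) (err A ε γ e₀ ω k) :=
      isBoundedBilinearMap_apply.continuous.comp_stronglyMeasurable (h1.prodMk ih)
    exact ih.sub ((h3.add h2).const_smul γ)

omit [MeasurableSpace Z] in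
lemma exists_norm_err_le {CA S : ℝ} (hA : ∀ z, ‖A z‖ ≤ CA) (hε : ∀ z, ‖ε z‖ ≤ S) (γ : ℝ)
    (e₀ : Vec d) (k : ℕ) : ∃ K, ∀ ω : ℕ → Z, ‖err A ε γ e₀ ω k‖ ≤ K := by
  induction k with
  | zero => exact ⟨‖e₀‖, fun _ => le_rfl⟩
  | succ k ih =>
    obtain ⟨K, hK⟩ := ih
    refine ⟨K + |γ| * (CA * K + S), fun ω => ?_⟩
    rw [err]
    refine (norm_sub_le _ _).trans (add_le_add (hK ω) ?_)
    rw [norm_smul, Real.norm_eq_abs]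
    gcongr
    refine (norm_add_le _ _).trans (add_le_add ?_ (hε _))
    exact ((A _).le_opNorm _).trans (mul_le_mul (hA _) (hK ω) (norm_nonneg _)
      ((norm_nonneg _).trans (hA (ω (k + 1)))))

/-- Growth of a perturbed linear recursion over a short time. -/
lemma norm_sub_le_of_recursion {v η : ℕ → Vec d} {B : ℕ → Mat d} {γ CA H : ℝ} (hγ : 0 ≤ γ)
    (hH : 0 ≤ H) (hCA : 0 ≤ CA) {m : ℕ} (hm : γ * m * CA ≤ 1 / 48)
    (hrec : ∀ j, v (j + 1) = v j - γ • (B j (v j) + η j)) (hB : ∀ j, ‖B j‖ ≤ CA)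
    (hη : ∀ j, ‖η j‖ ≤ H) {j : ℕ} (hj : j ≤ m) :
    ‖v j - v 0‖ ≤ 48 / 47 * (γ * j * (CA * ‖v 0‖ + H)) := by
  induction j with
  | zero => simp
  | succ j ih =>
    have ih := ih (by omega)
    set w := CA * ‖v 0‖ + H with hw
    have hw0 : 0 ≤ w := by positivity
    have h1 : ‖v j‖ ≤ ‖v 0‖ + 48 / 47 * (γ * j * w) := by
      calc ‖v j‖ = ‖v 0 + (v j - v 0)‖ := by rw [add_sub_cancel]
        _ ≤ _ := (norm_add_le _ _).trans (by gcongr)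
    have h2 : ‖B j (v j) + η j‖ ≤ CA * (‖v 0‖ + 48 / 47 * (γ * j * w)) + H := by
      refine (norm_add_le _ _).trans (add_le_add ?_ (hη j))
      exact ((B j).le_opNorm _).trans (mul_le_mul (hB j) h1 (norm_nonneg _) hCA)
    have h3 : v (j + 1) - v 0 = (v j - v 0) - γ • (B j (v j) + η j) := by rw [hrec]; abel
    have h4 : γ * j * CA ≤ 1 / 48 := by
      refine le_trans ?_ hm
      have : (j : ℝ) ≤ m := by exact_mod_cast (by omega : j ≤ m)
      gcongr
    calc ‖v (j + 1) - v 0‖ ≤ ‖v j - v 0‖ + γ * ‖B j (v j) + η j‖ := by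
          rw [h3]
          refine (norm_sub_le _ _).trans ?_
          rw [norm_smul, Real.norm_of_nonneg hγ]
      _ ≤ 48 / 47 * (γ * j * w) + γ * (CA * (‖v 0‖ + 48 / 47 * (γ * j * w)) + H) := by gcongr
      _ = 48 / 47 * (γ * j * w) + γ * w * (1 + 48 / 47 * (γ * j * CA)) := by rw [hw]; ring
      -- The constant 48/47 is the solution of 1 + c/48 = c, which closes the induction.
      _ ≤ 48 / 47 * (γ * j * w) + γ * w * (1 + 48 / 47 * (1 / 48)) := by gcongr
      _ = _ := by push_cast; ring

end ErrorProcess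

/-! ### Numerical inequalities behind the one-block contraction -/

section BlockStep

/-- Young's inequality with unequal weights 9/8 and 9 keeps the coefficient of aβU² small, namely
16·(48/47)²·(9/8)/24 < 0.783, at the expense of the additive noise term. -/
lemma block_fluctuation_le {a β p x U W H : ℝ} (hp : 0 ≤ p) (hab : 0 ≤ a * β)
    (hpx : p * x ^ 2 ≤ a * β / 24) (hW0 : 0 ≤ W) (hW : W ≤ 48 / 47 * (x * U + β * H)) :
    4 * p * (2 * W) ^ 2 ≤ 783 / 1000 * (a * β * U ^ 2) + 151 * (p * (β * H) ^ 2) := by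
  have h1 : W ^ 2 ≤ (48 / 47) ^ 2 * (9 / 8 * (x * U) ^ 2 + 9 * (β * H) ^ 2) := by
    calc W ^ 2 ≤ (48 / 47 * (x * U + β * H)) ^ 2 := by gcongr
      _ = (48 / 47) ^ 2 * (x * U + β * H) ^ 2 := by ring
      _ ≤ _ := by
        gcongr
        have e : 9 / 8 * (x * U) ^ 2 + 9 * (β * H) ^ 2 - (x * U + β * H) ^ 2
            = 1 / 8 * (x * U - 8 * (β * H)) ^ 2 := by ring
        have := sq_nonneg (x * U - 8 * (β * H))
        linarith
  have h2 : p * x ^ 2 * U ^ 2 ≤ a * β / 24 * U ^ 2 := by gcongr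
  have h3 := mul_le_mul_of_nonneg_left h1 (by positivity : 0 ≤ 16 * p)
  have h4 : 0 ≤ p * (β * H) ^ 2 := by positivity
  have h5 : 0 ≤ a * β * U ^ 2 := by positivity
  have e1 : 16 * p * ((48 / 47) ^ 2 * (9 / 8 * (x * U) ^ 2 + 9 * (β * H) ^ 2))
      = 16 * (48 / 47) ^ 2 * (9 / 8) * (p * x ^ 2 * U ^ 2)
        + 16 * (48 / 47) ^ 2 * 9 * (p * (β * H) ^ 2) := by ring
  rw [e1] at h3
  have e2 : 4 * p * (2 * W) ^ 2 = 16 * p * W ^ 2 := by ring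
  rw [e2]
  linarith

lemma block_cross_le {a β γ x U R CR : ℝ} (ha : 0 < a) (hβ : 0 < β) (hx48 : x ≤ 1 / 48)
    (hU : 0 ≤ U) (hR0 : 0 ≤ R) (hR : R ≤ (1 / 3 + 1 / 47) * (a * β) * U + CR * γ * β) :
    2 * ((1 + x) * U * R) ≤
      (775 / 1000) * (a * β * U ^ 2) + 21 * (CR ^ 2 / a * γ ^ 2 * β) := by
  have h1 : 2 * ((1 + x) * U * R) ≤ 49 / 24 * U * R := by
    have h0 : 0 ≤ U * R := by positivity
    have := mul_le_mul_of_nonneg_right hx48 h0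
    linarith
  have h2 : 49 / 24 * U * R ≤
      49 / 24 * U * ((1 / 3 + 1 / 47) * (a * β) * U + CR * γ * β) := by gcongr
  have h3 : 49 / 24 * U * (CR * γ * β) ≤
      5 / 100 * (a * β * U ^ 2) + 21 * (CR ^ 2 / a * γ ^ 2 * β) := by
    have e : 5 / 100 * (a * β * U ^ 2) + 21 * (CR ^ 2 / a * γ ^ 2 * β)
        - 49 / 24 * U * (CR * γ * β)
        = β / a * (5 / 100 * (a * U) ^ 2 + 21 * (CR * γ) ^ 2 - 49 / 24 * (a * U) * (CR * γ)) := by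
      field_simp
    have h4 : 5 / 100 * (a * U) ^ 2 + 21 * (CR * γ) ^ 2 - 49 / 24 * (a * U) * (CR * γ)
        = 5 / 100 * (a * U - 245 / 12 * (CR * γ)) ^ 2
          + (21 - 5 / 100 * (245 / 12) ^ 2) * (CR * γ) ^ 2 := by ring
    have : 0 ≤ β / a * (5 / 100 * (a * U) ^ 2 + 21 * (CR * γ) ^ 2
        - 49 / 24 * (a * U) * (CR * γ)) := by
      rw [h4]
      have : (0 : ℝ) ≤ 21 - 5 / 100 * (245 / 12) ^ 2 := by norm_num
      positivity
    linarith
  have h5 : 0 ≤ a * β * U ^ 2 := by positivity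
  linarith

lemma block_sq_le {a β γ U R CR : ℝ} (ha : 0 < a) (hβ : 0 < β) (haβ : a * β ≤ 1 / 48)
    (hR0 : 0 ≤ R) (hR : R ≤ (1 / 3 + 1 / 47) * (a * β) * U + CR * γ * β) :
    R ^ 2 ≤ 6 / 1000 * (a * β * U ^ 2) + CR ^ 2 / a * γ ^ 2 * β := by
  have h1 : R ^ 2 ≤ 2 * (((1 / 3 + 1 / 47) * (a * β) * U) ^ 2 + (CR * γ * β) ^ 2) :=
    (pow_le_pow_left₀ hR0 hR 2).trans add_sq_le
  have h2 : (a * β) * (a * β * U ^ 2) ≤ 1 / 48 * (a * β * U ^ 2) := by gcongr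
  have h3 : (CR * γ * β) ^ 2 = (a * β) * (CR ^ 2 / a * γ ^ 2 * β) := by field_simp
  have h4 : (a * β) * (CR ^ 2 / a * γ ^ 2 * β) ≤ 1 / 48 * (CR ^ 2 / a * γ ^ 2 * β) := by gcongr
  have h5 : 0 ≤ CR ^ 2 / a * γ ^ 2 * β := by positivity
  have h6 : 0 ≤ a * β * U ^ 2 := by positivity
  have h7 : ((1 / 3 + 1 / 47) * (a * β) * U) ^ 2
      = (1 / 3 + 1 / 47) ^ 2 * ((a * β) * (a * β * U ^ 2)) := by ring
  rw [h7, h3] at h1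
  linarith

/-- All smallness used in a block follows from 24 p C_A² β ≤ a together with a ≤ C_A and p ≥ 2. -/
lemma block_small {a β p CA x : ℝ} (hβ : 0 < β) (hp : 2 ≤ p)
    (ha : 0 < a) (haCA : a ≤ CA) (hx : x = β * CA) (hsmall : 24 * p * CA ^ 2 * β ≤ a) :
    0 < x ∧ x ≤ 1 / 48 ∧ p * x ^ 2 ≤ a * β / 24 ∧ x ^ 2 ≤ a * β / 48 ∧ a * β ≤ 1 / 48 := by
  have hCA : 0 < CA := ha.trans_le haCA
  have hx0 : 0 < x := by rw [hx]; positivity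
  have hx48 : x ≤ 1 / 48 := by
    have h2 : 24 * p * x ≤ 1 := by
      have : CA * (24 * p * x) ≤ CA * 1 := by rw [hx]; linarith
      exact le_of_mul_le_mul_left this hCA
    have : 2 * x ≤ p * x := by gcongr
    linarith
  have hpx : p * x ^ 2 ≤ a * β / 24 := by
    rw [hx]
    have := mul_le_mul_of_nonneg_right hsmall hβ.le
    linarith
  refine ⟨hx0, hx48, hpx, ?_, ?_⟩
  · have : 2 * x ^ 2 ≤ p * x ^ 2 := by gcongr
    linarith
  · calc a * β ≤ CA * β := by gcongr
      _ = x := by rw [hx]; ring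
      _ ≤ _ := hx48

/-- One block of the Lyapunov recursion, as an inequality between real numbers: `U` is the size of
the state, `N` its form, `R` the error of the conditional mean and `W` the fluctuation. -/
lemma block_inequality {a β γ p CA x U N R W H CR m : ℝ} (ha : 0 < a) (hβ : 0 < β) (hγ : 0 < γ)
    (hγ2 : γ ≤ 2) (hp : 2 ≤ p) (hβm : β = γ * m) (haCA : a ≤ CA) (hx : x = β * CA)
    (hsmall : 24 * p * CA ^ 2 * β ≤ a) (hU : 0 ≤ U) (hNU : N ≤ U ^ 2) (hR0 : 0 ≤ R)
    (hR : R ≤ (1 / 3 + 1 / 47) * (a * β) * U + CR * γ * β)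
    (hW0 : 0 ≤ W) (hW : W ≤ 48 / 47 * (x * U + β * H)) :
    N - 2 * a * β * U ^ 2 + x ^ 2 * U ^ 2 + 2 * ((1 + x) * U * R) + R ^ 2
        + 4 * p * (2 * W) ^ 2 ≤
      (1 - a * β / 6) * N + p * γ * β * (22 * CR ^ 2 / a + 151 * m * H ^ 2) := by
  obtain ⟨hx0, hx48, hpx, hx2, haβ⟩ := block_small hβ hp ha haCA hx hsmall
  have hab0 : 0 < a * β := by positivity
  have hWsq := block_fluctuation_le (by linarith) hab0.le hpx hW0 hW
  have hlin := block_cross_le ha hβ hx48 hU hR0 hR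
  have hRsq := block_sq_le ha hβ haβ hR0 hR
  have hxU : x ^ 2 * U ^ 2 ≤ a * β / 48 * U ^ 2 := by gcongr
  have hfin1 : CR ^ 2 / a * γ ^ 2 * β ≤ p * γ * β * (CR ^ 2 / a) := by
    have h5 : 0 ≤ CR ^ 2 / a * γ * β := by positivity
    have := mul_le_mul_of_nonneg_left (hγ2.trans hp) h5
    linarith
  have hfin2 : p * (β * H) ^ 2 = p * γ * β * (m * H ^ 2) := by rw [mul_pow, sq β, hβm]; ring
  -- The budget: of the drift 2aβU² the error terms use 0.783 + 0.775 + 0.006 + 1/48 < 2 − 1/6. The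
  -- remaining aβU²/6 dominates aβN/6 because N ≤ U².
  have hN : a * β / 6 * N ≤ a * β / 6 * U ^ 2 := by gcongr
  have h6 : 0 ≤ a * β * U ^ 2 := by positivity
  have e : p * γ * β * (22 * CR ^ 2 / a + 151 * m * H ^ 2)
      = 22 * (p * γ * β * (CR ^ 2 / a)) + 151 * (p * γ * β * (m * H ^ 2)) := by ring
  rw [e]
  rw [hfin2] at hWsq
  linarith

end BlockStep

/-! ### Bounds and the martingale property for Poisson solutions -/

section PoissonBounds

variable {Z : Type u} [MeasurableSpace Z] {Q : Kernel Z Z} [IsMarkovKernel Q] {π : Measure Z}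
  [IsProbabilityMeasure π] {t : ℕ} {E : Type*} [NormedAddCommGroup E] [NormedSpace ℝ E]

lemma kernelAvg_kernelAvg {f : Z → E} (hf : StronglyMeasurable f) {F : ℝ}
    (hF : ∀ z, ‖f z‖ ≤ F) (i j : ℕ) (z : Z) :
    kernelAvg Q (kernelAvg Q f i) j z = kernelAvg Q f (i + j) z := by
  have : (Q ^ (i + j)) z = (Q ^ i) ∘ₘ ((Q ^ j) z) := by
    rw [pow_add]; exact Kernel.comp_apply _ _ _
  rw [kernelAvg, kernelAvg, this, integral_comp_measure]
  · rfl
  · exact integrable_of_bound hf hF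

omit [IsMarkovKernel Q] in
lemma kernelAvg_one (f : Z → E) (z : Z) : kernelAvg Q f 1 z = ∫ w, f w ∂(Q z) := by
  rw [kernelAvg, pow_one]

/-- The function `Q g = g - f` for the Poisson solution `g` of `f`. -/
def poissonTail (Q : Kernel Z Z) (f : Z → E) (z : Z) : E := poisson Q f z - f z

variable [CompleteSpace E] (h : UniformlyGeometricallyErgodic Q π t) {f : Z → E}
  (hf : StronglyMeasurable f) {F : ℝ} (hF : ∀ z, ‖f z‖ ≤ F) (h0 : ∫ z, f z ∂π = 0)
include h hf hF h0

lemma UniformlyGeometricallyErgodic.stronglyMeasurable_poissonTail :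
    StronglyMeasurable (poissonTail Q f) :=
  (h.stronglyMeasurable_poisson hf hF h0).sub hf

lemma UniformlyGeometricallyErgodic.poissonTail_eq (z : Z) :
    poissonTail Q f z = kernelAvg Q (poisson Q f) 1 z := by
  rw [kernelAvg_one, h.integral_poisson hf hF h0, poissonTail]

lemma UniformlyGeometricallyErgodic.norm_poissonTail_le (z : Z) :
    ‖poissonTail Q f z‖ ≤ 3 * t * F := by
  rw [h.poissonTail_eq hf hF h0]
  exact norm_integral_le_of_bound (h.norm_poisson_le hf hF h0)

/-- Since g − f = Qg, both terms have conditional mean Q^{j+1} g at Z_k: the increments are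
martingale differences, seen here from any earlier time. -/
lemma UniformlyGeometricallyErgodic.integral_condChain_poisson_sub [MeasurableSingletonClass Z]
    (k j : ℕ) (ω : ℕ → Z) :
    ∫ ω', (poisson Q f (ω' (k + (j + 1))) - poissonTail Q f (ω' (k + j))) ∂(condChain Q k ω)
      = 0 := by
  have h1 := h.stronglyMeasurable_poisson hf hF h0
  have h2 := h.stronglyMeasurable_poissonTail hf hF h0
  rw [integral_sub, integral_condChain_add Q k (j + 1) ω h1, integral_condChain_add Q k j ω h2]
  · have h3 : poissonTail Q f = kernelAvg Q (poisson Q f) 1 :=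
      funext (h.poissonTail_eq hf hF h0)
    change kernelAvg Q (poisson Q f) (j + 1) (ω k) - kernelAvg Q (poissonTail Q f) j (ω k) = 0
    rw [h3, kernelAvg_kernelAvg h1 (h.norm_poisson_le hf hF h0), add_comm 1 j, sub_self]
  · exact integrable_of_bound (h1.comp_measurable (measurable_pi_apply _))
      fun _ => h.norm_poisson_le hf hF h0 _
  · exact integrable_of_bound (h2.comp_measurable (measurable_pi_apply _))
      fun _ => h.norm_poissonTail_le hf hF h0 _

end PoissonBounds

/-! ### The corrected error over one block -/

section Block

variable {Z : Type u} [MeasurableSpace Z] {d : ℕ}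

/-- The error process corrected by the Poisson solution of the noise. -/
def shiftedErr (Q : Kernel Z Z) (A : Z → Mat d) (ε : Z → Vec d) (γ : ℝ) (e₀ : Vec d)
    (ω : ℕ → Z) (k : ℕ) : Vec d :=
  err A ε γ e₀ ω k - γ • poissonTail Q ε (ω k)

/-- The noise of the corrected error process, up to a martingale difference a term of order `γ`. -/
def shiftedNoise (Q : Kernel Z Z) (A : Z → Mat d) (ε : Z → Vec d) (γ : ℝ) (ω : ℕ → Z) (k : ℕ) :
    Vec d :=
  (poisson Q ε (ω (k + 1)) - poissonTail Q ε (ω k)) + γ • A (ω (k + 1)) (poissonTail Q ε (ω k))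

/-- Summation by parts: in ε(Z_{k+1}) = g(Z_{k+1}) − Qg(Z_{k+1}) the second term is absorbed by the
shift at time k + 1. What remains is a martingale difference and a term of order γ, so the noise no
longer biases the conditional mean at first order. -/
lemma shiftedErr_succ (Q : Kernel Z Z) (A : Z → Mat d) (ε : Z → Vec d) (γ : ℝ) (e₀ : Vec d)
    (ω : ℕ → Z) (k : ℕ) :
    shiftedErr Q A ε γ e₀ ω (k + 1) = shiftedErr Q A ε γ e₀ ω k -
      γ • (A (ω (k + 1)) (shiftedErr Q A ε γ e₀ ω k) + shiftedNoise Q A ε γ ω k) := by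
  have h1 : ε (ω (k + 1)) = poisson Q ε (ω (k + 1)) - poissonTail Q ε (ω (k + 1)) := by
    rw [poissonTail]; abel
  simp only [shiftedErr, shiftedNoise, err]
  rw [h1, map_sub, map_smul]
  module

variable {Q : Kernel Z Z} [IsMarkovKernel Q] {π : Measure Z} [IsProbabilityMeasure π] {t : ℕ}
  {A : Z → Mat d} {M : Mat d} {ε : Z → Vec d} {P : Mat d} {a κ CA S : ℝ}

namespace CentredProblem

variable (h : CentredProblem Q π t A M ε P a κ CA S)
include h

omit [IsProbabilityMeasure π] in
lemma a_pos : 0 < a := h.adapted.a_pos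

omit [IsProbabilityMeasure π] in
lemma CA_pos : 0 < CA := h.a_pos.trans_le h.a_le

omit [IsProbabilityMeasure π] in
lemma noise_nonneg (z : Z) : 0 ≤ S := (norm_nonneg _).trans (h.norm_noise_le z)

lemma norm_poisson_noise_le (z : Z) : ‖poisson Q ε z‖ ≤ 3 * t * S :=
  h.ergodic.norm_poisson_le h.stronglyMeasurable_noise h.norm_noise_le h.integral_noise z

lemma norm_poissonTail_noise_le (z : Z) : ‖poissonTail Q ε z‖ ≤ 3 * t * S :=
  h.ergodic.norm_poissonTail_le h.stronglyMeasurable_noise h.norm_noise_le h.integral_noise z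

lemma norm_shiftedNoise_le {γ : ℝ} (hγ : 0 ≤ γ) (hγA : γ * CA ≤ 1) (ω : ℕ → Z) (k : ℕ) :
    ‖shiftedNoise Q A ε γ ω k‖ ≤ 9 * t * S := by
  have hS := h.noise_nonneg (ω 0)
  have h1 : ‖γ • A (ω (k + 1)) (poissonTail Q ε (ω k))‖ ≤ 3 * t * S := by
    rw [norm_smul, Real.norm_of_nonneg hγ]
    calc γ * ‖A (ω (k + 1)) (poissonTail Q ε (ω k))‖ ≤ γ * (CA * (3 * t * S)) := by
          gcongr
          exact ((A _).le_opNorm _).trans (mul_le_mul (h.norm_A_le _)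
            (h.norm_poissonTail_noise_le _) (norm_nonneg _) h.CA_pos.le)
      _ = γ * CA * (3 * t * S) := by ring
      _ ≤ 1 * (3 * t * S) := by gcongr
      _ = _ := one_mul _
  have h2 := norm_sub_le (poisson Q ε (ω (k + 1))) (poissonTail Q ε (ω k))
  have h3 := h.norm_poisson_noise_le (ω (k + 1))
  have h4 := h.norm_poissonTail_noise_le (ω k)
  refine (norm_add_le _ _).trans ?_
  linarith

lemma stronglyMeasurable_shiftedErr (γ : ℝ) (e₀ : Vec d) (k : ℕ) :
    StronglyMeasurable fun ω : ℕ → Z => shiftedErr Q A ε γ e₀ ω k := by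
  refine (stronglyMeasurable_err h.stronglyMeasurable_A h.stronglyMeasurable_noise γ e₀ k).sub ?_
  exact ((h.ergodic.stronglyMeasurable_poissonTail h.stronglyMeasurable_noise h.norm_noise_le
    h.integral_noise).comp_measurable (measurable_pi_apply k)).const_smul γ

lemma exists_norm_shiftedErr_le (γ : ℝ) (e₀ : Vec d) (k : ℕ) :
    ∃ K, ∀ ω : ℕ → Z, ‖shiftedErr Q A ε γ e₀ ω k‖ ≤ K := by
  obtain ⟨K, hK⟩ := exists_norm_err_le h.norm_A_le h.norm_noise_le γ e₀ k
  refine ⟨K + |γ| * (3 * t * S), fun ω => (norm_sub_le _ _).trans (add_le_add (hK ω) ?_)⟩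
  rw [norm_smul, Real.norm_eq_abs]
  gcongr
  exact h.norm_poissonTail_noise_le _

omit [IsMarkovKernel Q] [IsProbabilityMeasure π] [MeasurableSpace Z] h in
lemma _root_.MarkovLSA.shiftedErr_congr [MeasurableSpace Z] {Q : Kernel Z Z} (γ : ℝ) (e₀ : Vec d)
    {ω ω' : ℕ → Z} {k : ℕ} (hω : ∀ j ≤ k, ω' j = ω j) :
    shiftedErr Q A ε γ e₀ ω' k = shiftedErr Q A ε γ e₀ ω k := by
  rw [shiftedErr, shiftedErr, err_congr γ e₀ hω, hω k le_rfl]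

lemma norm_shiftedErr_sub_le {γ : ℝ} (hγ : 0 ≤ γ) {m : ℕ} (hm1 : 1 ≤ m)
    (hm : γ * m * CA ≤ 1 / 48) (e₀ : Vec d) (ω : ℕ → Z) (k : ℕ) {j : ℕ} (hj : j ≤ m) :
    ‖shiftedErr Q A ε γ e₀ ω (k + j) - shiftedErr Q A ε γ e₀ ω k‖ ≤
      48 / 47 * (γ * m * (CA * ‖shiftedErr Q A ε γ e₀ ω k‖ + 9 * t * S)) := by
  have hCA := h.CA_pos.le
  have hS := h.noise_nonneg (ω 0)
  have hγA : γ * CA ≤ 1 := by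
    have h1 : (1 : ℝ) ≤ m := by exact_mod_cast hm1
    have : γ * 1 * CA ≤ γ * m * CA := by gcongr
    linarith
  have h1 := norm_sub_le_of_recursion (v := fun j => shiftedErr Q A ε γ e₀ ω (k + j))
    (η := fun j => shiftedNoise Q A ε γ ω (k + j)) (B := fun j => A (ω (k + j + 1)))
    (H := 9 * t * S) hγ (by positivity) hCA hm
    (fun j => shiftedErr_succ Q A ε γ e₀ ω (k + j)) (fun j => h.norm_A_le _)
    (fun j => h.norm_shiftedNoise_le hγ hγA ω _) hj
  refine h1.trans ?_
  have : (j : ℝ) ≤ m := by exact_mod_cast hj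
  simp only [add_zero]
  gcongr

variable [MeasurableSingletonClass Z]

omit [MeasurableSingletonClass Z] in
/-- The conditional mean of the matrix noise over a block. -/
lemma norm_sum_kernelAvg_le (m : ℕ) (z : Z) (u : Vec d) :
    ‖∑ j ∈ Finset.range m, (kernelAvg Q (fun z => A z - M) (j + 1) z) u‖ ≤
      8 / 3 * t * CA * ‖u‖ := by
  have hCA := h.CA_pos.le
  have h1 : ∀ j, ‖(kernelAvg Q (fun z => A z - M) (j + 1) z) u‖ ≤
      2 * CA * (1 / 4) ^ ((j + 1) / t) * ‖u‖ := fun j =>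
    (ContinuousLinearMap.le_opNorm _ _).trans (mul_le_mul_of_nonneg_right
      (h.ergodic.norm_kernelAvg_le (h.stronglyMeasurable_A.sub stronglyMeasurable_const)
        h.norm_A_sub_le h.integral_A_sub _ _) (norm_nonneg _))
  have h2 : ∑ j ∈ Finset.range m, (1 / 4 : ℝ) ^ ((j + 1) / t) ≤ 4 / 3 * t := by
    have := sum_range_quarter_pow_div_le h.ergodic.tmix_pos (m + 1)
    rw [Finset.sum_range_succ'] at this
    have h3 : (0 : ℝ) ≤ (1 / 4) ^ (0 / t) := by positivity
    linarith
  calc _ ≤ ∑ j ∈ Finset.range m, 2 * CA * (1 / 4) ^ ((j + 1) / t) * ‖u‖ :=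
        (norm_sum_le _ _).trans (Finset.sum_le_sum fun j _ => h1 j)
    _ = 2 * CA * ‖u‖ * ∑ j ∈ Finset.range m, (1 / 4 : ℝ) ^ ((j + 1) / t) := by
        rw [Finset.mul_sum]
        exact Finset.sum_congr rfl fun _ _ => by ring
    _ ≤ 2 * CA * ‖u‖ * (4 / 3 * t) := by gcongr
    _ = _ := by ring

/-- The conditional mean of the corrected error after a block of length `m`. -/
lemma norm_integral_shiftedErr_sub_le {γ : ℝ} (hγ : 0 ≤ γ) {m : ℕ} (hm1 : 1 ≤ m)
    (hm : γ * m * CA ≤ 1 / 48) (e₀ : Vec d) (k : ℕ) (ω : ℕ → Z) :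
    ‖∫ ω', shiftedErr Q A ε γ e₀ ω' (k + m) ∂(condChain Q k ω)
        - (shiftedErr Q A ε γ e₀ ω k - (γ * m) • M (shiftedErr Q A ε γ e₀ ω k))‖ ≤
      γ * (8 / 3 * t * CA * ‖shiftedErr Q A ε γ e₀ ω k‖)
        + γ * m * (CA * (48 / 47 * (γ * m * (CA * ‖shiftedErr Q A ε γ e₀ ω k‖ + 9 * t * S)))
          + γ * CA * (3 * t * S)) := by
  have hCA := h.CA_pos.le
  have hS := h.noise_nonneg (ω 0)
  set u := shiftedErr Q A ε γ e₀ ω k with hu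
  set W := 48 / 47 * (γ * m * (CA * ‖u‖ + 9 * t * S)) with hW
  obtain ⟨K, hK⟩ := h.exists_norm_shiftedErr_le γ e₀ (k + m)
  have hV : Integrable (fun ω' => shiftedErr Q A ε γ e₀ ω' (k + m)) (condChain Q k ω) :=
    integrable_of_bound (h.stronglyMeasurable_shiftedErr γ e₀ (k + m)) hK
  have hAtm : StronglyMeasurable fun z => A z - M :=
    h.stronglyMeasurable_A.sub stronglyMeasurable_const
  have hAtu : StronglyMeasurable fun z => (A z - M) u :=
    (ContinuousLinearMap.apply ℝ (Vec d) u).continuous.comp_stronglyMeasurable hAtm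
  have hL1 : ∀ j, Integrable (fun ω' : ℕ → Z => (A (ω' (k + (j + 1))) - M) u)
      (condChain Q k ω) := fun j =>
    integrable_of_bound (F := CA * ‖u‖) (hAtu.comp_measurable (measurable_pi_apply _)) fun ω' =>
      (ContinuousLinearMap.le_opNorm _ _).trans
        (mul_le_mul_of_nonneg_right (h.norm_A_sub_le _) (norm_nonneg _))
  have hL1i : ∀ j, ∫ ω', (A (ω' (k + (j + 1))) - M) u ∂(condChain Q k ω)
      = (kernelAvg Q (fun z => A z - M) (j + 1) (ω k)) u := by
    intro j
    have e1 := integral_condChain_add Q k (j + 1) ω hAtu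
    rw [e1, kernelAvg, ContinuousLinearMap.integral_apply]
    exact integrable_of_bound hAtm h.norm_A_sub_le
  have hpm := h.ergodic.stronglyMeasurable_poisson h.stronglyMeasurable_noise h.norm_noise_le
    h.integral_noise
  have hptm := h.ergodic.stronglyMeasurable_poissonTail h.stronglyMeasurable_noise
    h.norm_noise_le h.integral_noise
  have hL2 : ∀ j, Integrable (fun ω' : ℕ → Z => poisson Q ε (ω' (k + (j + 1)))
      - poissonTail Q ε (ω' (k + j))) (condChain Q k ω) := fun j =>
    (integrable_of_bound (hpm.comp_measurable (measurable_pi_apply _))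
      fun _ => h.norm_poisson_noise_le _).sub
    (integrable_of_bound (hptm.comp_measurable (measurable_pi_apply _))
      fun _ => h.norm_poissonTail_noise_le _)
  -- `L` collects the first-order noise with the state frozen at `u`. Its conditional mean is
  -- explicit: mixing controls the matrix part and the Poisson part averages to zero.
  set L : (ℕ → Z) → Vec d := fun ω' => ∑ j ∈ Finset.range m, ((A (ω' (k + (j + 1))) - M) u
    + (poisson Q ε (ω' (k + (j + 1))) - poissonTail Q ε (ω' (k + j)))) with hLdef
  have hL12 : ∀ j, Integrable (fun ω' : ℕ → Z => (A (ω' (k + (j + 1))) - M) u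
      + (poisson Q ε (ω' (k + (j + 1))) - poissonTail Q ε (ω' (k + j)))) (condChain Q k ω) :=
    fun j => (hL1 j).add (hL2 j)
  have hLi : Integrable L (condChain Q k ω) := integrable_finsetSum _ fun j _ => hL12 j
  have hLint : ∫ ω', L ω' ∂(condChain Q k ω) =
      ∑ j ∈ Finset.range m, (kernelAvg Q (fun z => A z - M) (j + 1) (ω k)) u := by
    rw [hLdef]
    refine (integral_finsetSum _ fun j _ => hL12 j).trans ?_
    refine Finset.sum_congr rfl fun j _ => ?_
    rw [integral_add (hL1 j) (hL2 j), hL1i,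
      h.ergodic.integral_condChain_poisson_sub h.stronglyMeasurable_noise h.norm_noise_le
        h.integral_noise, add_zero]
  -- Once the Euler step and `L` are removed, each summand involves either the displacement of the
  -- state from `u` or an extra γ, so `Φ` is bounded pathwise.
  set Φ : (ℕ → Z) → Vec d := fun ω' => shiftedErr Q A ε γ e₀ ω' (k + m)
    - (u - (γ * m) • M u) + γ • L ω' with hΦ
  have hΦint : ∫ ω', Φ ω' ∂(condChain Q k ω) =
      (∫ ω', shiftedErr Q A ε γ e₀ ω' (k + m) ∂(condChain Q k ω) - (u - (γ * m) • M u))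
        + γ • ∫ ω', L ω' ∂(condChain Q k ω) := by
    have e1 : Integrable (fun ω' => shiftedErr Q A ε γ e₀ ω' (k + m) - (u - (γ * m) • M u))
        (condChain Q k ω) := hV.sub (integrable_const _)
    have e2 : Integrable (fun ω' => γ • L ω') (condChain Q k ω) := hLi.smul γ
    rw [hΦ]
    refine (integral_add e1 e2).trans ?_
    rw [integral_sub hV (integrable_const _), integral_smul]
    simp
  have hΦb : ∀ᵐ ω' ∂(condChain Q k ω), ‖Φ ω'‖ ≤ γ * m * (CA * W + γ * CA * (3 * t * S)) := by
    filter_upwards [ae_condChain_eq Q k ω] with ω' hω'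
    have hu' : shiftedErr Q A ε γ e₀ ω' k = u := shiftedErr_congr γ e₀ hω'
    have htel : shiftedErr Q A ε γ e₀ ω' (k + m) = u - γ • ∑ j ∈ Finset.range m,
        (A (ω' (k + (j + 1))) (shiftedErr Q A ε γ e₀ ω' (k + j))
          + shiftedNoise Q A ε γ ω' (k + j)) := by
      have := Finset.sum_range_sub (fun j => shiftedErr Q A ε γ e₀ ω' (k + j)) m
      simp only [add_zero] at this
      rw [hu', eq_comm, sub_eq_iff_eq_add] at this
      rw [this, Finset.smul_sum, sub_eq_neg_add, ← Finset.sum_neg_distrib]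
      congr 1
      refine Finset.sum_congr rfl fun j _ => ?_
      rw [← add_assoc, shiftedErr_succ]
      abel
    have hΦe : Φ ω' = γ • ∑ j ∈ Finset.range m, -(A (ω' (k + (j + 1)))
        (shiftedErr Q A ε γ e₀ ω' (k + j) - u)
          + γ • A (ω' (k + (j + 1))) (poissonTail Q ε (ω' (k + j)))) := by
      have hMu : (γ * m) • M u = γ • ∑ j ∈ Finset.range m, M u := by
        rw [Finset.sum_const, Finset.card_range, mul_smul, Nat.cast_smul_eq_nsmul]
      rw [hΦ]
      simp only [htel, hLdef]
      rw [hMu]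
      have : ∀ x y z w : Vec d, u - γ • x - (u - γ • y) + γ • z = γ • (y + z - x) := by
        intros; module
      rw [this _ _ _ 0, ← Finset.sum_add_distrib, ← Finset.sum_sub_distrib]
      congr 1
      refine Finset.sum_congr rfl fun j _ => ?_
      rw [shiftedNoise, map_sub, sub_apply, add_assoc k j 1]
      abel
    rw [hΦe, norm_smul, Real.norm_of_nonneg hγ, mul_assoc]
    gcongr
    calc _ ≤ ∑ j ∈ Finset.range m, (CA * W + γ * CA * (3 * t * S)) := by
          refine (norm_sum_le _ _).trans (Finset.sum_le_sum fun j hj => ?_)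
          rw [norm_neg]
          refine (norm_add_le _ _).trans (add_le_add ?_ ?_)
          · refine ((A _).le_opNorm _).trans (mul_le_mul (h.norm_A_le _) ?_ (norm_nonneg _) hCA)
            have := h.norm_shiftedErr_sub_le hγ hm1 hm e₀ ω' k (Finset.mem_range.1 hj).le
            rwa [hu'] at this
          · rw [norm_smul, Real.norm_of_nonneg hγ, mul_assoc]
            gcongr
            exact ((A _).le_opNorm _).trans (mul_le_mul (h.norm_A_le _)
              (h.norm_poissonTail_noise_le _) (norm_nonneg _) hCA)
      _ = _ := by rw [Finset.sum_const, Finset.card_range, nsmul_eq_mul]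
  have hΦn : ‖∫ ω', Φ ω' ∂(condChain Q k ω)‖ ≤ γ * m * (CA * W + γ * CA * (3 * t * S)) := by
    have := norm_integral_le_of_norm_le_const hΦb
    simpa using this
  rw [hLint] at hΦint
  have hfin : ∫ ω', shiftedErr Q A ε γ e₀ ω' (k + m) ∂(condChain Q k ω) - (u - (γ * m) • M u)
      = ∫ ω', Φ ω' ∂(condChain Q k ω)
        - γ • ∑ j ∈ Finset.range m, (kernelAvg Q (fun z => A z - M) (j + 1) (ω k)) u := by
    rw [hΦint]; abel
  rw [hfin, add_comm]
  refine (norm_sub_le _ _).trans (add_le_add hΦn ?_)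
  rw [norm_smul, Real.norm_of_nonneg hγ]
  gcongr
  exact h.norm_sum_kernelAvg_le m (ω k) u

end CentredProblem

end Block

/-! ### Exponential forgetting and moments of the error -/

section Stability

variable {Z : Type u} [MeasurableSpace Z] {d : ℕ}

lemma IsAdaptedForm.inner_sub_smul_le {M P : Mat d} {a κ CA β : ℝ} (h : IsAdaptedForm M a κ P)
    (hM : ‖M‖ ≤ CA) (u : Vec d) :
    inner ℝ (u - β • M u) (P (u - β • M u)) ≤
      inner ℝ u (P u) - 2 * a * β * ‖u‖ ^ 2 + (β * CA) ^ 2 * ‖u‖ ^ 2 := by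
  have h1 := h.isPosForm.inner_add u (-(β • M u))
  rw [← sub_eq_add_neg] at h1
  rw [h1]
  have h2 : inner ℝ u (P (-(β • M u))) = -(β * (a * ‖u‖ ^ 2)) := by
    rw [map_neg, map_smul, inner_neg_right, inner_smul_right, h.inner_eq]
  have h3 : inner ℝ (-(β • M u)) (P (-(β • M u))) ≤ (β * CA) ^ 2 * ‖u‖ ^ 2 := by
    refine (h.le_norm _).trans ?_
    rw [norm_neg, norm_smul, mul_pow, mul_pow, Real.norm_eq_abs, sq_abs, mul_assoc]
    gcongr
    rw [← mul_pow]
    gcongr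
    exact (M.le_opNorm u).trans (mul_le_mul_of_nonneg_right hM (norm_nonneg _))
  rw [h2]
  linarith

lemma IsAdaptedForm.inner_add_le {M P : Mat d} {a κ : ℝ} (h : IsAdaptedForm M a κ P)
    (y r : Vec d) :
    inner ℝ (y + r) (P (y + r)) ≤ inner ℝ y (P y) + 2 * (‖y‖ * ‖r‖) + ‖r‖ ^ 2 := by
  rw [h.isPosForm.inner_add]
  have h1 := (le_abs_self _).trans (h.abs_inner_le y r)
  have h2 := h.le_norm r
  linarith

/-- The bias constant of one block. -/
def blockBias (m t : ℕ) (CA S : ℝ) : ℝ := 48 / 47 * m * CA * (9 * t * S) + 3 * CA * t * S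

/-- The noise constant of one block. -/
def blockNoise (m t : ℕ) (a CA S : ℝ) : ℝ :=
  22 * blockBias m t CA S ^ 2 / a + 151 * m * (9 * t * S) ^ 2

/-- The constant in the stationary part of the moment bound for the error process. -/
def stabilityConst (m t : ℕ) (a κ CA S : ℝ) : ℝ :=
  6 * κ * (3 * t * S) ^ 2 + 18 * κ * blockNoise m t a CA S / a
    + 2 * (2 * m * (9 * t * S) + 3 * t * S) ^ 2

variable {Q : Kernel Z Z} [IsMarkovKernel Q] {π : Measure Z} [IsProbabilityMeasure π] {t : ℕ}
  {A : Z → Mat d} {M : Mat d} {ε : Z → Vec d} {P : Mat d} {a κ CA S : ℝ}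

namespace CentredProblem

variable (h : CentredProblem Q π t A M ε P a κ CA S)
include h

lemma S_nonneg : 0 ≤ S := by
  obtain ⟨z⟩ : Nonempty Z := nonempty_of_isProbabilityMeasure π
  exact h.noise_nonneg z

lemma blockNoise_nonneg (m : ℕ) : 0 ≤ blockNoise m t a CA S := by
  have := h.a_pos
  have := h.S_nonneg
  unfold blockNoise
  positivity

variable [MeasurableSingletonClass Z] (ξ : Measure Z) [IsProbabilityMeasure ξ]

omit [IsProbabilityMeasure ξ] in
-- The smoothness inequality is applied once per block with q = p/2, and `block_inequality` then
-- absorbs the fluctuation cost into the drift. Working per block rather than per step gives the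
-- chain time to mix.
lemma eLpNorm_form_le_eLpNorm {p γ : ℝ} (hp : 2 ≤ p) (hγ : 0 < γ) (hγ2 : γ ≤ 2) {m : ℕ}
    (hm1 : 1 ≤ m) (hmt : 8 * CA * t ≤ a * m) (hsmall : 24 * p * CA ^ 2 * (γ * m) ≤ a)
    (e₀ : Vec d) (k : ℕ) :
    eLpNorm (fun ω => inner ℝ (shiftedErr Q A ε γ e₀ ω (k + m))
        (P (shiftedErr Q A ε γ e₀ ω (k + m)))) (ENNReal.ofReal (p / 2)) (chainLaw Q ξ) ≤
      eLpNorm (fun ω => (1 - a * (γ * m) / 6) * inner ℝ (shiftedErr Q A ε γ e₀ ω k)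
        (P (shiftedErr Q A ε γ e₀ ω k)) + p * γ * (γ * m) * blockNoise m t a CA S)
        (ENNReal.ofReal (p / 2)) (chainLaw Q ξ) := by
  have ha := h.a_pos
  have hCA := h.CA_pos
  have hS := h.S_nonneg
  have hmpos : (0 : ℝ) < m := by exact_mod_cast hm1
  have hβ : 0 < γ * m := by positivity
  obtain ⟨hx0, hx48, -, hx2, -⟩ := block_small hβ hp ha h.a_le rfl hsmall
  obtain ⟨K, hK⟩ := h.exists_norm_shiftedErr_le γ e₀ (k + m)
  set W : (ℕ → Z) → ℝ := fun ω => 48 / 47 * (γ * m * (CA * ‖shiftedErr Q A ε γ e₀ ω k‖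
    + 9 * t * S)) with hW
  -- The end of the block and its conditional mean both lie within `W` of the starting state, hence
  -- within 2`W` of each other.
  refine IsPosForm.eLpNorm_le_of_condChain Q ξ h.adapted.isPosForm k
    (h.stronglyMeasurable_shiftedErr γ e₀ (k + m)) hK (by linarith) (fun ω => rfl)
    (T := fun ω => (2 * W ω) ^ 2) ?_ ?_
  · intro ω
    have hd : ∀ᵐ ω' ∂(condChain Q k ω),
        ‖shiftedErr Q A ε γ e₀ ω' (k + m) - shiftedErr Q A ε γ e₀ ω k‖ ≤ W ω := by
      filter_upwards [ae_condChain_eq Q k ω] with ω' hω'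
      have h1 := h.norm_shiftedErr_sub_le hγ.le hm1 hx48 e₀ ω' k le_rfl
      rwa [shiftedErr_congr (Q := Q) (A := A) (ε := ε) γ e₀ hω'] at h1
    have hV : Integrable (fun ω' => shiftedErr Q A ε γ e₀ ω' (k + m)) (condChain Q k ω) :=
      integrable_of_bound (h.stronglyMeasurable_shiftedErr γ e₀ (k + m)) hK
    have hc : ‖∫ ω', shiftedErr Q A ε γ e₀ ω' (k + m) ∂(condChain Q k ω)
        - shiftedErr Q A ε γ e₀ ω k‖ ≤ W ω := by
      have h1 := norm_integral_le_of_norm_le_const hd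
      rw [integral_sub hV (integrable_const _)] at h1
      simpa using h1
    filter_upwards [hd] with ω' hω'
    refine (h.adapted.le_norm _).trans ?_
    gcongr
    calc _ = ‖(shiftedErr Q A ε γ e₀ ω' (k + m) - shiftedErr Q A ε γ e₀ ω k)
          - (∫ ω', shiftedErr Q A ε γ e₀ ω' (k + m) ∂(condChain Q k ω)
            - shiftedErr Q A ε γ e₀ ω k)‖ := by rw [sub_sub_sub_cancel_right]
      _ ≤ _ := (norm_sub_le _ _).trans (by linarith)
  · intro ω
    have hR := h.norm_integral_shiftedErr_sub_le hγ.le hm1 hx48 e₀ k ω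
    set u := shiftedErr Q A ε γ e₀ ω k with hu
    set c := ∫ ω', shiftedErr Q A ε γ e₀ ω' (k + m) ∂(condChain Q k ω) with hc
    set y := u - (γ * m) • M u with hy
    have hform := h.adapted.inner_add_le y (c - y)
    rw [add_sub_cancel] at hform
    have hyf := h.adapted.inner_sub_smul_le (β := γ * m) h.norm_mean_le u
    rw [← hy] at hyf
    have hyn : ‖y‖ ≤ (1 + γ * m * CA) * ‖u‖ := by
      have h1 : ‖(γ * m) • M u‖ ≤ γ * m * (CA * ‖u‖) := by
        rw [norm_smul, Real.norm_of_nonneg hβ.le]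
        gcongr
        exact (M.le_opNorm u).trans (mul_le_mul_of_nonneg_right h.norm_mean_le (norm_nonneg _))
      have h2 := norm_sub_le u ((γ * m) • M u)
      rw [← hy] at h2
      linarith
    have hR' : ‖c - y‖ ≤ (1 / 3 + 1 / 47) * (a * (γ * m)) * ‖u‖
        + blockBias m t CA S * γ * (γ * m) := by
      refine hR.trans ?_
      -- The block length enters here: the mixing error (8/3) t C_A γ‖u‖ is at most a third of
      -- aγm‖u‖. The share 1/47 is (48/47)(γ m C_A)² with (γ m C_A)² ≤ aγm/48.
      have h1 : γ * ‖u‖ * (8 * CA * t) ≤ γ * ‖u‖ * (a * m) := by gcongr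
      have h2 : (γ * m * CA) ^ 2 * ‖u‖ ≤ a * (γ * m) / 48 * ‖u‖ := by gcongr
      unfold blockBias
      linarith
    have hblock := block_inequality (N := inner ℝ u (P u)) (W := W ω) (H := 9 * t * S)
      ha hβ hγ hγ2 hp rfl h.a_le rfl hsmall (norm_nonneg u)
      (h.adapted.le_norm u) (norm_nonneg _) hR' (by positivity)
      (by rw [hW]; simp only; rw [← hu]; apply le_of_eq; ring)
    have hprod : ‖y‖ * ‖c - y‖ ≤ (1 + γ * m * CA) * ‖u‖ * ‖c - y‖ := by gcongr
    have e8 : 8 * (p / 2) * (2 * W ω) ^ 2 = 4 * p * (2 * W ω) ^ 2 := by ring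
    rw [e8]
    unfold blockNoise
    linarith

/-- The block recursion is iterated with Minkowski's inequality in L^{p/2}. The stationary term is
the fixed point of the affine recursion, pγ·γm·N / (aγm/6) with N the block noise constant. -/
lemma eLpNorm_form_le {p γ : ℝ} (hp : 2 ≤ p) (hγ : 0 < γ) (hγ2 : γ ≤ 2) {m : ℕ}
    (hm1 : 1 ≤ m) (hmt : 8 * CA * t ≤ a * m) (hsmall : 24 * p * CA ^ 2 * (γ * m) ≤ a)
    (e₀ : Vec d) (i : ℕ) :
    eLpNorm (fun ω => inner ℝ (shiftedErr Q A ε γ e₀ ω (i * m))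
        (P (shiftedErr Q A ε γ e₀ ω (i * m)))) (ENNReal.ofReal (p / 2)) (chainLaw Q ξ) ≤
      ENNReal.ofReal ((1 - a * (γ * m) / 6) ^ i * (2 * ‖e₀‖ ^ 2 + 2 * (γ * (3 * t * S)) ^ 2)
        + 6 * p * γ * blockNoise m t a CA S / a) := by
  have ha := h.a_pos
  have hCA := h.CA_pos
  have hmpos : (0 : ℝ) < m := by exact_mod_cast hm1
  have hβ : 0 < γ * m := by positivity
  obtain ⟨hx0, hx48, -, hx2, haβ⟩ := block_small hβ hp ha h.a_le rfl hsmall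
  have hρ : 0 ≤ 1 - a * (γ * m) / 6 := by linarith
  have hN := h.blockNoise_nonneg m
  have hq : (1 : ℝ≥0∞) ≤ ENNReal.ofReal (p / 2) := by
    rw [ENNReal.one_le_ofReal]; linarith
  induction i with
  | zero =>
    rw [zero_mul, pow_zero, one_mul]
    have h1 : ∀ ω : ℕ → Z, ‖inner ℝ (shiftedErr Q A ε γ e₀ ω 0)
        (P (shiftedErr Q A ε γ e₀ ω 0))‖ ≤ 2 * ‖e₀‖ ^ 2 + 2 * (γ * (3 * t * S)) ^ 2 := by
      intro ω
      rw [Real.norm_of_nonneg (h.adapted.nonneg _)]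
      refine (h.adapted.le_norm _).trans ?_
      have h2 : ‖shiftedErr Q A ε γ e₀ ω 0‖ ≤ ‖e₀‖ + γ * (3 * t * S) := by
        refine (norm_sub_le _ _).trans (add_le_add le_rfl ?_)
        rw [norm_smul, Real.norm_of_nonneg hγ.le]
        gcongr
        exact h.norm_poissonTail_noise_le _
      calc _ ≤ (‖e₀‖ + γ * (3 * t * S)) ^ 2 := by gcongr
        _ ≤ _ := by linarith [add_sq_le (a := ‖e₀‖) (b := γ * (3 * t * S))]
    refine (eLpNorm_le_of_ae_bound (Filter.Eventually.of_forall h1)).trans ?_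
    simp only [measure_univ, ENNReal.one_rpow, one_mul]
    refine ENNReal.ofReal_le_ofReal ?_
    have : 0 ≤ 6 * p * γ * blockNoise m t a CA S / a := by positivity
    linarith
  | succ i ih =>
    have h1 := h.eLpNorm_form_le_eLpNorm ξ hp hγ hγ2 hm1 hmt hsmall e₀ (i * m)
    rw [← Nat.succ_mul] at h1
    refine h1.trans ?_
    have hVm := h.stronglyMeasurable_shiftedErr γ e₀ (i * m)
    have hfm : AEStronglyMeasurable (fun ω => (1 - a * (γ * m) / 6) *
        inner ℝ (shiftedErr Q A ε γ e₀ ω (i * m)) (P (shiftedErr Q A ε γ e₀ ω (i * m))))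
        (chainLaw Q ξ) :=
      ((hVm.inner (P.continuous.comp_stronglyMeasurable hVm)).const_mul _).aestronglyMeasurable
    refine (eLpNorm_add_le hfm aestronglyMeasurable_const hq).trans ?_
    have h2 : eLpNorm (fun ω => (1 - a * (γ * m) / 6) *
        inner ℝ (shiftedErr Q A ε γ e₀ ω (i * m)) (P (shiftedErr Q A ε γ e₀ ω (i * m))))
        (ENNReal.ofReal (p / 2)) (chainLaw Q ξ) ≤ ENNReal.ofReal ((1 - a * (γ * m) / 6) *
        ((1 - a * (γ * m) / 6) ^ i * (2 * ‖e₀‖ ^ 2 + 2 * (γ * (3 * t * S)) ^ 2)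
        + 6 * p * γ * blockNoise m t a CA S / a)) := by
      refine (eLpNorm_const_smul_le (c := 1 - a * (γ * m) / 6)).trans ?_
      rw [ENNReal.ofReal_mul hρ, Real.enorm_of_nonneg hρ]
      gcongr
    have h3 : eLpNorm (fun _ : ℕ → Z => p * γ * (γ * m) * blockNoise m t a CA S)
        (ENNReal.ofReal (p / 2)) (chainLaw Q ξ) ≤
        ENNReal.ofReal (p * γ * (γ * m) * blockNoise m t a CA S) := by
      rw [eLpNorm_const _ (by positivity) (NeZero.ne _)]
      have : 0 ≤ p * γ * (γ * m) * blockNoise m t a CA S := by positivity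
      simp [Real.enorm_of_nonneg this]
    refine (add_le_add h2 h3).trans ?_
    rw [← ENNReal.ofReal_add (by positivity) (by positivity)]
    refine ENNReal.ofReal_le_ofReal (le_of_eq ?_)
    rw [pow_succ]
    field_simp
    ring

/-- Moments of the error process: the initial error is forgotten exponentially fast. -/
theorem eLpNorm_sq_err_le {p γ : ℝ} (hp : 2 ≤ p) (hγ : 0 < γ) (hγ2 : γ ≤ 2) {m : ℕ}
    (hm1 : 1 ≤ m) (hmt : 8 * CA * t ≤ a * m) (hsmall : 24 * p * CA ^ 2 * (γ * m) ≤ a)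
    (e₀ : Vec d) (k : ℕ) :
    eLpNorm (fun ω => ‖err A ε γ e₀ ω k‖ ^ 2) (ENNReal.ofReal (p / 2)) (chainLaw Q ξ) ≤
      ENNReal.ofReal (12 * κ * Real.exp (-(a * γ * k) / 6) * ‖e₀‖ ^ 2
        + stabilityConst m t a κ CA S * (p * γ)) := by
  have ha := h.a_pos
  have hCA := h.CA_pos
  have hS := h.S_nonneg
  have hκ := h.adapted.one_le_kappa
  have hmpos : (0 : ℝ) < m := by exact_mod_cast hm1
  have hβ : 0 < γ * m := by positivity
  obtain ⟨hx0, hx48, -, hx2, haβ⟩ := block_small hβ hp ha h.a_le rfl hsmall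
  have hρ : 0 ≤ 1 - a * (γ * m) / 6 := by linarith
  have hN := h.blockNoise_nonneg m
  have hq : (1 : ℝ≥0∞) ≤ ENNReal.ofReal (p / 2) := by
    rw [ENNReal.one_le_ofReal]; linarith
  set C4 := 2 * m * (9 * t * S) + 3 * t * S with hC4
  have hC40 : 0 ≤ C4 := by positivity
  set i := k / m
  set r := k % m
  have hk : k = i * m + r := by rw [mul_comm]; exact (Nat.div_add_mod k m).symm
  have hr : r < m := Nat.mod_lt _ (by omega)
  have hpt : ∀ ω : ℕ → Z, ‖err A ε γ e₀ ω k‖ ^ 2 ≤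
      3 * κ * inner ℝ (shiftedErr Q A ε γ e₀ ω (i * m)) (P (shiftedErr Q A ε γ e₀ ω (i * m)))
        + 2 * (C4 * γ) ^ 2 := by
    intro ω
    set v := shiftedErr Q A ε γ e₀ ω (i * m) with hv
    have h1 := h.norm_shiftedErr_sub_le hγ.le hm1 hx48 e₀ ω (i * m) hr.le
    -- Times inside a block are compared with the start of the block; 3κ in the pointwise bound
    -- comes from 2(48/47)² ≤ 3 and the norm comparison.
    rw [← hv, ← hk] at h1
    have h2 : err A ε γ e₀ ω k = v + (shiftedErr Q A ε γ e₀ ω k - v)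
        + γ • poissonTail Q ε (ω k) := by rw [shiftedErr]; abel
    have h3 : ‖γ • poissonTail Q ε (ω k)‖ ≤ γ * (3 * t * S) := by
      rw [norm_smul, Real.norm_of_nonneg hγ.le]
      gcongr
      exact h.norm_poissonTail_noise_le _
    have h4 : γ * m * CA * ‖v‖ ≤ 1 / 48 * ‖v‖ := by gcongr
    have h6 : 0 ≤ γ * m * (9 * t * S) := by positivity
    have h5 : ‖err A ε γ e₀ ω k‖ ≤ 48 / 47 * ‖v‖ + C4 * γ := by
      rw [h2]
      refine (norm_add_le _ _).trans ?_
      have := norm_add_le v (shiftedErr Q A ε γ e₀ ω k - v)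
      rw [hC4]
      linarith
    calc ‖err A ε γ e₀ ω k‖ ^ 2 ≤ (48 / 47 * ‖v‖ + C4 * γ) ^ 2 := by gcongr
      _ ≤ 2 * ((48 / 47 * ‖v‖) ^ 2 + (C4 * γ) ^ 2) := add_sq_le
      _ = 2 * (48 / 47) ^ 2 * ‖v‖ ^ 2 + 2 * (C4 * γ) ^ 2 := by ring
      _ ≤ 3 * ‖v‖ ^ 2 + 2 * (C4 * γ) ^ 2 := by
        gcongr
        norm_num
      _ ≤ _ := by
        have := h.adapted.norm_le v
        linarith
  have hmono : eLpNorm (fun ω => ‖err A ε γ e₀ ω k‖ ^ 2) (ENNReal.ofReal (p / 2))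
      (chainLaw Q ξ) ≤ eLpNorm (fun ω => 3 * κ * inner ℝ (shiftedErr Q A ε γ e₀ ω (i * m))
        (P (shiftedErr Q A ε γ e₀ ω (i * m))) + 2 * (C4 * γ) ^ 2) (ENNReal.ofReal (p / 2))
      (chainLaw Q ξ) :=
    eLpNorm_mono_real fun ω => by
      rw [Real.norm_of_nonneg (by positivity)]
      exact hpt ω
  refine hmono.trans ?_
  have hVm := h.stronglyMeasurable_shiftedErr γ e₀ (i * m)
  have hfm : AEStronglyMeasurable (fun ω => 3 * κ *
      inner ℝ (shiftedErr Q A ε γ e₀ ω (i * m)) (P (shiftedErr Q A ε γ e₀ ω (i * m))))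
      (chainLaw Q ξ) :=
    ((hVm.inner (P.continuous.comp_stronglyMeasurable hVm)).const_mul _).aestronglyMeasurable
  refine (eLpNorm_add_le hfm aestronglyMeasurable_const hq).trans ?_
  have hform := h.eLpNorm_form_le ξ hp hγ hγ2 hm1 hmt hsmall e₀ i
  have h2 : eLpNorm (fun ω => 3 * κ *
      inner ℝ (shiftedErr Q A ε γ e₀ ω (i * m)) (P (shiftedErr Q A ε γ e₀ ω (i * m))))
      (ENNReal.ofReal (p / 2)) (chainLaw Q ξ) ≤ ENNReal.ofReal (3 * κ *
      ((1 - a * (γ * m) / 6) ^ i * (2 * ‖e₀‖ ^ 2 + 2 * (γ * (3 * t * S)) ^ 2)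
        + 6 * p * γ * blockNoise m t a CA S / a)) := by
    refine (eLpNorm_const_smul_le (c := 3 * κ)).trans ?_
    rw [ENNReal.ofReal_mul (by positivity), Real.enorm_of_nonneg (by positivity)]
    gcongr
  have h3 : eLpNorm (fun _ : ℕ → Z => 2 * (C4 * γ) ^ 2)
      (ENNReal.ofReal (p / 2)) (chainLaw Q ξ) ≤ ENNReal.ofReal (2 * (C4 * γ) ^ 2) := by
    rw [eLpNorm_const _ (by positivity) (NeZero.ne _)]
    have : 0 ≤ 2 * (C4 * γ) ^ 2 := by positivity
    simp [Real.enorm_of_nonneg this]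
  refine (add_le_add h2 h3).trans ?_
  rw [← ENNReal.ofReal_add (by positivity) (by positivity)]
  refine ENNReal.ofReal_le_ofReal ?_
  -- The incomplete last block costs at most e^{aγm/6} ≤ e^{1/288} ≤ 2.
  have hpow : (1 - a * (γ * m) / 6) ^ i ≤ 2 * Real.exp (-(a * γ * k) / 6) := by
    have h5 : 1 - a * (γ * m) / 6 ≤ Real.exp (-(a * (γ * m) / 6)) := by
      have := Real.add_one_le_exp (-(a * (γ * m) / 6)); linarith
    have h6 : Real.exp (1 / 288) ≤ 2 := by
      have := Real.exp_bound_div_one_sub_of_interval (x := 1 / 288) (by norm_num) (by norm_num)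
      refine this.trans (by norm_num)
    have h7 : (k : ℝ) ≤ i * m + m := by
      exact_mod_cast (by rw [hk]; omega : k ≤ i * m + m)
    calc (1 - a * (γ * m) / 6) ^ i ≤ Real.exp (-(a * (γ * m) / 6)) ^ i :=
          pow_le_pow_left₀ hρ h5 i
      _ = Real.exp (-(a * γ * (i * m)) / 6) := by
          rw [← Real.exp_nat_mul]; congr 1; ring
      _ ≤ Real.exp (1 / 288 + -(a * γ * k) / 6) := by
          apply Real.exp_le_exp.2
          have : a * γ * k ≤ a * γ * (i * m + m) := by gcongr
          linarith
      _ = Real.exp (1 / 288) * Real.exp (-(a * γ * k) / 6) := Real.exp_add _ _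
      _ ≤ _ := by gcongr
  have hpow1 : (1 - a * (γ * m) / 6) ^ i ≤ 1 := by
    have : 0 ≤ a * (γ * m) := by positivity
    exact pow_le_one₀ hρ (by linarith)
  have hγp : γ ^ 2 ≤ p * γ := by rw [sq]; gcongr; linarith
  have t1 : (1 - a * (γ * m) / 6) ^ i * ‖e₀‖ ^ 2 ≤
      2 * Real.exp (-(a * γ * k) / 6) * ‖e₀‖ ^ 2 := by gcongr
  have t2 : (1 - a * (γ * m) / 6) ^ i * (γ ^ 2 * (3 * t * S) ^ 2) ≤
      1 * (p * γ * (3 * t * S) ^ 2) := by gcongr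
  have t3 : C4 ^ 2 * γ ^ 2 ≤ C4 ^ 2 * (p * γ) := by gcongr
  have t1' := mul_le_mul_of_nonneg_left t1 (by positivity : 0 ≤ 6 * κ)
  have t2' := mul_le_mul_of_nonneg_left t2 (by positivity : 0 ≤ 6 * κ)
  have e1 : 3 * κ * (6 * p * γ * blockNoise m t a CA S / a)
      = 18 * κ * blockNoise m t a CA S / a * (p * γ) := by ring
  unfold stabilityConst
  rw [← hC4, mul_add, e1]
  linarith

end CentredProblem

end Stability

/-! ### Martingale increments from the Poisson equation -/

section PoissonIncrement

variable {Z : Type u} [MeasurableSpace Z] {E : Type*} [NormedAddCommGroup E] [NormedSpace ℝ E]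

/-- The martingale increments attached to the Poisson solution of `f`. -/
def poissonIncr (Q : Kernel Z Z) (f : Z → E) (ω : ℕ → Z) (k : ℕ) : E :=
  poisson Q f (ω (k + 1)) - poissonTail Q f (ω k)

variable {Q : Kernel Z Z} [IsMarkovKernel Q] {π : Measure Z} [IsProbabilityMeasure π] {t : ℕ}

variable [CompleteSpace E] (h : UniformlyGeometricallyErgodic Q π t) {f : Z → E}
  (hf : StronglyMeasurable f) {F : ℝ} (hF : ∀ z, ‖f z‖ ≤ F) (h0 : ∫ z, f z ∂π = 0)
include h hf hF h0

lemma UniformlyGeometricallyErgodic.stronglyMeasurable_poissonIncr (k : ℕ) :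
    StronglyMeasurable fun ω : ℕ → Z => poissonIncr Q f ω k :=
  ((h.stronglyMeasurable_poisson hf hF h0).comp_measurable (measurable_pi_apply _)).sub
    ((h.stronglyMeasurable_poissonTail hf hF h0).comp_measurable (measurable_pi_apply _))

lemma UniformlyGeometricallyErgodic.norm_poisson_sub_le (w z : Z) :
    ‖poisson Q f w - poissonTail Q f z‖ ≤ 6 * t * F := by
  refine (norm_sub_le _ _).trans ?_
  have h1 := h.norm_poisson_le hf hF h0 w
  have h2 := h.norm_poissonTail_le hf hF h0 z
  linarith

end PoissonIncrement

/-! ### The compensated cosh supermartingale -/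

section Exponential

variable {Z : Type u} [MeasurableSpace Z] {E : Type*} [NormedAddCommGroup E]
  [InnerProductSpace ℝ E]

/-- The martingale attached to the Poisson solution of `f`, started at time `s`. -/
def poissonMart (Q : Kernel Z Z) (f : Z → E) (s : ℕ) (ω : ℕ → Z) (j : ℕ) : E :=
  ∑ i ∈ Finset.range j, poissonIncr Q f ω (s + i)

/-- The conditional variance of the martingale increments attached to `f`. -/
def condVar (Q : Kernel Z Z) (f : Z → E) (z : Z) : ℝ :=
  kernelAvg Q (fun w => ‖poisson Q f w‖ ^ 2) 1 z - ‖poissonTail Q f z‖ ^ 2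

lemma poissonMart_succ (Q : Kernel Z Z) (f : Z → E) (s : ℕ) (ω : ℕ → Z) (j : ℕ) :
    poissonMart Q f s ω (j + 1) = poissonMart Q f s ω j + poissonIncr Q f ω (s + j) :=
  Finset.sum_range_succ _ _

/-- Martingale approximation by telescoping. This version, with times s+1, …, s+j, has Qg at the
endpoints and serves the noise; `sum_eq_poissonMart`, with times s, …, s+j−1, matches the indices at
which conditional variances are evaluated. -/
lemma sum_succ_eq_poissonMart (Q : Kernel Z Z) (f : Z → E) (s : ℕ) (ω : ℕ → Z) (j : ℕ) :
    ∑ i ∈ Finset.range j, f (ω (s + i + 1)) =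
      poissonMart Q f s ω j + (poissonTail Q f (ω s) - poissonTail Q f (ω (s + j))) := by
  induction j with
  | zero => simp [poissonMart]
  | succ j ih =>
    rw [Finset.sum_range_succ, ih, poissonMart_succ, poissonIncr, ← add_assoc s j 1]
    simp only [poissonTail]
    abel

lemma sum_eq_poissonMart (Q : Kernel Z Z) (f : Z → E) (s : ℕ) (ω : ℕ → Z) (j : ℕ) :
    ∑ i ∈ Finset.range j, f (ω (s + i)) =
      poissonMart Q f s ω j + (poisson Q f (ω s) - poisson Q f (ω (s + j))) := by
  induction j with
  | zero => simp [poissonMart]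
  | succ j ih =>
    rw [Finset.sum_range_succ, ih, poissonMart_succ, poissonIncr, ← add_assoc s j 1]
    simp only [poissonTail]
    abel

variable {Q : Kernel Z Z} [IsMarkovKernel Q] {π : Measure Z} [IsProbabilityMeasure π] {t : ℕ}

variable [CompleteSpace E] (h : UniformlyGeometricallyErgodic Q π t) {f : Z → E}
  (hf : StronglyMeasurable f) {F : ℝ} (hF : ∀ z, ‖f z‖ ≤ F) (h0 : ∫ z, f z ∂π = 0)
include h hf hF h0

lemma UniformlyGeometricallyErgodic.stronglyMeasurable_poissonMart (s j : ℕ) :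
    StronglyMeasurable fun ω : ℕ → Z => poissonMart Q f s ω j :=
  Finset.stronglyMeasurable_fun_sum _ fun i _ => h.stronglyMeasurable_poissonIncr hf hF h0 (s + i)

lemma UniformlyGeometricallyErgodic.stronglyMeasurable_condVar :
    StronglyMeasurable (condVar Q f) :=
  (stronglyMeasurable_kernelAvg ((h.stronglyMeasurable_poisson hf hF h0).norm.pow 2) 1).sub
    ((h.stronglyMeasurable_poissonTail hf hF h0).norm.pow 2)

lemma UniformlyGeometricallyErgodic.integral_norm_sq_eq_condVar (z : Z) :
    ∫ w, ‖poisson Q f w - poissonTail Q f z‖ ^ 2 ∂(Q z) = condVar Q f z := by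
  have hm := h.stronglyMeasurable_poisson hf hF h0
  have hb := h.norm_poisson_le hf hF h0
  have hg : Integrable (poisson Q f) (Q z) := integrable_of_bound hm hb
  have hg2 : Integrable (fun w => ‖poisson Q f w‖ ^ 2) (Q z) :=
    integrable_of_bound (hm.norm.pow 2) (F := (3 * t * F) ^ 2) fun w => by
      rw [norm_pow, norm_norm]
      gcongr
      exact hb w
  have hi : Integrable (fun w => 2 * inner ℝ (poissonTail Q f z) (poisson Q f w)) (Q z) :=
    ((innerSL ℝ (poissonTail Q f z)).integrable_comp hg).const_mul 2
  have hlin : ∫ w, inner ℝ (poissonTail Q f z) (poisson Q f w) ∂(Q z)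
      = ‖poissonTail Q f z‖ ^ 2 := by
    refine ((innerSL ℝ (poissonTail Q f z)).integral_comp_comm hg).trans ?_
    rw [h.integral_poisson hf hF h0, ← poissonTail, innerSL_apply_apply,
      real_inner_self_eq_norm_sq]
  have e : ∀ w, ‖poisson Q f w - poissonTail Q f z‖ ^ 2 = ‖poisson Q f w‖ ^ 2
      - 2 * inner ℝ (poissonTail Q f z) (poisson Q f w) + ‖poissonTail Q f z‖ ^ 2 := by
    intro w
    rw [norm_sub_sq_real, real_inner_comm]
  simp only [e]
  have hs : Integrable (fun w => ‖poisson Q f w‖ ^ 2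
      - 2 * inner ℝ (poissonTail Q f z) (poisson Q f w)) (Q z) := hg2.sub hi
  rw [integral_add hs (integrable_const _), integral_sub hg2 hi, integral_const_mul, hlin,
    condVar, kernelAvg_one]
  simp only [probReal_univ, integral_const, one_smul]
  ring

lemma UniformlyGeometricallyErgodic.condVar_nonneg (z : Z) : 0 ≤ condVar Q f z := by
  rw [← h.integral_norm_sq_eq_condVar hf hF h0]
  exact integral_nonneg fun _ => sq_nonneg _

lemma UniformlyGeometricallyErgodic.condVar_le (z : Z) : condVar Q f z ≤ (6 * t * F) ^ 2 := by
  rw [← h.integral_norm_sq_eq_condVar hf hF h0]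
  refine (le_abs_self _).trans ?_
  rw [← Real.norm_eq_abs]
  refine norm_integral_le_of_bound fun w => ?_
  rw [norm_pow, norm_norm]
  gcongr
  exact h.norm_poisson_sub_le hf hF h0 w z

variable [MeasurableSingletonClass Z] (ξ : Measure Z) [IsProbabilityMeasure ξ]

/-- The compensated hyperbolic cosine of the martingale is a supermartingale. -/
lemma UniformlyGeometricallyErgodic.lintegral_cosh_poissonMart_le {lam : ℝ} (hl : 0 ≤ lam)
    (hlB : lam * (6 * t * F) ≤ 1) (s j : ℕ) :
    ∫⁻ ω, ENNReal.ofReal (Real.cosh (lam * ‖poissonMart Q f s ω j‖)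
      * Real.exp (-(lam ^ 2 * ∑ i ∈ Finset.range j, condVar Q f (ω (s + i))))) ∂(chainLaw Q ξ)
      ≤ 1 := by
  induction j with
  | zero => simp [poissonMart]
  | succ j ih =>
    have hMm : ∀ j, StronglyMeasurable fun ω : ℕ → Z => poissonMart Q f s ω j := fun j =>
      h.stronglyMeasurable_poissonMart hf hF h0 s j
    have hcm : ∀ i, Measurable fun ω : ℕ → Z => condVar Q f (ω (s + i)) := fun i =>
      (h.stronglyMeasurable_condVar hf hF h0).measurable.comp (measurable_pi_apply _)
    refine le_trans ?_ ih
    -- Condition at time s + j. The compensator up to index j is evaluated at Z_s, …, Z_{s+j}, so it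
    -- is predictable and leaves the conditional integral; only Z_{s+j+1} is random there.
    rw [lintegral_chainLaw_condChain Q ξ (s + j)]
    · refine lintegral_mono fun ω => ?_
      have hag := ae_condChain_eq Q (s + j) ω
      have hMeq : ∀ᵐ ω' ∂(condChain Q (s + j) ω),
          poissonMart Q f s ω' j = poissonMart Q f s ω j ∧
          poissonIncr Q f ω' (s + j) = poisson Q f (ω' (s + j + 1)) - poissonTail Q f (ω (s + j))
          ∧ ∑ i ∈ Finset.range (j + 1), condVar Q f (ω' (s + i))
            = ∑ i ∈ Finset.range (j + 1), condVar Q f (ω (s + i)) := by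
        filter_upwards [hag] with ω' hω'
        refine ⟨Finset.sum_congr rfl fun i hi => ?_, ?_, Finset.sum_congr rfl fun i hi => ?_⟩
        · have := Finset.mem_range.1 hi
          rw [poissonIncr, poissonIncr, hω' _ (by omega), hω' _ (by omega)]
        · rw [poissonIncr, hω' _ le_rfl]
        · have := Finset.mem_range.1 hi
          rw [hω' _ (by omega)]
      set c := poissonMart Q f s ω j with hc
      set H := ∑ i ∈ Finset.range (j + 1), condVar Q f (ω (s + i)) with hH
      have hgm := h.stronglyMeasurable_poisson hf hF h0
      have hgi : Integrable (fun ω' : ℕ → Z => poisson Q f (ω' (s + j + 1)))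
          (condChain Q (s + j) ω) :=
        integrable_of_bound (hgm.comp_measurable (measurable_pi_apply _))
          fun _ => h.norm_poisson_le hf hF h0 _
      have hmean : ∫ ω', poisson Q f (ω' (s + j + 1)) ∂(condChain Q (s + j) ω)
          = poissonTail Q f (ω (s + j)) := by
        rw [integral_condChain_add Q (s + j) 1 ω hgm, pow_one, h.integral_poisson hf hF h0,
          poissonTail]
      have hVm : StronglyMeasurable fun ω' : ℕ → Z => lam • (c
          + (poisson Q f (ω' (s + j + 1)) - poissonTail Q f (ω (s + j)))) :=
        (stronglyMeasurable_const.add ((hgm.comp_measurable (measurable_pi_apply _)).sub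
          stronglyMeasurable_const)).const_smul lam
      have hVc : ∫ ω', lam • (c + (poisson Q f (ω' (s + j + 1)) - poissonTail Q f (ω (s + j))))
          ∂(condChain Q (s + j) ω) = lam • c := by
        have hs : Integrable (fun ω' : ℕ → Z => poisson Q f (ω' (s + j + 1))
          - poissonTail Q f (ω (s + j))) (condChain Q (s + j) ω) := hgi.sub (integrable_const _)
        rw [integral_smul, integral_add (integrable_const _) hs,
          integral_sub hgi (integrable_const _), hmean]
        simp
      have hd : ∀ ω' : ℕ → Z, ‖lam • (c + (poisson Q f (ω' (s + j + 1))
          - poissonTail Q f (ω (s + j)))) - lam • c‖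
          = lam * ‖poisson Q f (ω' (s + j + 1)) - poissonTail Q f (ω (s + j))‖ := by
        intro ω'
        rw [← smul_sub, add_sub_cancel_left, norm_smul, Real.norm_of_nonneg hl]
      have hstep := lintegral_cosh_le hVm hVc (Filter.Eventually.of_forall fun ω' => by
        rw [hd]
        refine le_trans ?_ hlB
        gcongr
        exact h.norm_poisson_sub_le hf hF h0 _ _)
      have hvar : ∫ ω', ‖lam • (c + (poisson Q f (ω' (s + j + 1))
          - poissonTail Q f (ω (s + j)))) - lam • c‖ ^ 2 ∂(condChain Q (s + j) ω)
          = lam ^ 2 * condVar Q f (ω (s + j)) := by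
        simp only [hd, mul_pow]
        rw [integral_const_mul]
        congr 1
        have := integral_condChain_add Q (s + j) 1 ω
          (f := fun w => ‖poisson Q f w - poissonTail Q f (ω (s + j))‖ ^ 2)
          ((hgm.sub stronglyMeasurable_const).norm.pow 2)
        rw [this, pow_one, h.integral_norm_sq_eq_condVar hf hF h0]
      rw [hvar] at hstep
      calc ∫⁻ ω', ENNReal.ofReal (Real.cosh (lam * ‖poissonMart Q f s ω' (j + 1)‖)
            * Real.exp (-(lam ^ 2 * ∑ i ∈ Finset.range (j + 1), condVar Q f (ω' (s + i)))))
            ∂(condChain Q (s + j) ω)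
          = ∫⁻ ω', ENNReal.ofReal (Real.exp (-(lam ^ 2 * H))) * ENNReal.ofReal (Real.cosh
              ‖lam • (c + (poisson Q f (ω' (s + j + 1)) - poissonTail Q f (ω (s + j))))‖)
              ∂(condChain Q (s + j) ω) := by
            refine lintegral_congr_ae ?_
            filter_upwards [hMeq] with ω' hω'
            rw [poissonMart_succ, hω'.1, hω'.2.1, hω'.2.2, norm_smul, Real.norm_of_nonneg hl,
              ← ENNReal.ofReal_mul (Real.exp_pos _).le, mul_comm]
        _ = ENNReal.ofReal (Real.exp (-(lam ^ 2 * H))) * ∫⁻ ω', ENNReal.ofReal (Real.cosh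
              ‖lam • (c + (poisson Q f (ω' (s + j + 1)) - poissonTail Q f (ω (s + j))))‖)
              ∂(condChain Q (s + j) ω) := by
            rw [lintegral_const_mul]
            exact (Real.continuous_cosh.comp_stronglyMeasurable
              hVm.norm).measurable.ennreal_ofReal
        _ ≤ ENNReal.ofReal (Real.exp (-(lam ^ 2 * H))) * ENNReal.ofReal (Real.cosh ‖lam • c‖
              * Real.exp (lam ^ 2 * condVar Q f (ω (s + j)))) := by gcongr
        _ = _ := by
            rw [← ENNReal.ofReal_mul (Real.exp_pos _).le]
            congr 1
            rw [norm_smul, Real.norm_of_nonneg hl, mul_left_comm, ← Real.exp_add, hH,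
              Finset.sum_range_succ]
            congr 2
            ring
    · refine Measurable.ennreal_ofReal (Measurable.mul ?_ ?_)
      · exact (Real.continuous_cosh.comp_stronglyMeasurable
          ((hMm (j + 1)).norm.const_mul lam)).measurable
      · exact Real.measurable_exp.comp
          ((Finset.measurable_sum _ fun i _ => hcm i).const_mul _).neg

end Exponential

/-! ### A Rosenthal inequality for additive functionals -/

section Rosenthal

lemma rpow_le_mul_cosh {x p : ℝ} (hx : 0 ≤ x) (hp : 0 < p) :
    x ^ p ≤ p ^ p * (2 * Real.cosh x) := by
  have h1 : x ≤ p * Real.exp (x / p) := by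
    have := Real.add_one_le_exp (x / p)
    calc x = p * (x / p) := by field_simp
      _ ≤ _ := by gcongr; linarith
  calc x ^ p ≤ (p * Real.exp (x / p)) ^ p := Real.rpow_le_rpow hx h1 hp.le
    _ = p ^ p * Real.exp x := by
        rw [Real.mul_rpow hp.le (Real.exp_pos _).le, ← Real.exp_mul, div_mul_cancel₀ _ hp.ne']
    _ ≤ _ := by
        gcongr
        rw [Real.cosh_eq]
        linarith [Real.exp_pos (-x)]

lemma cosh_sq_le_cosh_two_mul (x : ℝ) : Real.cosh x ^ 2 ≤ Real.cosh (2 * x) := by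
  rw [Real.cosh_two_mul]
  linarith [sq_nonneg (Real.sinh x)]

/-- The inequality 2ab ≤ a² + b² separates the martingale from the random compensator: the first
term is a supermartingale at doubled parameter, the second an exponential moment of the compensator.
-/
lemma cosh_le_half_add (x u : ℝ) :
    Real.cosh x ≤ 1 / 2 * (Real.cosh (2 * x) * Real.exp (-u) + Real.exp u) := by
  have h1 : Real.cosh x = (Real.cosh x * Real.exp (-(u / 2))) * Real.exp (u / 2) := by
    rw [mul_assoc, ← Real.exp_add]; simp
  have h2 : (Real.cosh x * Real.exp (-(u / 2))) ^ 2 = Real.cosh x ^ 2 * Real.exp (-u) := by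
    rw [mul_pow, ← Real.exp_nat_mul]; congr 2; push_cast; ring
  have h3 : Real.exp (u / 2) ^ 2 = Real.exp u := by
    rw [← Real.exp_nat_mul]; congr 1; push_cast; ring
  have h4 := two_mul_le_add_sq (Real.cosh x * Real.exp (-(u / 2))) (Real.exp (u / 2))
  rw [h2, h3] at h4
  have h5 : Real.cosh x ^ 2 * Real.exp (-u) ≤ Real.cosh (2 * x) * Real.exp (-u) := by
    gcongr
    exact cosh_sq_le_cosh_two_mul x
  linarith

lemma eLpNorm_le_of_lintegral_cosh_le {Ω E : Type*} [MeasurableSpace Ω] [NormedAddCommGroup E]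
    {ν : Measure Ω} {X : Ω → E} {lam p : ℝ} (hl : 0 < lam) (hp : 2 ≤ p)
    (hX : ∫⁻ ω, ENNReal.ofReal (Real.cosh (lam * ‖X ω‖)) ∂ν ≤ ENNReal.ofReal (Real.exp (2 * p))) :
    eLpNorm X (ENNReal.ofReal p) ν ≤ ENNReal.ofReal (2 * Real.exp 2 * (p / lam)) := by
  have hp0 : 0 < p := by linarith
  rw [eLpNorm_eq_lintegral_rpow_enorm_toReal (by simpa using hp0) ENNReal.ofReal_ne_top,
    ENNReal.toReal_ofReal hp0.le, one_div, ENNReal.rpow_inv_le_iff hp0]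
  have hpt : ∀ ω, ‖X ω‖ₑ ^ p ≤ ENNReal.ofReal ((p / lam) ^ p * 2)
      * ENNReal.ofReal (Real.cosh (lam * ‖X ω‖)) := by
    intro ω
    rw [← ofReal_norm, ENNReal.ofReal_rpow_of_nonneg (norm_nonneg _) hp0.le,
      ← ENNReal.ofReal_mul (by positivity)]
    refine ENNReal.ofReal_le_ofReal ?_
    have h1 := rpow_le_mul_cosh (x := lam * ‖X ω‖) (by positivity) hp0
    rw [Real.mul_rpow hl.le (norm_nonneg _)] at h1
    rw [Real.div_rpow hp0.le hl.le]
    have h2 : 0 < lam ^ p := Real.rpow_pos_of_pos hl p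
    rw [mul_comm (lam ^ p), ← le_div_iff₀ h2] at h1
    refine h1.trans (le_of_eq ?_)
    ring
  have h2 : (2 : ℝ) ≤ 2 ^ p := by
    have := Real.rpow_le_rpow_of_exponent_le (x := 2) (by norm_num) (show (1 : ℝ) ≤ p by linarith)
    rwa [Real.rpow_one] at this
  calc ∫⁻ ω, ‖X ω‖ₑ ^ p ∂ν
      ≤ ∫⁻ ω, ENNReal.ofReal ((p / lam) ^ p * 2)
        * ENNReal.ofReal (Real.cosh (lam * ‖X ω‖)) ∂ν := lintegral_mono hpt
    _ = ENNReal.ofReal ((p / lam) ^ p * 2)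
        * ∫⁻ ω, ENNReal.ofReal (Real.cosh (lam * ‖X ω‖)) ∂ν :=
        lintegral_const_mul' _ _ ENNReal.ofReal_ne_top
    _ ≤ ENNReal.ofReal ((p / lam) ^ p * 2) * ENNReal.ofReal (Real.exp (2 * p)) := by gcongr
    _ ≤ _ := by
        rw [← ENNReal.ofReal_mul (by positivity), ENNReal.ofReal_rpow_of_nonneg (by positivity)
          hp0.le]
        refine ENNReal.ofReal_le_ofReal ?_
        rw [Real.mul_rpow (by positivity) (by positivity),
          Real.mul_rpow (by positivity) (by positivity), ← Real.exp_mul]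
        have : 0 ≤ (p / lam) ^ p * Real.exp (2 * p) := by positivity
        have := mul_le_mul_of_nonneg_right h2 this
        linarith

variable {Z : Type u} [MeasurableSpace Z] {E : Type*} [NormedAddCommGroup E]
  [InnerProductSpace ℝ E]
variable {Q : Kernel Z Z} [IsMarkovKernel Q] {π : Measure Z} [IsProbabilityMeasure π] {t : ℕ}

/-- The remainder constant in the moment bound for additive functionals. -/
def rosenthalConst (t : ℕ) (F : ℝ) : ℝ :=
  4 * Real.exp 2 * (2 * √(6 * t * (6 * t * F) ^ 2) + 6 * t * F) + 6 * t * F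

variable [CompleteSpace E] [MeasurableSingletonClass Z]
  (h : UniformlyGeometricallyErgodic Q π t) (ξ : Measure Z) [IsProbabilityMeasure ξ]
include h

/-- Exponential moments of additive functionals of a bounded centred real function. -/
lemma UniformlyGeometricallyErgodic.lintegral_exp_sum_le {f : Z → ℝ}
    (hf : StronglyMeasurable f) {F : ℝ} (hF : ∀ z, ‖f z‖ ≤ F) (h0 : ∫ z, f z ∂π = 0) {θ : ℝ}
    (hθ : 0 ≤ θ) (hθB : θ * (6 * t * F) ≤ 1) (s N : ℕ) :
    ∫⁻ ω, ENNReal.ofReal (Real.exp (θ * ∑ i ∈ Finset.range N, f (ω (s + i)))) ∂(chainLaw Q ξ) ≤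
      ENNReal.ofReal (2 * Real.exp (θ * (6 * t * F) + θ ^ 2 * (N * (6 * t * F) ^ 2))) := by
  have hpt : ∀ ω : ℕ → Z, Real.exp (θ * ∑ i ∈ Finset.range N, f (ω (s + i))) ≤
      2 * Real.exp (θ * (6 * t * F) + θ ^ 2 * (N * (6 * t * F) ^ 2)) *
        (Real.cosh (θ * ‖poissonMart Q f s ω N‖)
          * Real.exp (-(θ ^ 2 * ∑ i ∈ Finset.range N, condVar Q f (ω (s + i))))) := by
    intro ω
    have hsum : ∑ i ∈ Finset.range N, condVar Q f (ω (s + i)) ≤ N * (6 * t * F) ^ 2 := by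
      refine (Finset.sum_le_sum fun i _ => h.condVar_le hf hF h0 _).trans ?_
      simp
    have h1 : ∑ i ∈ Finset.range N, f (ω (s + i)) ≤ ‖poissonMart Q f s ω N‖ + 6 * t * F := by
      rw [sum_eq_poissonMart]
      have h2 := Real.le_norm_self (poissonMart Q f s ω N)
      have h3 := (Real.le_norm_self _).trans
        (norm_sub_le (poisson Q f (ω s)) (poisson Q f (ω (s + N))))
      have h4 := h.norm_poisson_le hf hF h0 (ω s)
      have h5 := h.norm_poisson_le hf hF h0 (ω (s + N))
      linarith
    have h6 : Real.exp (θ * ‖poissonMart Q f s ω N‖) ≤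
        2 * Real.cosh (θ * ‖poissonMart Q f s ω N‖) := by
      rw [Real.cosh_eq]
      linarith [Real.exp_pos (-(θ * ‖poissonMart Q f s ω N‖))]
    calc Real.exp (θ * ∑ i ∈ Finset.range N, f (ω (s + i)))
        ≤ Real.exp (θ * (6 * t * F) + θ ^ 2 * (N * (6 * t * F) ^ 2)
            + -(θ ^ 2 * ∑ i ∈ Finset.range N, condVar Q f (ω (s + i)))
            + θ * ‖poissonMart Q f s ω N‖) := by
          apply Real.exp_le_exp.2
          have h7 := mul_le_mul_of_nonneg_left h1 hθ
          have h8 := mul_le_mul_of_nonneg_left hsum (sq_nonneg θ)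
          linarith
      _ = Real.exp (θ * (6 * t * F) + θ ^ 2 * (N * (6 * t * F) ^ 2))
            * Real.exp (-(θ ^ 2 * ∑ i ∈ Finset.range N, condVar Q f (ω (s + i))))
            * Real.exp (θ * ‖poissonMart Q f s ω N‖) := by rw [Real.exp_add, Real.exp_add]
      _ ≤ Real.exp (θ * (6 * t * F) + θ ^ 2 * (N * (6 * t * F) ^ 2))
            * Real.exp (-(θ ^ 2 * ∑ i ∈ Finset.range N, condVar Q f (ω (s + i))))
            * (2 * Real.cosh (θ * ‖poissonMart Q f s ω N‖)) := by gcongr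
      _ = _ := by ring
  have hc : 0 ≤ 2 * Real.exp (θ * (6 * t * F) + θ ^ 2 * (N * (6 * t * F) ^ 2)) := by positivity
  calc _ ≤ ∫⁻ ω, ENNReal.ofReal
        (2 * Real.exp (θ * (6 * t * F) + θ ^ 2 * (N * (6 * t * F) ^ 2))) * ENNReal.ofReal
        (Real.cosh (θ * ‖poissonMart Q f s ω N‖)
          * Real.exp (-(θ ^ 2 * ∑ i ∈ Finset.range N, condVar Q f (ω (s + i)))))
        ∂(chainLaw Q ξ) := lintegral_mono fun ω => by
          rw [← ENNReal.ofReal_mul hc]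
          exact ENNReal.ofReal_le_ofReal (hpt ω)
    _ ≤ ENNReal.ofReal
        (2 * Real.exp (θ * (6 * t * F) + θ ^ 2 * (N * (6 * t * F) ^ 2))) * 1 := by
        rw [lintegral_const_mul' _ _ ENNReal.ofReal_ne_top]
        gcongr
        exact h.lintegral_cosh_poissonMart_le hf hF h0 ξ hθ hθB s N
    _ = _ := mul_one _

variable {f : Z → E} (hf : StronglyMeasurable f) {F : ℝ} (hF : ∀ z, ‖f z‖ ≤ F)
  (h0 : ∫ z, f z ∂π = 0)
include hf hF h0

omit [MeasurableSingletonClass Z] in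
lemma UniformlyGeometricallyErgodic.integral_condVar_nonneg : 0 ≤ ∫ z, condVar Q f z ∂π :=
  integral_nonneg fun z => h.condVar_nonneg hf hF h0 z

omit [MeasurableSingletonClass Z] in
lemma UniformlyGeometricallyErgodic.integral_condVar_le :
    ∫ z, condVar Q f z ∂π ≤ (6 * t * F) ^ 2 := by
  refine (le_abs_self _).trans ?_
  rw [← Real.norm_eq_abs]
  refine norm_integral_le_of_bound fun z => ?_
  rw [Real.norm_of_nonneg (h.condVar_nonneg hf hF h0 z)]
  exact h.condVar_le hf hF h0 z

/-- In `cosh_le_half_add` take u = 4λ² Σ (condVar − v). The supermartingale at parameter 2λ handles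
the first term up to e^{4λ²Nv}. The second is `lintegral_exp_sum_le` for the bounded centred real
function condVar − v, so a second Poisson equation is solved for the conditional variance. -/
lemma UniformlyGeometricallyErgodic.lintegral_cosh_le_of_variance {lam : ℝ} (hl : 0 ≤ lam)
    (hlB : 2 * lam * (6 * t * F) ≤ 1) (hlB2 : 4 * lam ^ 2 * (6 * t * (6 * t * F) ^ 2) ≤ 1)
    (s N : ℕ) :
    ∫⁻ ω, ENNReal.ofReal (Real.cosh (lam * ‖poissonMart Q f s ω N‖)) ∂(chainLaw Q ξ) ≤
      ENNReal.ofReal (1 / 2 * Real.exp (4 * lam ^ 2 * (N * ∫ z, condVar Q f z ∂π))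
        + Real.exp (4 * lam ^ 2 * (6 * t * (6 * t * F) ^ 2)
          + (4 * lam ^ 2) ^ 2 * (N * (6 * t * (6 * t * F) ^ 2) ^ 2))) := by
  set v := ∫ z, condVar Q f z ∂π with hv
  set θ := 4 * lam ^ 2 with hθ
  have hcm := h.stronglyMeasurable_condVar hf hF h0
  have hcb : ∀ z, ‖condVar Q f z‖ ≤ (6 * t * F) ^ 2 := fun z => by
    rw [Real.norm_of_nonneg (h.condVar_nonneg hf hF h0 z)]
    exact h.condVar_le hf hF h0 z
  have h2b : ∀ z, ‖condVar Q f z - v‖ ≤ (6 * t * F) ^ 2 := fun z => by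
    have h1 := h.condVar_nonneg hf hF h0 z
    have h2 := h.condVar_le hf hF h0 z
    have h3 := h.integral_condVar_nonneg hf hF h0
    have h4 := h.integral_condVar_le hf hF h0
    rw [Real.norm_eq_abs, abs_le]
    constructor <;> linarith
  have h20 : ∫ z, (condVar Q f z - v) ∂π = 0 := by
    rw [integral_sub (integrable_of_bound hcm hcb) (integrable_const _), ← hv]
    simp
  have hexp := h.lintegral_exp_sum_le ξ (hcm.sub stronglyMeasurable_const) h2b h20
    (θ := θ) (by positivity) hlB2 s N
  have hcosh := h.lintegral_cosh_poissonMart_le hf hF h0 ξ (lam := 2 * lam) (by positivity) hlB s N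
  have hpt : ∀ ω : ℕ → Z, Real.cosh (lam * ‖poissonMart Q f s ω N‖) ≤
      1 / 2 * Real.exp (θ * (N * v)) * (Real.cosh (2 * lam * ‖poissonMart Q f s ω N‖)
        * Real.exp (-((2 * lam) ^ 2 * ∑ i ∈ Finset.range N, condVar Q f (ω (s + i)))))
      + 1 / 2 * Real.exp (θ * ∑ i ∈ Finset.range N, (condVar Q f (ω (s + i)) - v)) := by
    intro ω
    have h1 := cosh_le_half_add (lam * ‖poissonMart Q f s ω N‖)
      (θ * ∑ i ∈ Finset.range N, (condVar Q f (ω (s + i)) - v))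
    refine h1.trans (le_of_eq ?_)
    have h2 : Real.exp (-(θ * ∑ i ∈ Finset.range N, (condVar Q f (ω (s + i)) - v)))
        = Real.exp (θ * (N * v))
          * Real.exp (-((2 * lam) ^ 2 * ∑ i ∈ Finset.range N, condVar Q f (ω (s + i)))) := by
      rw [← Real.exp_add, Finset.sum_sub_distrib, Finset.sum_const, Finset.card_range,
        nsmul_eq_mul, hθ]
      congr 1
      ring
    rw [h2, mul_assoc 2]
    ring
  have hm2 : Measurable fun ω : ℕ → Z => ENNReal.ofReal
      (Real.exp (θ * ∑ i ∈ Finset.range N, (condVar Q f (ω (s + i)) - v))) := by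
    refine (Real.measurable_exp.comp ((Finset.measurable_sum _ fun i _ => ?_).const_mul
      _)).ennreal_ofReal
    exact (hcm.measurable.comp (measurable_pi_apply _)).sub_const v
  calc _ ≤ ∫⁻ ω, (ENNReal.ofReal (1 / 2 * Real.exp (θ * (N * v)))
          * ENNReal.ofReal (Real.cosh (2 * lam * ‖poissonMart Q f s ω N‖)
            * Real.exp (-((2 * lam) ^ 2 * ∑ i ∈ Finset.range N, condVar Q f (ω (s + i)))))
        + ENNReal.ofReal (1 / 2) * ENNReal.ofReal (Real.exp
          (θ * ∑ i ∈ Finset.range N, (condVar Q f (ω (s + i)) - v)))) ∂(chainLaw Q ξ) := by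
        refine lintegral_mono fun ω => ?_
        rw [← ENNReal.ofReal_mul (by positivity), ← ENNReal.ofReal_mul (by positivity),
          ← ENNReal.ofReal_add (by have := Real.cosh_pos (2 * lam * ‖poissonMart Q f s ω N‖)
                                   positivity) (by positivity)]
        exact ENNReal.ofReal_le_ofReal (hpt ω)
    _ ≤ ENNReal.ofReal (1 / 2 * Real.exp (θ * (N * v))) * 1
        + ENNReal.ofReal (1 / 2) * ENNReal.ofReal (2 * Real.exp (θ * (6 * t * (6 * t * F) ^ 2)
          + θ ^ 2 * (N * (6 * t * (6 * t * F) ^ 2) ^ 2))) := by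
        rw [lintegral_add_right _ (hm2.const_mul _),
          lintegral_const_mul' _ _ ENNReal.ofReal_ne_top,
          lintegral_const_mul' _ _ ENNReal.ofReal_ne_top]
        gcongr
        exact hexp
    _ = _ := by
        rw [mul_one, ← ENNReal.ofReal_mul (by positivity),
          ← ENNReal.ofReal_add (by positivity) (by positivity)]
        congr 1
        ring

/-- A Rosenthal type inequality for the martingale attached to a Poisson solution. -/
lemma UniformlyGeometricallyErgodic.eLpNorm_poissonMart_le (hF0 : 0 < F) {p : ℝ} (hp : 2 ≤ p)
    (s N : ℕ) :
    eLpNorm (fun ω => poissonMart Q f s ω N) (ENNReal.ofReal p) (chainLaw Q ξ) ≤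
      ENNReal.ofReal (2 * Real.exp 2 * √(p * (4 * (N * ∫ z, condVar Q f z ∂π
        + 6 * t * (6 * t * F) ^ 2 * √(p * N) + p * (6 * t * (6 * t * F) ^ 2)
        + p * (6 * t * F) ^ 2)))) := by
  have ht : (0 : ℝ) < t := by exact_mod_cast h.tmix_pos
  have hv := h.integral_condVar_nonneg hf hF h0
  set v := ∫ z, condVar Q f z ∂π with hvdef
  set B := 6 * t * F with hB
  have hB0 : 0 < B := by positivity
  set B2 := 6 * t * B ^ 2 with hB2
  have hB20 : 0 < B2 := by positivity
  have hp0 : 0 < p := by linarith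
  set V := 4 * (N * v + B2 * √(p * N) + p * B2 + p * B ^ 2) with hV
  have hV0 : 0 < V := by positivity
  have hNv : 0 ≤ N * v := by positivity
  have hsq : 0 ≤ B2 * √(p * N) := by positivity
  have hpB2 : 0 < p * B2 := by positivity
  have hpB : 0 < p * B ^ 2 := by positivity
  -- This choice gives λ²V = p. The four summands of `V` are exactly what the two smallness
  -- conditions on λ and the two exponents require.
  set lam := √(p / V) with hlam
  have hl0 : 0 < lam := Real.sqrt_pos.2 (by positivity)
  have hl2 : lam ^ 2 = p / V := Real.sq_sqrt (by positivity)
  have hl2' : lam ^ 2 * V = p := by rw [hl2]; field_simp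
  have hkey : ∀ x, x ≤ V → 0 ≤ x → lam ^ 2 * x ≤ p := fun x hx _ => by
    rw [← hl2']; gcongr
  have c1 : 2 * lam * B ≤ 1 := by
    have h1 : (2 * lam * B) ^ 2 ≤ 1 ^ 2 := by
      have e : p * (2 * lam * B) ^ 2 = lam ^ 2 * (4 * (p * B ^ 2)) := by ring
      have h2 : p * (2 * lam * B) ^ 2 ≤ p * 1 := by
        rw [e, mul_one]
        exact hkey _ (by linarith) (by positivity)
      have := le_of_mul_le_mul_left h2 hp0
      linarith
    exact le_of_sq_le_sq h1 (by norm_num)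
  have c2 : 4 * lam ^ 2 * B2 ≤ 1 := by
    have e : p * (4 * lam ^ 2 * B2) = lam ^ 2 * (4 * (p * B2)) := by ring
    have h2 : p * (4 * lam ^ 2 * B2) ≤ p * 1 := by
      rw [e, mul_one]
      exact hkey _ (by linarith) (by positivity)
    exact le_of_mul_le_mul_left h2 hp0
  have c3 : 4 * lam ^ 2 * (N * v) ≤ p := by
    have := hkey (4 * (N * v)) (by linarith) (by positivity)
    linarith
  have c4 : (4 * lam ^ 2) ^ 2 * (N * B2 ^ 2) ≤ p := by
    have h1 := hkey (4 * (B2 * √(p * N))) (by linarith) (by positivity)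
    have h2 : (lam ^ 2 * (4 * (B2 * √(p * N)))) ^ 2 ≤ p ^ 2 := by gcongr
    have h3 : √(p * N) ^ 2 = p * N := Real.sq_sqrt (by positivity)
    have e : (lam ^ 2 * (4 * (B2 * √(p * N)))) ^ 2 = p * ((4 * lam ^ 2) ^ 2 * (N * B2 ^ 2)) := by
      calc _ = (4 * lam ^ 2) ^ 2 * B2 ^ 2 * √(p * N) ^ 2 := by ring
        _ = _ := by rw [h3]; ring
    rw [e, sq p] at h2
    exact le_of_mul_le_mul_left h2 hp0
  have hmain := h.lintegral_cosh_le_of_variance ξ hf hF h0 hl0.le c1 c2 s N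
  -- With both exponents controlled the sum is at most (1/2 + e)eᵖ, and 1/2 + e ≤ e² ≤ eᵖ because p
  -- ≥ 2.
  have hfin : 1 / 2 * Real.exp (4 * lam ^ 2 * (N * v)) + Real.exp (4 * lam ^ 2 * B2
      + (4 * lam ^ 2) ^ 2 * (N * B2 ^ 2)) ≤ Real.exp (2 * p) := by
    have h1 : Real.exp (4 * lam ^ 2 * (N * v)) ≤ Real.exp p := Real.exp_le_exp.2 c3
    have h2 : Real.exp (4 * lam ^ 2 * B2 + (4 * lam ^ 2) ^ 2 * (N * B2 ^ 2)) ≤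
        Real.exp (1 + p) := Real.exp_le_exp.2 (by linarith)
    have h3 : Real.exp (1 + p) = Real.exp 1 * Real.exp p := Real.exp_add _ _
    have h4 : Real.exp (2 * p) = Real.exp p * Real.exp p := by rw [two_mul, Real.exp_add]
    have h5 : Real.exp 1 * Real.exp 1 ≤ Real.exp p := by
      rw [← Real.exp_add]; exact Real.exp_le_exp.2 (by linarith)
    have h6 := Real.exp_one_gt_d9
    have h7 : 2.7 * Real.exp 1 ≤ Real.exp 1 * Real.exp 1 := by gcongr; linarith
    have h8 : (1 / 2 + Real.exp 1) * Real.exp p ≤ Real.exp p * Real.exp p := by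
      gcongr
      linarith
    linarith
  have hlast := eLpNorm_le_of_lintegral_cosh_le hl0 hp
    (hmain.trans (ENNReal.ofReal_le_ofReal hfin))
  have hpl : p / lam = √(p * V) := by
    have h1 : √(p * V) ^ 2 = p * V := Real.sq_sqrt (by positivity)
    have h2 : (p / lam) ^ 2 = p * V := by
      rw [div_pow, hl2]; field_simp
    rw [← Real.sqrt_sq (show 0 ≤ p / lam by positivity), h2]
  rwa [hpl] at hlast

/-- A Rosenthal type inequality for additive functionals of the chain. -/
theorem UniformlyGeometricallyErgodic.eLpNorm_sum_le (hF0 : 0 < F) {p : ℝ} (hp : 2 ≤ p)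
    (s : ℕ) {N : ℕ} (hN : 1 ≤ N) :
    eLpNorm (fun ω => ∑ i ∈ Finset.range N, f (ω (s + i + 1))) (ENNReal.ofReal p)
      (chainLaw Q ξ) ≤
      ENNReal.ofReal (4 * Real.exp 2 * √(p * (N * ∫ z, condVar Q f z ∂π))
        + rosenthalConst t F * (p * √√N)) := by
  have hN' : (1 : ℝ) ≤ N := by exact_mod_cast hN
  have hv := h.integral_condVar_nonneg hf hF h0
  have hM := h.eLpNorm_poissonMart_le ξ hf hF h0 hF0 hp s N
  set v := ∫ z, condVar Q f z ∂π with hvdef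
  set B := 6 * t * F with hB
  have hB0 : 0 ≤ B := by positivity
  set B2 := 6 * t * B ^ 2 with hB2
  have hB20 : 0 ≤ B2 := by positivity
  have hp0 : 0 < p := by linarith
  set w := √√(N : ℝ) with hw
  have hw1 : 1 ≤ w := Real.one_le_sqrt.2 (Real.one_le_sqrt.2 hN')
  have hwsq : w ^ 2 = √(N : ℝ) := Real.sq_sqrt (Real.sqrt_nonneg _)
  have hq : (1 : ℝ≥0∞) ≤ ENNReal.ofReal p := by
    rw [ENNReal.one_le_ofReal]; linarith
  -- The cross term √(pN) comes from fluctuations of the conditional variance; after the outer root,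
  -- and with √p ≤ p, it produces p N^{1/4}, hence the rate n^{−3/4}.
  have hsqrt : √(p * (4 * (N * v + B2 * √(p * N) + p * B2 + p * B ^ 2))) ≤
      2 * √(p * (N * v)) + 2 * (2 * √B2 + B) * (p * w) := by
    have hsp : √p ≤ p := by
      rw [Real.sqrt_le_left hp0.le]
      rw [sq]
      exact le_mul_of_one_le_left hp0.le (by linarith)
    have e1 : √(p * N) = √p * w ^ 2 := by rw [hwsq, Real.sqrt_mul hp0.le]
    have hb2 : √B2 ^ 2 = B2 := Real.sq_sqrt hB20
    have hx : √(p * (N * v)) ^ 2 = p * (N * v) := Real.sq_sqrt (by positivity)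
    rw [Real.sqrt_le_left (by positivity)]
    set x := √(p * (N * v))
    set b := √B2
    have hb0 : 0 ≤ b := Real.sqrt_nonneg _
    have hx0 : 0 ≤ x := Real.sqrt_nonneg _
    rw [e1, ← hb2]
    have i1 : p * √p * w ^ 2 * b ^ 2 ≤ p * p * w ^ 2 * b ^ 2 := by gcongr
    have i2 : p * p * b ^ 2 * 1 ≤ p * p * b ^ 2 * w ^ 2 := by
      gcongr
      exact one_le_pow₀ hw1
    have i3 : p * p * B ^ 2 * 1 ≤ p * p * B ^ 2 * w ^ 2 := by
      gcongr
      exact one_le_pow₀ hw1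
    have i4 : 0 ≤ x * ((2 * b + B) * (p * w)) := by positivity
    have i5 : 0 ≤ b * B * (p * w) ^ 2 := by positivity
    have i6 : 0 ≤ b ^ 2 * (p * w) ^ 2 := by positivity
    have e2 : (2 * x + 2 * (2 * b + B) * (p * w)) ^ 2 = 4 * x ^ 2
        + 8 * (x * ((2 * b + B) * (p * w))) + 16 * (b ^ 2 * (p * w) ^ 2)
        + 16 * (b * B * (p * w) ^ 2) + 4 * (p * p * B ^ 2 * w ^ 2) := by ring
    rw [e2, hx]
    linarith
  have hbd : ∀ ω : ℕ → Z, ‖poissonTail Q f (ω s) - poissonTail Q f (ω (s + N))‖ ≤ B := by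
    intro ω
    have h1 := h.norm_poissonTail_le hf hF h0 (ω s)
    have h2 := h.norm_poissonTail_le hf hF h0 (ω (s + N))
    have h3 := norm_sub_le (poissonTail Q f (ω s)) (poissonTail Q f (ω (s + N)))
    linarith
  have htm := h.stronglyMeasurable_poissonTail hf hF h0
  have hbm : StronglyMeasurable fun ω : ℕ → Z =>
      poissonTail Q f (ω s) - poissonTail Q f (ω (s + N)) :=
    (htm.comp_measurable (measurable_pi_apply _)).sub (htm.comp_measurable (measurable_pi_apply _))
  have hb : eLpNorm (fun ω : ℕ → Z => poissonTail Q f (ω s) - poissonTail Q f (ω (s + N)))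
      (ENNReal.ofReal p) (chainLaw Q ξ) ≤ ENNReal.ofReal B := by
    refine (eLpNorm_le_of_ae_bound (Filter.Eventually.of_forall hbd)).trans ?_
    simp
  simp only [sum_succ_eq_poissonMart Q f]
  refine (eLpNorm_add_le (h.stronglyMeasurable_poissonMart hf hF h0 s N).aestronglyMeasurable
    hbm.aestronglyMeasurable hq).trans ((add_le_add hM hb).trans ?_)
  rw [← ENNReal.ofReal_add (by positivity) hB0]
  refine ENNReal.ofReal_le_ofReal ?_
  have h1 := mul_le_mul_of_nonneg_left hsqrt (by positivity : 0 ≤ 2 * Real.exp 2)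
  have h2 : B * 1 ≤ B * (p * w) := by
    gcongr
    exact one_le_mul_of_one_le_of_one_le (by linarith) hw1
  unfold rosenthalConst
  linarith

end Rosenthal

/-! ### The asymptotic covariance and its trace -/

section Covariance

variable {Z : Type u} [MeasurableSpace Z] {d : ℕ}
variable {Q : Kernel Z Z} [IsMarkovKernel Q] {π : Measure Z} [IsProbabilityMeasure π] {t : ℕ}

lemma integral_kernelAvg_apply {f : Z → Vec d} (hf : StronglyMeasurable f) {F : ℝ}
    (hF : ∀ z, ‖f z‖ ≤ F) (ℓ : ℕ) (z : Z) (j : Fin d) :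
    ∫ w, f w j ∂((Q ^ ℓ) z) = kernelAvg Q f ℓ z j :=
  (EuclideanSpace.proj (𝕜 := ℝ) j).integral_comp_comm (integrable_of_bound hf hF)

/-- Conditioning at time 0 replaces f(Z_ℓ) by Q^ℓ f(Z_0), and Z_0 has law π. -/
lemma autoCov_apply [MeasurableSingletonClass Z] {f : Z → Vec d} (hf : StronglyMeasurable f)
    {F : ℝ} (hF : ∀ z, ‖f z‖ ≤ F) (ℓ : ℕ) (i j : Fin d) :
    autoCov Q π f ℓ i j = ∫ z, f z i * kernelAvg Q f ℓ z j ∂π := by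
  have hcoord : ∀ i : Fin d, StronglyMeasurable fun z => f z i := fun i =>
    (EuclideanSpace.proj (𝕜 := ℝ) i).continuous.comp_stronglyMeasurable hf
  have hb : ∀ (i : Fin d) z, ‖f z i‖ ≤ F := fun i z => (PiLp.norm_apply_le (f z) i).trans (hF z)
  have hFm : StronglyMeasurable fun ω : ℕ → Z => f (ω 0) i * f (ω ℓ) j :=
    ((hcoord i).comp_measurable (measurable_pi_apply 0)).mul
      ((hcoord j).comp_measurable (measurable_pi_apply ℓ))
  have hFb : ∀ ω : ℕ → Z, ‖f (ω 0) i * f (ω ℓ) j‖ ≤ F * F := fun ω => by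
    rw [norm_mul]
    exact mul_le_mul (hb _ _) (hb _ _) (norm_nonneg _) ((norm_nonneg _).trans (hb i (ω 0)))
  have hinner : ∀ ω : ℕ → Z, ∫ ω', f (ω' 0) i * f (ω' ℓ) j ∂(condChain Q 0 ω)
      = f (ω 0) i * kernelAvg Q f ℓ (ω 0) j := by
    intro ω
    have h1 : ∫ ω', f (ω' 0) i * f (ω' ℓ) j ∂(condChain Q 0 ω)
        = ∫ ω', f (ω 0) i * f (ω' (0 + ℓ)) j ∂(condChain Q 0 ω) := by
      refine integral_congr_ae ?_
      filter_upwards [ae_condChain_eq Q 0 ω] with ω' hω'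
      rw [hω' 0 le_rfl, zero_add]
    rw [h1, integral_const_mul, integral_condChain_add Q 0 ℓ ω (hcoord j),
      integral_kernelAvg_apply hf hF]
  have hgm : StronglyMeasurable fun z => f z i * kernelAvg Q f ℓ z j :=
    (hcoord i).mul ((EuclideanSpace.proj (𝕜 := ℝ) j).continuous.comp_stronglyMeasurable
      (stronglyMeasurable_kernelAvg hf ℓ))
  calc autoCov Q π f ℓ i j = ∫ ω, f (ω 0) i * f (ω ℓ) j ∂(chainLaw Q π) := rfl
    _ = ∫ ω, ∫ ω', f (ω' 0) i * f (ω' ℓ) j ∂(condChain Q 0 ω) ∂(chainLaw Q π) := by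
        conv_lhs => rw [← condChain_comp_chainLaw Q π 0]
        exact integral_comp_measure (integrable_of_bound hFm hFb)
    _ = ∫ ω, f (ω 0) i * kernelAvg Q f ℓ (ω 0) j ∂(chainLaw Q π) := by simp only [hinner]
    _ = _ := by
        conv_rhs => rw [← chainLaw_map_zero Q π]
        rw [integral_map (measurable_pi_apply 0).aemeasurable hgm.aestronglyMeasurable]

variable (h : UniformlyGeometricallyErgodic Q π t) {f : Z → Vec d}
  (hf : StronglyMeasurable f) {F : ℝ} (hF : ∀ z, ‖f z‖ ≤ F) (h0 : ∫ z, f z ∂π = 0)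
include h hf hF h0

lemma UniformlyGeometricallyErgodic.summable_autoCov [MeasurableSingletonClass Z] :
    Summable fun ℓ : ℕ => autoCov Q π f ℓ := by
  refine Pi.summable.2 fun i => Pi.summable.2 fun j => ?_
  refine Summable.of_norm_bounded
    ((summable_quarter_pow_div h.tmix_pos).mul_left (F * (2 * F))) fun ℓ => ?_
  rw [autoCov_apply hf hF]
  refine norm_integral_le_of_bound fun z => ?_
  have hF0 : 0 ≤ F := (norm_nonneg _).trans (hF z)
  rw [norm_mul, mul_assoc]
  exact mul_le_mul ((PiLp.norm_apply_le (f z) i).trans (hF z))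
    ((PiLp.norm_apply_le _ j).trans (h.norm_kernelAvg_le hf hF h0 ℓ z)) (norm_nonneg _) hF0

lemma UniformlyGeometricallyErgodic.hasSum_integral_inner_kernelAvg :
    HasSum (fun ℓ => ∫ z, inner ℝ (f z) (kernelAvg Q f ℓ z) ∂π)
      (∫ z, inner ℝ (f z) (poisson Q f z) ∂π) := by
  have hb : ∀ ℓ z, ‖inner ℝ (f z) (kernelAvg Q f ℓ z)‖ ≤ F * (2 * F) * (1 / 4) ^ (ℓ / t) := by
    intro ℓ z
    have hF0 : 0 ≤ F := (norm_nonneg _).trans (hF z)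
    refine (norm_inner_le_norm _ _).trans ?_
    rw [mul_assoc]
    exact mul_le_mul (hF z) (h.norm_kernelAvg_le hf hF h0 ℓ z) (norm_nonneg _) hF0
  have hm : ∀ ℓ, StronglyMeasurable fun z => inner ℝ (f z) (kernelAvg Q f ℓ z) := fun ℓ =>
    hf.inner (stronglyMeasurable_kernelAvg hf ℓ)
  have h1 := hasSum_integral_of_summable_integral_norm (μ := π)
    (F := fun ℓ z => inner ℝ (f z) (kernelAvg Q f ℓ z))
    (fun ℓ => integrable_of_bound (hm ℓ) (hb ℓ)) ?_
  · have h2 : ∀ z, ∑' ℓ, inner ℝ (f z) (kernelAvg Q f ℓ z) = inner ℝ (f z) (poisson Q f z) :=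
      fun z => ((h.hasSum_poisson hf hF h0 z).mapL (innerSL ℝ (f z))).tsum_eq
    simpa only [h2] using h1
  · refine Summable.of_nonneg_of_le (fun ℓ => integral_nonneg fun _ => norm_nonneg _) (fun ℓ => ?_)
      ((summable_quarter_pow_div h.tmix_pos).mul_left (F * (2 * F)))
    refine (le_abs_self _).trans ?_
    rw [← Real.norm_eq_abs]
    exact norm_integral_le_of_bound fun z => by rw [norm_norm]; exact hb ℓ z

/-- By invariance Q‖g‖² and ‖g‖² have the same π-integral, and ‖g‖² − ‖g − f‖² = 2⟨f, g⟩ − ‖f‖².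
Expanding g = Σ Q^ℓ f in the inner product then yields the covariance series. -/
lemma UniformlyGeometricallyErgodic.integral_condVar :
    ∫ z, condVar Q f z ∂π =
      2 * ∫ z, inner ℝ (f z) (poisson Q f z) ∂π - ∫ z, inner ℝ (f z) (f z) ∂π := by
  have hgm := h.stronglyMeasurable_poisson hf hF h0
  have hgb := h.norm_poisson_le hf hF h0
  have htm := h.stronglyMeasurable_poissonTail hf hF h0
  have htb := h.norm_poissonTail_le hf hF h0
  have hg2b : ∀ z, ‖‖poisson Q f z‖ ^ 2‖ ≤ (3 * t * F) ^ 2 := fun z => by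
    rw [norm_pow, norm_norm]
    exact pow_le_pow_left₀ (norm_nonneg _) (hgb z) 2
  have hg2 : Integrable (fun z => ‖poisson Q f z‖ ^ 2) π :=
    integrable_of_bound (hgm.norm.pow 2) hg2b
  have ht2 : Integrable (fun z => ‖poissonTail Q f z‖ ^ 2) π :=
    integrable_of_bound (htm.norm.pow 2) (F := (3 * t * F) ^ 2) fun z => by
      rw [norm_pow, norm_norm]
      exact pow_le_pow_left₀ (norm_nonneg _) (htb z) 2
  have hinv : ∫ z, kernelAvg Q (fun w => ‖poisson Q f w‖ ^ 2) 1 z ∂π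
      = ∫ z, ‖poisson Q f z‖ ^ 2 ∂π := by
    conv_rhs => rw [← h.invariant_pow 1]
    rw [integral_comp_measure]
    · rfl
    · exact integrable_of_bound (hgm.norm.pow 2) hg2b
  have hki : Integrable (kernelAvg Q (fun w => ‖poisson Q f w‖ ^ 2) 1) π :=
    integrable_of_bound (stronglyMeasurable_kernelAvg (hgm.norm.pow 2) 1)
      fun z => norm_integral_le_of_bound hg2b
  have hfg : Integrable (fun z => 2 * inner ℝ (f z) (poisson Q f z)) π :=
    Integrable.const_mul (integrable_of_bound (hf.inner hgm) (F := F * (3 * t * F)) fun z =>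
      (norm_inner_le_norm _ _).trans (mul_le_mul (hF z) (hgb z) (norm_nonneg _)
        ((norm_nonneg _).trans (hF z)))) 2
  have hff : Integrable (fun z => inner ℝ (f z) (f z)) π :=
    integrable_of_bound (hf.inner hf) (F := F * F) fun z =>
      (norm_inner_le_norm _ _).trans (mul_le_mul (hF z) (hF z) (norm_nonneg _)
        ((norm_nonneg _).trans (hF z)))
  simp only [condVar]
  rw [integral_sub hki ht2, hinv, ← integral_sub hg2 ht2, ← integral_const_mul,
    ← integral_sub hfg hff]
  refine integral_congr_ae (Filter.Eventually.of_forall fun z => ?_)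
  simp only
  rw [poissonTail, norm_sub_sq_real, real_inner_comm, real_inner_self_eq_norm_sq]
  ring

variable [MeasurableSingletonClass Z]

omit [IsProbabilityMeasure π] h h0 in
lemma trace_autoCov [IsProbabilityMeasure π] (ℓ : ℕ) :
    (autoCov Q π f ℓ).trace = ∫ z, inner ℝ (f z) (kernelAvg Q f ℓ z) ∂π := by
  have e : ∀ z, inner ℝ (f z) (kernelAvg Q f ℓ z) = ∑ i, f z i * kernelAvg Q f ℓ z i := by
    intro z
    rw [PiLp.inner_apply]
    simp [mul_comm]
  simp only [e, Matrix.trace, Matrix.diag]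
  rw [integral_finsetSum]
  · exact Finset.sum_congr rfl fun i _ => autoCov_apply hf hF ℓ i i
  · intro i _
    refine integrable_of_bound (F := F * F)
      (((EuclideanSpace.proj (𝕜 := ℝ) i).continuous.comp_stronglyMeasurable hf).mul
      ((EuclideanSpace.proj (𝕜 := ℝ) i).continuous.comp_stronglyMeasurable
        (stronglyMeasurable_kernelAvg hf ℓ))) fun z => ?_
    rw [norm_mul]
    exact mul_le_mul ((PiLp.norm_apply_le (f z) i).trans (hF z))
      ((PiLp.norm_apply_le _ i).trans (norm_integral_le_of_bound hF)) (norm_nonneg _)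
      ((norm_nonneg _).trans (hF z))

/-- The trace of the asymptotic covariance is the stationary conditional variance. -/
theorem UniformlyGeometricallyErgodic.trace_markovCov :
    (markovCov Q π f).trace = ∫ z, condVar Q f z ∂π := by
  have hs := h.summable_autoCov hf hF h0
  have hs1 : Summable fun ℓ => autoCov Q π f (ℓ + 1) := (summable_nat_add_iff 1).2 hs
  have htr : (∑' ℓ, autoCov Q π f (ℓ + 1)).trace
      = ∑' ℓ, (autoCov Q π f (ℓ + 1)).trace :=
    (hs1.hasSum.map (Matrix.traceAddMonoidHom (Fin d) ℝ)
      (continuous_id.matrix_trace)).tsum_eq.symm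
  have hsum := h.hasSum_integral_inner_kernelAvg hf hF h0
  have h1 := hsum.summable.sum_add_tsum_nat_add 1
  rw [hsum.tsum_eq, Finset.sum_range_one, kernelAvg_zero hf] at h1
  rw [markovCov, Matrix.trace_add, Matrix.trace_smul, htr]
  simp only [trace_autoCov hf hF]
  rw [h.integral_condVar hf hF h0, ← h1, kernelAvg_zero hf, smul_eq_mul]
  ring

end Covariance

/-! ### The matrix martingale -/

section Burkholder

variable {Z : Type u} [MeasurableSpace Z] {d : ℕ}

/-- The martingale part of `∑ (A(Z_{k+1}) - M) e_k`, started at time `s`. -/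
def matrixMart (Q : Kernel Z Z) (A : Z → Mat d) (M : Mat d) (ε : Z → Vec d) (γ : ℝ) (e₀ : Vec d)
    (s : ℕ) (ω : ℕ → Z) (j : ℕ) : Vec d :=
  ∑ i ∈ Finset.range j, poissonIncr Q (fun z => A z - M) ω (s + i) (err A ε γ e₀ ω (s + i))

variable {Q : Kernel Z Z} [IsMarkovKernel Q] {π : Measure Z} [IsProbabilityMeasure π] {t : ℕ}
  {A : Z → Mat d} {M : Mat d} {ε : Z → Vec d} {P : Mat d} {a κ CA S : ℝ}

namespace CentredProblem

variable (h : CentredProblem Q π t A M ε P a κ CA S)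
include h

omit [IsProbabilityMeasure π] in
lemma stronglyMeasurable_A_sub : StronglyMeasurable fun z => A z - M :=
  h.stronglyMeasurable_A.sub stronglyMeasurable_const

omit [IsProbabilityMeasure π] in
lemma stronglyMeasurable_err (γ : ℝ) (e₀ : Vec d) (k : ℕ) :
    StronglyMeasurable fun ω : ℕ → Z => err A ε γ e₀ ω k :=
  MarkovLSA.stronglyMeasurable_err h.stronglyMeasurable_A h.stronglyMeasurable_noise γ e₀ k

lemma norm_poissonIncr_le (ω : ℕ → Z) (k : ℕ) :
    ‖poissonIncr Q (fun z => A z - M) ω k‖ ≤ 6 * t * CA :=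
  h.ergodic.norm_poisson_sub_le h.stronglyMeasurable_A_sub h.norm_A_sub_le h.integral_A_sub _ _

lemma stronglyMeasurable_incr_err (γ : ℝ) (e₀ : Vec d) (k : ℕ) :
    StronglyMeasurable fun ω : ℕ → Z =>
      poissonIncr Q (fun z => A z - M) ω k (err A ε γ e₀ ω k) :=
  isBoundedBilinearMap_apply.continuous.comp_stronglyMeasurable
    ((h.ergodic.stronglyMeasurable_poissonIncr h.stronglyMeasurable_A_sub h.norm_A_sub_le
      h.integral_A_sub k).prodMk (h.stronglyMeasurable_err γ e₀ k))

lemma stronglyMeasurable_matrixMart (γ : ℝ) (e₀ : Vec d) (s j : ℕ) :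
    StronglyMeasurable fun ω : ℕ → Z => matrixMart Q A M ε γ e₀ s ω j :=
  Finset.stronglyMeasurable_fun_sum _ fun i _ => h.stronglyMeasurable_incr_err γ e₀ (s + i)

lemma norm_incr_err_le (γ : ℝ) (e₀ : Vec d) (ω : ℕ → Z) (k : ℕ) :
    ‖poissonIncr Q (fun z => A z - M) ω k (err A ε γ e₀ ω k)‖ ≤
      6 * t * CA * ‖err A ε γ e₀ ω k‖ :=
  (ContinuousLinearMap.le_opNorm _ _).trans
    (mul_le_mul_of_nonneg_right (h.norm_poissonIncr_le ω k) (norm_nonneg _))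

lemma exists_norm_matrixMart_le (γ : ℝ) (e₀ : Vec d) (s j : ℕ) :
    ∃ K, ∀ ω : ℕ → Z, ‖matrixMart Q A M ε γ e₀ s ω j‖ ≤ K := by
  have hCA := h.CA_pos.le
  choose K hK using fun k => exists_norm_err_le h.norm_A_le h.norm_noise_le γ e₀ k
  refine ⟨∑ i ∈ Finset.range j, 6 * t * CA * K (s + i), fun ω =>
    (norm_sum_le _ _).trans (Finset.sum_le_sum fun i _ => ?_)⟩
  refine (h.norm_incr_err_le γ e₀ ω (s + i)).trans ?_
  gcongr
  exact hK _ ω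

variable [MeasurableSingletonClass Z] (ξ : Measure Z) [IsProbabilityMeasure ξ]

-- The one-step smoothness inequality for the Euclidean form, with q = p/2, so that 8q = 4p. The
-- iterate e_{s+j} is frozen by conditioning at time s + j, and the increment is bounded by 6 t C_A
-- times its norm.
omit [IsProbabilityMeasure ξ] in
lemma eLpNorm_sq_matrixMart_succ_le {p : ℝ} (hp : 2 ≤ p) (γ : ℝ) (e₀ : Vec d) (s j : ℕ) :
    eLpNorm (fun ω => ‖matrixMart Q A M ε γ e₀ s ω (j + 1)‖ ^ 2) (ENNReal.ofReal (p / 2))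
      (chainLaw Q ξ) ≤
    eLpNorm (fun ω => ‖matrixMart Q A M ε γ e₀ s ω j‖ ^ 2
      + 4 * p * (6 * t * CA) ^ 2 * ‖err A ε γ e₀ ω (s + j)‖ ^ 2) (ENNReal.ofReal (p / 2))
      (chainLaw Q ξ) := by
  obtain ⟨K, hK⟩ := h.exists_norm_matrixMart_le γ e₀ s (j + 1)
  have hdiff : ∀ ω : ℕ → Z, matrixMart Q A M ε γ e₀ s ω (j + 1) = matrixMart Q A M ε γ e₀ s ω j
      + poissonIncr Q (fun z => A z - M) ω (s + j) (err A ε γ e₀ ω (s + j)) := fun ω =>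
    Finset.sum_range_succ _ _
  have hag : ∀ ω, ∀ᵐ ω' ∂(condChain Q (s + j) ω),
      matrixMart Q A M ε γ e₀ s ω' (j + 1) = matrixMart Q A M ε γ e₀ s ω j
        + (poisson Q (fun z => A z - M) (ω' (s + j + 1))
          - poissonTail Q (fun z => A z - M) (ω (s + j))) (err A ε γ e₀ ω (s + j)) := by
    intro ω
    filter_upwards [ae_condChain_eq Q (s + j) ω] with ω' hω'
    have h1 : matrixMart Q A M ε γ e₀ s ω' j = matrixMart Q A M ε γ e₀ s ω j := by
      refine Finset.sum_congr rfl fun i hi => ?_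
      have := Finset.mem_range.1 hi
      rw [poissonIncr, poissonIncr, hω' _ (by omega), hω' _ (by omega),
        err_congr γ e₀ fun l hl => hω' l (by omega)]
    rw [hdiff, h1, poissonIncr, hω' _ le_rfl, err_congr γ e₀ hω']
  have hpm := h.ergodic.stronglyMeasurable_poisson h.stronglyMeasurable_A_sub h.norm_A_sub_le
    h.integral_A_sub
  have hmean : ∀ ω, ∫ ω', matrixMart Q A M ε γ e₀ s ω' (j + 1) ∂(condChain Q (s + j) ω)
      = matrixMart Q A M ε γ e₀ s ω j := by
    intro ω
    have hint : Integrable (fun ω' : ℕ → Z => poisson Q (fun z => A z - M) (ω' (s + j + 1)))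
        (condChain Q (s + j) ω) :=
      integrable_of_bound (hpm.comp_measurable (measurable_pi_apply _)) fun _ =>
        h.ergodic.norm_poisson_le h.stronglyMeasurable_A_sub h.norm_A_sub_le h.integral_A_sub _
    have hint2 : Integrable (fun ω' : ℕ → Z => poisson Q (fun z => A z - M) (ω' (s + j + 1))
        - poissonTail Q (fun z => A z - M) (ω (s + j))) (condChain Q (s + j) ω) :=
      hint.sub (integrable_const _)
    rw [integral_congr_ae (hag ω), integral_add (integrable_const _)
      (hint2.apply_continuousLinearMap _), ← ContinuousLinearMap.integral_apply hint2,
      integral_sub hint (integrable_const _), integral_condChain_add Q (s + j) 1 ω hpm, pow_one,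
      h.ergodic.integral_poisson h.stronglyMeasurable_A_sub h.norm_A_sub_le h.integral_A_sub]
    simp [poissonTail]
  have hmain := IsPosForm.eLpNorm_le_of_condChain Q ξ (isPosForm_id (E := Vec d)) (s + j)
    (h.stronglyMeasurable_matrixMart γ e₀ s (j + 1)) hK (q := p / 2) (by linarith) hmean
    (T := fun ω => (6 * t * CA * ‖err A ε γ e₀ ω (s + j)‖) ^ 2)
    (G := fun ω => ‖matrixMart Q A M ε γ e₀ s ω j‖ ^ 2
      + 4 * p * (6 * t * CA) ^ 2 * ‖err A ε γ e₀ ω (s + j)‖ ^ 2) ?_ ?_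
  · simpa only [ContinuousLinearMap.id_apply, real_inner_self_eq_norm_sq] using hmain
  · intro ω
    filter_upwards [hag ω] with ω' hω'
    rw [ContinuousLinearMap.id_apply, real_inner_self_eq_norm_sq, hω', add_sub_cancel_left]
    gcongr
    refine (ContinuousLinearMap.le_opNorm _ _).trans
      (mul_le_mul_of_nonneg_right ?_ (norm_nonneg _))
    exact h.ergodic.norm_poisson_sub_le h.stronglyMeasurable_A_sub h.norm_A_sub_le
      h.integral_A_sub _ _
  · intro ω
    rw [ContinuousLinearMap.id_apply, real_inner_self_eq_norm_sq]
    apply le_of_eq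
    ring

omit [IsProbabilityMeasure ξ] in
/-- A Burkholder type inequality for the martingale part of the matrix noise. -/
theorem eLpNorm_matrixMart_le {p : ℝ} (hp : 2 ≤ p) (γ : ℝ) (e₀ : Vec d) (s N : ℕ)
    {ρ : ℕ → ℝ} (hρ0 : ∀ k, 0 ≤ ρ k)
    (hρ : ∀ k, eLpNorm (fun ω => ‖err A ε γ e₀ ω k‖ ^ 2) (ENNReal.ofReal (p / 2))
      (chainLaw Q ξ) ≤ ENNReal.ofReal (ρ k)) :
    eLpNorm (fun ω => matrixMart Q A M ε γ e₀ s ω N) (ENNReal.ofReal p) (chainLaw Q ξ) ≤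
      ENNReal.ofReal √(4 * p * (6 * t * CA) ^ 2 * ∑ i ∈ Finset.range N, ρ (s + i)) := by
  have hq : (1 : ℝ≥0∞) ≤ ENNReal.ofReal (p / 2) := by
    rw [ENNReal.one_le_ofReal]; linarith
  have hstep := h.eLpNorm_sq_matrixMart_succ_le ξ hp γ e₀ s
  have hC : 0 ≤ 4 * p * (6 * t * CA) ^ 2 := by positivity
  generalize 4 * p * (6 * t * CA) ^ 2 = C at hstep hC ⊢
  have hMm : ∀ j, AEStronglyMeasurable (fun ω => ‖matrixMart Q A M ε γ e₀ s ω j‖ ^ 2)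
      (chainLaw Q ξ) := fun j =>
    ((h.stronglyMeasurable_matrixMart γ e₀ s j).norm.pow 2).aestronglyMeasurable
  have hem : ∀ j, AEStronglyMeasurable (fun ω => C * ‖err A ε γ e₀ ω j‖ ^ 2)
      (chainLaw Q ξ) := fun j =>
    (((h.stronglyMeasurable_err γ e₀ j).norm.pow 2).const_mul C).aestronglyMeasurable
  have h2 : ∀ j, eLpNorm (fun ω => C * ‖err A ε γ e₀ ω j‖ ^ 2)
      (ENNReal.ofReal (p / 2)) (chainLaw Q ξ) ≤ ENNReal.ofReal (C * ρ j) := by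
    intro j
    have h1 := eLpNorm_const_smul_le (c := C) (f := fun ω => ‖err A ε γ e₀ ω j‖ ^ 2)
      (p := ENNReal.ofReal (p / 2)) (μ := chainLaw Q ξ)
    refine h1.trans ?_
    rw [ENNReal.ofReal_mul hC, Real.enorm_of_nonneg hC]
    gcongr
    exact hρ j
  have hsq : ∀ N, eLpNorm (fun ω => ‖matrixMart Q A M ε γ e₀ s ω N‖ ^ 2)
      (ENNReal.ofReal (p / 2)) (chainLaw Q ξ) ≤
      ENNReal.ofReal (C * ∑ i ∈ Finset.range N, ρ (s + i)) := by
    intro N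
    induction N with
    | zero => simp [matrixMart]
    | succ N ih =>
      refine (hstep N).trans ((eLpNorm_add_le (hMm N) (hem (s + N)) hq).trans
        ((add_le_add ih (h2 (s + N))).trans ?_))
      have h3 : 0 ≤ ∑ i ∈ Finset.range N, ρ (s + i) := Finset.sum_nonneg fun i _ => hρ0 _
      have h4 := hρ0 (s + N)
      rw [← ENNReal.ofReal_add (by positivity) (by positivity), Finset.sum_range_succ, mul_add]
  have h3 : 0 ≤ ∑ i ∈ Finset.range N, ρ (s + i) := Finset.sum_nonneg fun i _ => hρ0 _
  have := eLpNorm_le_sqrt_of_sq_le (X := fun ω => matrixMart Q A M ε γ e₀ s ω N)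
    (fun ω => le_rfl) (q := p / 2) (by linarith) (by positivity) (hsq N)
  rwa [mul_div_cancel₀ p two_ne_zero] at this

end CentredProblem

end Burkholder

/-! ### Calculus of L^p bounds -/

section MomentBound

variable {Ω : Type*} [MeasurableSpace Ω] {E : Type*} [NormedAddCommGroup E] [NormedSpace ℝ E]

/-- The random vector `X` has `L^p` norm at most `b`. -/
structure HasMomentBound (X : Ω → E) (p : ℝ) (μ : Measure Ω) (b : ℝ) : Prop where
  aestronglyMeasurable : AEStronglyMeasurable X μ
  nonneg : 0 ≤ b
  eLpNorm_le : eLpNorm X (ENNReal.ofReal p) μ ≤ ENNReal.ofReal b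

variable {X Y : Ω → E} {p : ℝ} {μ : Measure Ω} {b c : ℝ}

namespace HasMomentBound

omit [NormedSpace ℝ E] in
lemma add (hX : HasMomentBound X p μ b) (hY : HasMomentBound Y p μ c) (hp : 1 ≤ p) :
    HasMomentBound (fun ω => X ω + Y ω) p μ (b + c) where
  aestronglyMeasurable := hX.1.add hY.1
  nonneg := add_nonneg hX.2 hY.2
  eLpNorm_le := by
    rw [ENNReal.ofReal_add hX.2 hY.2]
    exact (eLpNorm_add_le hX.1 hY.1 (by rwa [ENNReal.one_le_ofReal])).trans
      (add_le_add hX.3 hY.3)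

omit [NormedSpace ℝ E] in
lemma sub (hX : HasMomentBound X p μ b) (hY : HasMomentBound Y p μ c) (hp : 1 ≤ p) :
    HasMomentBound (fun ω => X ω - Y ω) p μ (b + c) where
  aestronglyMeasurable := hX.1.sub hY.1
  nonneg := add_nonneg hX.2 hY.2
  eLpNorm_le := by
    rw [ENNReal.ofReal_add hX.2 hY.2]
    exact (eLpNorm_sub_le hX.1 hY.1 (by rwa [ENNReal.one_le_ofReal])).trans
      (add_le_add hX.3 hY.3)

lemma const_smul (hX : HasMomentBound X p μ b) {r : ℝ} (hr : 0 ≤ r) :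
    HasMomentBound (fun ω => r • X ω) p μ (r * b) where
  aestronglyMeasurable := hX.1.const_smul r
  nonneg := mul_nonneg hr hX.2
  eLpNorm_le := by
    rw [ENNReal.ofReal_mul hr]
    refine (eLpNorm_const_smul_le (c := r) (f := X)).trans ?_
    rw [Real.enorm_of_nonneg hr]
    gcongr
    exact hX.3

omit [NormedSpace ℝ E] in
lemma sum {X : ℕ → Ω → E} {b : ℕ → ℝ} (hX : ∀ i, HasMomentBound (X i) p μ (b i)) (hp : 1 ≤ p)
    (N : ℕ) :
    HasMomentBound (fun ω => ∑ i ∈ Finset.range N, X i ω) p μ (∑ i ∈ Finset.range N, b i) := by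
  induction N with
  | zero => exact ⟨by simpa using aestronglyMeasurable_const, by simp, by simp⟩
  | succ N ih =>
    simp only [Finset.sum_range_succ]
    exact ih.add (hX N) hp

omit [NormedSpace ℝ E] in
lemma mono (hX : HasMomentBound X p μ b) (h : b ≤ c) : HasMomentBound X p μ c :=
  ⟨hX.1, hX.2.trans h, hX.3.trans (ENNReal.ofReal_le_ofReal h)⟩

omit [NormedSpace ℝ E] in
lemma of_norm_le {F : Type*} [NormedAddCommGroup F] {Y : Ω → F} (hX : HasMomentBound X p μ b)
    (hY : AEStronglyMeasurable Y μ) {r : ℝ} (hr : 0 ≤ r) (h : ∀ ω, ‖Y ω‖ ≤ r * ‖X ω‖) :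
    HasMomentBound Y p μ (r * b) where
  aestronglyMeasurable := hY
  nonneg := mul_nonneg hr hX.2
  eLpNorm_le := by
    rw [ENNReal.ofReal_mul hr]
    refine (eLpNorm_le_mul_eLpNorm_of_ae_le_mul (Filter.Eventually.of_forall h) _).trans ?_
    gcongr
    exact hX.3

end HasMomentBound

end MomentBound

/-! ### Decomposition of the summed error -/

section Decomposition

variable {Z : Type u} [MeasurableSpace Z] {d : ℕ}

/-- The part of `∑ M e_k` that is of lower order. -/
def remainder (Q : Kernel Z Z) (A : Z → Mat d) (M : Mat d) (ε : Z → Vec d) (γ : ℝ) (e₀ : Vec d)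
    (s N : ℕ) (ω : ℕ → Z) : Vec d :=
  γ⁻¹ • (err A ε γ e₀ ω s - err A ε γ e₀ ω (s + N)) - matrixMart Q A M ε γ e₀ s ω N
    - (poissonTail Q (fun z => A z - M) (ω s) (err A ε γ e₀ ω s)
      - poissonTail Q (fun z => A z - M) (ω (s + N)) (err A ε γ e₀ ω (s + N)))
    + γ • ∑ i ∈ Finset.range N, poissonTail Q (fun z => A z - M) (ω (s + i + 1))
      (A (ω (s + i + 1)) (err A ε γ e₀ ω (s + i)))

/-- The summed error process: the leading noise term, a term linear in the step size that does not
depend on the iterates, and a remainder. -/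
lemma sum_map_err_eq (Q : Kernel Z Z) (A : Z → Mat d) (M : Mat d) (ε : Z → Vec d) {γ : ℝ}
    (hγ : γ ≠ 0) (e₀ : Vec d) (s N : ℕ) (ω : ℕ → Z) :
    ∑ i ∈ Finset.range N, M (err A ε γ e₀ ω (s + i)) =
      remainder Q A M ε γ e₀ s N ω - ∑ i ∈ Finset.range N, ε (ω (s + i + 1))
        + γ • ∑ i ∈ Finset.range N,
          poissonTail Q (fun z => A z - M) (ω (s + i + 1)) (ε (ω (s + i + 1))) := by
  induction N with
  | zero => simp [remainder, matrixMart]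
  | succ N ih =>
    rw [Finset.sum_range_succ, ih]
    simp only [remainder, matrixMart, Finset.sum_range_succ]
    rw [← add_assoc s N 1, err, poissonIncr]
    set e := err A ε γ e₀ ω (s + N)
    -- Writing G = QG + (A − M) makes the new matrix increment cancel against the recursion for the
    -- error; the rest is bookkeeping.
    have hG : poisson Q (fun z => A z - M) (ω (s + N + 1))
        = poissonTail Q (fun z => A z - M) (ω (s + N + 1)) + (A (ω (s + N + 1)) - M) := by
      rw [poissonTail]; abel
    rw [hG]
    simp only [map_sub, map_smul, map_add, sub_apply, add_apply, smul_add, smul_sub, smul_smul,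
      inv_mul_cancel₀ hγ, one_smul]
    abel

variable {Q : Kernel Z Z} [IsMarkovKernel Q] {π : Measure Z} [IsProbabilityMeasure π] {t : ℕ}
  {A : Z → Mat d} {M : Mat d} {ε : Z → Vec d} {P : Mat d} {a κ CA S : ℝ}

namespace CentredProblem

variable (h : CentredProblem Q π t A M ε P a κ CA S)
include h

lemma stabilityConst_nonneg (m : ℕ) : 0 ≤ stabilityConst m t a κ CA S := by
  have := h.a_pos
  have := h.S_nonneg
  have := h.blockNoise_nonneg m
  have := h.adapted.one_le_kappa
  unfold stabilityConst
  positivity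

variable [MeasurableSingletonClass Z] (ξ : Measure Z) [IsProbabilityMeasure ξ]

lemma hasMomentBound_err {p γ : ℝ} (hp : 2 ≤ p) (hγ : 0 < γ) (hγ2 : γ ≤ 2) {m : ℕ}
    (hm1 : 1 ≤ m) (hmt : 8 * CA * t ≤ a * m) (hsmall : 24 * p * CA ^ 2 * (γ * m) ≤ a)
    (e₀ : Vec d) (k : ℕ) :
    HasMomentBound (fun ω => err A ε γ e₀ ω k) p (chainLaw Q ξ)
      (√(12 * κ) * ‖e₀‖ * Real.exp (-(a * γ / 12 * k))
        + √(stabilityConst m t a κ CA S) * √(p * γ)) where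
  aestronglyMeasurable := (h.stronglyMeasurable_err γ e₀ k).aestronglyMeasurable
  nonneg := by positivity
  eLpNorm_le := by
    have hκ := h.adapted.one_le_kappa
    have hC := h.stabilityConst_nonneg m
    have h1 := h.eLpNorm_sq_err_le ξ hp hγ hγ2 hm1 hmt hsmall e₀ k
    have h2 := eLpNorm_le_sqrt_of_sq_le (X := fun ω => err A ε γ e₀ ω k)
      (fun ω => le_rfl) (q := p / 2) (by linarith) (by positivity) h1
    rw [mul_div_cancel₀ p two_ne_zero] at h2
    refine h2.trans (ENNReal.ofReal_le_ofReal ?_)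
    rw [Real.sqrt_le_left (by positivity), add_sq, mul_pow, mul_pow, mul_pow,
      Real.sq_sqrt (by positivity), Real.sq_sqrt hC, Real.sq_sqrt (by positivity),
      ← Real.exp_nat_mul]
    have e : ((2 : ℕ) : ℝ) * -(a * γ / 12 * k) = -(a * γ * k) / 6 := by push_cast; ring
    rw [e]
    have : 0 ≤ 2 * (√(12 * κ) * ‖e₀‖ * Real.exp (-(a * γ / 12 * k)))
        * (√(stabilityConst m t a κ CA S) * √(p * γ)) := by positivity
    linarith

lemma hasMomentBound_matrixMart {p γ : ℝ} (hp : 2 ≤ p) (hγ : 0 < γ) (hγ2 : γ ≤ 2) {m : ℕ}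
    (hm1 : 1 ≤ m) (hmt : 8 * CA * t ≤ a * m) (hsmall : 24 * p * CA ^ 2 * (γ * m) ≤ a)
    (e₀ : Vec d) (s N : ℕ) :
    HasMomentBound (fun ω => matrixMart Q A M ε γ e₀ s ω N) p (chainLaw Q ξ)
      √(4 * p * (6 * t * CA) ^ 2 * ∑ i ∈ Finset.range N,
        (12 * κ * Real.exp (-(a * γ / 6 * (s + i : ℕ))) * ‖e₀‖ ^ 2
          + stabilityConst m t a κ CA S * (p * γ))) where
  aestronglyMeasurable := (h.stronglyMeasurable_matrixMart γ e₀ s N).aestronglyMeasurable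
  nonneg := Real.sqrt_nonneg _
  eLpNorm_le := by
    have hκ := h.adapted.one_le_kappa
    have hC := h.stabilityConst_nonneg m
    refine h.eLpNorm_matrixMart_le ξ hp γ e₀ s N (ρ := fun k =>
      12 * κ * Real.exp (-(a * γ / 6 * k)) * ‖e₀‖ ^ 2 + stabilityConst m t a κ CA S * (p * γ))
      (fun k => by positivity) fun k => ?_
    have h1 := h.eLpNorm_sq_err_le ξ hp hγ hγ2 hm1 hmt hsmall e₀ k
    rwa [show -(a * γ * k) / 6 = -(a * γ / 6 * k) by ring] at h1

omit [MeasurableSingletonClass Z] [IsProbabilityMeasure ξ] in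
lemma hasMomentBound_remainder {p γ : ℝ} (hp : 2 ≤ p) (hγ : 0 < γ) {e₀ : Vec d} {r : ℕ → ℝ}
    (hr : ∀ k, HasMomentBound (fun ω => err A ε γ e₀ ω k) p (chainLaw Q ξ) (r k)) (s N : ℕ)
    {R : ℝ} (hR : HasMomentBound (fun ω => matrixMart Q A M ε γ e₀ s ω N) p (chainLaw Q ξ) R) :
    HasMomentBound (remainder Q A M ε γ e₀ s N) p (chainLaw Q ξ)
      (γ⁻¹ * (r s + r (s + N)) + R + 3 * t * CA * (r s + r (s + N))
        + γ * (3 * t * CA ^ 2 * ∑ i ∈ Finset.range N, r (s + i))) := by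
  have hp1 : 1 ≤ p := by linarith
  have hCA := h.CA_pos.le
  have hGm : ∀ k, StronglyMeasurable fun ω : ℕ → Z => poissonTail Q (fun z => A z - M) (ω k) :=
    fun k => (h.ergodic.stronglyMeasurable_poissonTail h.stronglyMeasurable_A_sub
      h.norm_A_sub_le h.integral_A_sub).comp_measurable (measurable_pi_apply k)
  have hGb : ∀ z, ‖poissonTail Q (fun z => A z - M) z‖ ≤ 3 * t * CA :=
    h.ergodic.norm_poissonTail_le h.stronglyMeasurable_A_sub h.norm_A_sub_le h.integral_A_sub
  have hem := fun k => h.stronglyMeasurable_err γ e₀ k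
  have hGe : ∀ k, HasMomentBound
      (fun ω => poissonTail Q (fun z => A z - M) (ω k) (err A ε γ e₀ ω k)) p (chainLaw Q ξ)
      (3 * t * CA * r k) := fun k => by
    refine (hr k).of_norm_le (isBoundedBilinearMap_apply.continuous.comp_stronglyMeasurable
      ((hGm k).prodMk (hem k))).aestronglyMeasurable (by positivity) fun ω => ?_
    exact (ContinuousLinearMap.le_opNorm _ _).trans
      (mul_le_mul_of_nonneg_right (hGb _) (norm_nonneg _))
  have hGAe : ∀ k, HasMomentBound (fun ω => poissonTail Q (fun z => A z - M) (ω (k + 1))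
      (A (ω (k + 1)) (err A ε γ e₀ ω k))) p (chainLaw Q ξ) (3 * t * CA ^ 2 * r k) := fun k => by
    have hAm : StronglyMeasurable fun ω : ℕ → Z => A (ω (k + 1)) :=
      h.stronglyMeasurable_A.comp_measurable (measurable_pi_apply _)
    have hAe : StronglyMeasurable fun ω : ℕ → Z => A (ω (k + 1)) (err A ε γ e₀ ω k) :=
      isBoundedBilinearMap_apply.continuous.comp_stronglyMeasurable (hAm.prodMk (hem k))
    refine (hr k).of_norm_le (isBoundedBilinearMap_apply.continuous.comp_stronglyMeasurable
      ((hGm (k + 1)).prodMk hAe)).aestronglyMeasurable (by positivity) fun ω => ?_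
    calc _ ≤ 3 * t * CA * (CA * ‖err A ε γ e₀ ω k‖) :=
          (ContinuousLinearMap.le_opNorm _ _).trans (mul_le_mul (hGb _)
            ((ContinuousLinearMap.le_opNorm _ _).trans
              (mul_le_mul_of_nonneg_right (h.norm_A_le _) (norm_nonneg _)))
            (norm_nonneg _) (by positivity))
      _ = _ := by ring
  have h1 := ((hr s).sub (hr (s + N)) hp1).const_smul (inv_pos.2 hγ).le
  have h2 := ((h1.sub hR hp1).sub ((hGe s).sub (hGe (s + N)) hp1) hp1).add
    ((HasMomentBound.sum (fun i => hGAe (s + i)) hp1 N).const_smul hγ.le) hp1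
  refine h2.mono (le_of_eq ?_)
  rw [← Finset.mul_sum]
  ring

end CentredProblem

end Decomposition

/-! ### From moment bounds to rates -/

section Rates

/-- A geometric series whose ratio satisfies 1 − e^{−x} ≥ x/2 for 0 < x ≤ 1. -/
lemma sum_exp_neg_le {x : ℝ} (hx : 0 < x) (hx1 : x ≤ 1) (s N : ℕ) :
    ∑ i ∈ Finset.range N, Real.exp (-(x * (s + i : ℕ))) ≤ Real.exp (-(x * s)) * (2 / x) := by
  have h1 : ∀ i : ℕ, Real.exp (-(x * (s + i : ℕ))) = Real.exp (-(x * s)) * Real.exp (-x) ^ i := by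
    intro i
    rw [← Real.exp_nat_mul, ← Real.exp_add]
    congr 1
    push_cast
    ring
  simp only [h1]
  rw [← Finset.mul_sum]
  gcongr
  have hq0 : 0 ≤ Real.exp (-x) := (Real.exp_pos _).le
  have hq : Real.exp (-x) ≤ 1 - x / 2 := by
    have h2 := Real.exp_bound_div_one_sub_of_interval hx.le
    rw [Real.exp_neg]
    have h3 : 1 + x ≤ Real.exp x := by linarith [Real.add_one_le_exp x]
    calc (Real.exp x)⁻¹ ≤ (1 + x)⁻¹ := by gcongr
      _ ≤ 1 - x / 2 := by
        rw [inv_le_iff_one_le_mul₀ (by linarith)]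
        have : 0 ≤ x * (1 - x) := mul_nonneg hx.le (by linarith)
        linarith
  calc ∑ i ∈ Finset.range N, Real.exp (-x) ^ i ≤ (1 - Real.exp (-x))⁻¹ := by
        have h2 := (summable_geometric_of_lt_one hq0 (by linarith)).sum_le_tsum
          (Finset.range N) fun _ _ => by positivity
        rwa [tsum_geometric_of_lt_one hq0 (by linarith)] at h2
    _ ≤ (x / 2)⁻¹ := by
        gcongr
        linarith
    _ = 2 / x := inv_div x 2

/-- The error decays in L^p at rate aγ/12 per step and the burn-in lasts about n/2 steps, whence the
exponent αan/24. Rounding n/2 down costs e^{1/48} ≤ 2. -/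
lemma exp_burnIn_le {a α γ : ℝ} (ha : 0 < a) (hα : 0 < α) (hαγ : α ≤ γ) (haα : a * α ≤ 1 / 2)
    (n : ℕ) :
    Real.exp (-(a * γ / 12 * (n / 2 : ℕ))) ≤ 2 * Real.exp (-(α * a * n) / 24) := by
  have h1 : (n : ℝ) ≤ 2 * (n / 2 : ℕ) + 1 := by exact_mod_cast (by omega : n ≤ 2 * (n / 2) + 1)
  have h2 : Real.exp (1 / 48) ≤ 2 := by
    have := Real.exp_bound_div_one_sub_of_interval (x := 1 / 48) (by norm_num) (by norm_num)
    refine this.trans (by norm_num)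
  calc Real.exp (-(a * γ / 12 * (n / 2 : ℕ))) ≤ Real.exp (1 / 48 + -(α * a * n) / 24) := by
        apply Real.exp_le_exp.2
        have h3 : a * α * n ≤ a * α * (2 * (n / 2 : ℕ) + 1) := by gcongr
        have h4 : a * α * (n / 2 : ℕ) ≤ a * γ * (n / 2 : ℕ) := by gcongr
        linarith
    _ = Real.exp (1 / 48) * Real.exp (-(α * a * n) / 24) := Real.exp_add _ _
    _ ≤ _ := by gcongr

/-- A rate without logarithms and with the smallest powers of `p`, below the fluctuation rate. -/
def simpleRate (p α : ℝ) (n : ℕ) : ℝ :=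
  p * √√(n : ℝ) / n + √p / (√α * n) + p * √α / √n + √p * (α * √α)

/-- Powers of p only increase, since p ≥ 1. The logarithm is harmless because αap ≤ 1 and p ≥ 2
force αa ≤ 1/2, so it is at least log 2 ≥ 1/4; its power 3/2 is then at least 1/8, which explains
the factor 8. -/
lemma simpleRate_le {a p α : ℝ} (ha : 0 < a) (hp : 2 ≤ p) (hα : 0 < α) (hap : α * a * p ≤ 1)
    {n : ℕ} (hn : 1 ≤ n) : simpleRate p α n ≤ 8 * fluctuationRate a p α n := by
  have hn' : (1 : ℝ) ≤ n := by exact_mod_cast hn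
  have hn0 : (0 : ℝ) < n := by linarith
  have hp0 : 0 < p := by linarith
  have hp1 : 1 ≤ p := by linarith
  have haα : 0 < α * a := by positivity
  have hpow : ∀ {q : ℝ}, 1 ≤ q → p ≤ p ^ q := fun {q} hq => by
    have := Real.rpow_le_rpow_of_exponent_le hp1 hq
    rwa [Real.rpow_one] at this
  have hsp : √p ≤ p := by
    rw [Real.sqrt_le_left hp0.le, sq]
    exact le_mul_of_one_le_left hp0.le hp1
  have hlog : (1 / 4 : ℝ) ≤ Real.log (1 / (α * a)) := by
    have h1 : α * a ≤ 1 / 2 := by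
      have : α * a * 2 ≤ α * a * p := by gcongr
      linarith
    have h2 : (2 : ℝ) ≤ 1 / (α * a) := by
      rw [le_div_iff₀ haα]; linarith
    have := Real.log_le_log (by norm_num) h2
    have := Real.log_two_gt_d9
    linarith
  have hlog8 : (1 / 8 : ℝ) ≤ Real.log (1 / (α * a)) ^ (3 / 2 : ℝ) := by
    have h1 := Real.rpow_le_rpow (by norm_num) hlog (show (0 : ℝ) ≤ 3 / 2 by norm_num)
    have h2 : (1 / 4 : ℝ) ^ (3 / 2 : ℝ) = 1 / 8 := by
      rw [show (1 / 4 : ℝ) = (1 / 2) ^ (2 : ℝ) by norm_num, ← Real.rpow_mul (by norm_num)]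
      norm_num
    rwa [h2] at h1
  have e1 : (n : ℝ) ^ (-(3 / 4) : ℝ) = √√(n : ℝ) / n := by
    rw [Real.sqrt_eq_rpow, Real.sqrt_eq_rpow, ← Real.rpow_mul hn0.le, ← Real.rpow_sub_one hn0.ne']
    norm_num
  have e2 : (α * n) ^ (-(1 / 2) : ℝ) = (√α * √n)⁻¹ := by
    rw [Real.rpow_neg (by positivity), ← Real.sqrt_eq_rpow, Real.sqrt_mul hα.le]
  have e3 : (n : ℝ) ^ (-(1 / 2) : ℝ) = (√n)⁻¹ := by
    rw [Real.rpow_neg hn0.le, ← Real.sqrt_eq_rpow]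
  have e4 : α ^ (1 / 2 : ℝ) = √α := (Real.sqrt_eq_rpow α).symm
  have e5 : α ^ (3 / 2 : ℝ) = α * √α := by
    rw [show (3 / 2 : ℝ) = 1 + 1 / 2 by norm_num, Real.rpow_add hα, Real.rpow_one, e4]
  have hsα : 0 < √α := Real.sqrt_pos.2 hα
  have hsn : 0 < √(n : ℝ) := Real.sqrt_pos.2 hn0
  have hsq : √(n : ℝ) * √(n : ℝ) = n := Real.mul_self_sqrt hn0.le
  rw [simpleRate, fluctuationRate, e1, e2, e3, e4, e5]
  have p32 := hpow (q := 3 / 2) (by norm_num)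
  have p72 := hpow (q := 7 / 2) (by norm_num)
  have t1 : p * √√(n : ℝ) / n = p * (√√(n : ℝ) / n) := by ring
  have t2 : √p / (√α * n) ≤ p ^ (3 / 2 : ℝ) * (√α * √n)⁻¹ * p ^ (3 / 2 : ℝ) * (√n)⁻¹ := by
    have e : p ^ (3 / 2 : ℝ) * (√α * √n)⁻¹ * p ^ (3 / 2 : ℝ) * (√n)⁻¹
        = p ^ (3 / 2 : ℝ) * p ^ (3 / 2 : ℝ) / (√α * n) := by
      rw [show √α * (n : ℝ) = √α * (√n * √n) by rw [hsq]]
      field_simp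
    rw [e]
    gcongr
    calc √p ≤ p * 1 := by linarith
      _ ≤ p ^ (3 / 2 : ℝ) * p ^ (3 / 2 : ℝ) := by gcongr; linarith
  have t3 : p * √α / √n ≤ √α * p ^ (3 / 2 : ℝ) * (√n)⁻¹ := by
    rw [mul_comm p, div_eq_mul_inv]
    gcongr
  have t4 : √p * (α * √α) ≤ 8 * (p ^ (7 / 2 : ℝ) * (α * √α)
      * Real.log (1 / (α * a)) ^ (3 / 2 : ℝ)) := by
    have h1 : √p * (α * √α) * (1 / 8) ≤ p ^ (7 / 2 : ℝ) * (α * √α)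
      * Real.log (1 / (α * a)) ^ (3 / 2 : ℝ) := by
      gcongr
      linarith
    linarith
  have n1 : 0 ≤ p * (√√(n : ℝ) / n) := by positivity
  have n2 : 0 ≤ p ^ (3 / 2 : ℝ) * (√α * √n)⁻¹ * p ^ (3 / 2 : ℝ) * (√n)⁻¹ := by positivity
  have n3 : 0 ≤ √α * p ^ (3 / 2 : ℝ) * (√n)⁻¹ := by positivity
  rw [t1]
  linarith

/-- The constant of the transient part of the remainder. -/
def transientConst (t a κ CA : ℝ) : ℝ := 2 * √(12 * κ) * (4 + 12 * t + 264 * t * CA / a)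

/-- The constant of the stationary part of the remainder. -/
def stationaryConst (t CA C : ℝ) : ℝ := √C * (4 + 12 * t + 24 * t * CA + 9 * t * CA ^ 2)

lemma sqrt_matrixMart_bound_le {a γ p CA κ C E t δ : ℝ} (ha : 0 < a) (hγ : 0 < γ)
    (haγ : a * γ ≤ 1) (hp : 0 < p) (hap : p * (a * γ) ≤ 2) (hCA : 0 ≤ CA) (hκ : 0 ≤ κ)
    (hC : 0 ≤ C) (hE : 0 ≤ E) (ht : 0 ≤ t) (hδ0 : 0 ≤ δ) {s : ℕ} (N : ℕ)
    (hδ : Real.exp (-(a * γ / 12 * s)) ≤ 2 * δ) :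
    √(4 * p * (6 * t * CA) ^ 2 * ∑ i ∈ Finset.range N,
        (12 * κ * Real.exp (-(a * γ / 6 * (s + i : ℕ))) * E ^ 2 + C * (p * γ))) ≤
      120 * t * CA * √(12 * κ) * E * δ / (a * γ)
        + 12 * t * CA * √C * (√p * √N * √(p * γ)) := by
  have haγ0 : 0 < a * γ := by positivity
  have hsum : ∑ i ∈ Finset.range N,
        (12 * κ * Real.exp (-(a * γ / 6 * (s + i : ℕ))) * E ^ 2 + C * (p * γ))
      = 12 * κ * E ^ 2 * ∑ i ∈ Finset.range N, Real.exp (-(a * γ / 6 * (s + i : ℕ)))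
        + N * (C * (p * γ)) := by
    rw [Finset.sum_add_distrib, Finset.sum_const, Finset.card_range, nsmul_eq_mul, Finset.mul_sum]
    congr 1
    exact Finset.sum_congr rfl fun _ _ => by ring
  have hexp : ∑ i ∈ Finset.range N, Real.exp (-(a * γ / 6 * (s + i : ℕ))) ≤
      (2 * δ) ^ 2 * (12 / (a * γ)) := by
    refine (sum_exp_neg_le (by positivity) (by linarith) s N).trans ?_
    have e1 : Real.exp (-(a * γ / 6 * s)) = Real.exp (-(a * γ / 12 * s)) ^ 2 := by
      rw [← Real.exp_nat_mul]; congr 1; push_cast; ring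
    have e2 : 2 / (a * γ / 6) = 12 / (a * γ) := by field_simp; norm_num
    rw [e1, e2]
    gcongr
  rw [Real.sqrt_le_left (by positivity), add_sq, hsum]
  have hX : √(12 * κ) ^ 2 = 12 * κ := Real.sq_sqrt (by positivity)
  have sC : √C ^ 2 = C := Real.sq_sqrt hC
  have sp : √p ^ 2 = p := Real.sq_sqrt hp.le
  have sN : √(N : ℝ) ^ 2 = N := Real.sq_sqrt (by positivity)
  have sg : √(p * γ) ^ 2 = p * γ := Real.sq_sqrt (by positivity)
  have q1 : (12 * t * CA * √C * (√p * √N * √(p * γ))) ^ 2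
      = 4 * p * (6 * t * CA) ^ 2 * (N * (C * (p * γ))) := by
    simp only [mul_pow]
    rw [sC, sp, sN, ← mul_pow, sg]
    ring
  have q2 : 4 * p * (6 * t * CA) ^ 2 * (12 * κ * E ^ 2 * ∑ i ∈ Finset.range N,
      Real.exp (-(a * γ / 6 * (s + i : ℕ)))) ≤
      (120 * t * CA * √(12 * κ) * E * δ / (a * γ)) ^ 2 := by
    calc _ ≤ 4 * p * (6 * t * CA) ^ 2 * (12 * κ * E ^ 2 * ((2 * δ) ^ 2 * (12 / (a * γ)))) := by
          gcongr
      -- The factor p of the Burkholder bound is absorbed by p a γ ≤ 2, a consequence of the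
      -- threshold 1/(ap); the transient constant is therefore free of p.
      _ = p * (a * γ) * (12 * κ * (6912 * (t * CA * E * δ) ^ 2) / (a * γ) ^ 2) := by
          field_simp
          ring
      _ ≤ 2 * (12 * κ * (6912 * (t * CA * E * δ) ^ 2) / (a * γ) ^ 2) := by gcongr
      _ ≤ 12 * κ * (14400 * (t * CA * E * δ) ^ 2) / (a * γ) ^ 2 := by
          have : 0 ≤ 12 * κ * (t * CA * E * δ) ^ 2 / (a * γ) ^ 2 := by positivity
          have e1 : 2 * (12 * κ * (6912 * (t * CA * E * δ) ^ 2) / (a * γ) ^ 2)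
            = 13824 * (12 * κ * (t * CA * E * δ) ^ 2 / (a * γ) ^ 2) := by ring
          have e2 : 12 * κ * (14400 * (t * CA * E * δ) ^ 2) / (a * γ) ^ 2
            = 14400 * (12 * κ * (t * CA * E * δ) ^ 2 / (a * γ) ^ 2) := by ring
          rw [e1, e2]
          linarith
      _ = _ := by
          have e1 : (120 * t * CA * √(12 * κ) * E * δ) ^ 2
              = √(12 * κ) ^ 2 * (14400 * (t * CA * E * δ) ^ 2) := by ring
          rw [div_pow, e1, hX]
  have q3 : 0 ≤ 2 * (120 * t * CA * √(12 * κ) * E * δ / (a * γ))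
      * (12 * t * CA * √C * (√p * √N * √(p * γ))) := by positivity
  rw [q1, mul_add]
  linarith

/-- The remainder bound, in terms of rates. -/
lemma remainder_bound_le {a α γ p CA κ C E t : ℝ} (ha : 0 < a) (hα : 0 < α) (hαγ : α ≤ γ)
    (hγα : γ ≤ 2 * α) (hp : 2 ≤ p) (hap : α * a * p ≤ 1) (hCA : 0 ≤ CA) (hγCA : γ * CA ≤ 1)
    (hκ : 0 ≤ κ) (hC : 0 ≤ C) (hE : 0 ≤ E) (ht : 0 ≤ t) {n N s : ℕ} (hn : 1 ≤ n) (hs : s = n / 2)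
    (hN : N = n - n / 2) {r : ℕ → ℝ}
    (hr : r = fun k : ℕ => √(12 * κ) * E * Real.exp (-(a * γ / 12 * (k : ℝ))) + √C * √(p * γ)) :
    γ⁻¹ * (r s + r (s + N)) + √(4 * p * (6 * t * CA) ^ 2 * ∑ i ∈ Finset.range N,
        (12 * κ * Real.exp (-(a * γ / 6 * (s + i : ℕ))) * E ^ 2 + C * (p * γ)))
      + 3 * t * CA * (r s + r (s + N)) + γ * (3 * t * CA ^ 2 * ∑ i ∈ Finset.range N, r (s + i)) ≤
    N * (transientConst t a κ CA * (α * n)⁻¹ * E * Real.exp (-(α * a * n) / 24)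
      + stationaryConst t CA C * simpleRate p α n) := by
  have hγ : 0 < γ := hα.trans_le hαγ
  have haγ0 : 0 < a * γ := by positivity
  have hp0 : 0 < p := by linarith
  have haα : a * α ≤ 1 / 2 := by
    have : α * a * 2 ≤ α * a * p := by gcongr
    linarith
  have haγ : a * γ ≤ 1 := by
    have : a * γ ≤ a * (2 * α) := by gcongr
    linarith
  have hapγ : p * (a * γ) ≤ 2 := by
    have : p * (a * γ) ≤ p * (a * (2 * α)) := by gcongr
    linarith
  have hn0 : (0 : ℝ) < n := by exact_mod_cast hn
  have hN2 : (n : ℝ) ≤ 2 * N := by exact_mod_cast (by omega : n ≤ 2 * N)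
  have hN0 : (0 : ℝ) < N := by linarith
  set δ := Real.exp (-(α * a * n) / 24) with hδdef
  have hδ0 : 0 ≤ δ := (Real.exp_pos _).le
  have hδ : Real.exp (-(a * γ / 12 * s)) ≤ 2 * δ := hs ▸ exp_burnIn_le ha hα hαγ haα n
  have hmart := sqrt_matrixMart_bound_le ha hγ haγ hp0 hapγ hCA hκ hC hE ht hδ0 N hδ
  set K1 := √(12 * κ) with hK1
  set K2 := √C with hK2
  set g := √(p * γ) with hg
  have hK10 : 0 ≤ K1 := Real.sqrt_nonneg _
  have hK20 : 0 ≤ K2 := Real.sqrt_nonneg _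
  have hg0 : 0 ≤ g := Real.sqrt_nonneg _
  have hrs : r s + r (s + N) ≤ 4 * K1 * E * δ + 2 * K2 * g := by
    have h1 : Real.exp (-(a * γ / 12 * (s + N : ℕ))) ≤ Real.exp (-(a * γ / 12 * s)) := by
      apply Real.exp_le_exp.2
      have : a * γ / 12 * (s : ℝ) ≤ a * γ / 12 * (s + N : ℕ) := by
        gcongr
        omega
      linarith
    have h2 : K1 * E * Real.exp (-(a * γ / 12 * s)) ≤ K1 * E * (2 * δ) := by gcongr
    have h3 : K1 * E * Real.exp (-(a * γ / 12 * (s + N : ℕ))) ≤ K1 * E * (2 * δ) := by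
      gcongr
      exact h1.trans hδ
    rw [hr]
    simp only
    linarith
  have hrs0 : 0 ≤ r s + r (s + N) := by rw [hr]; positivity
  have hsum : ∑ i ∈ Finset.range N, r (s + i) ≤
      K1 * E * (2 * δ * (24 / (a * γ))) + N * (K2 * g) := by
    rw [hr]
    simp only
    rw [Finset.sum_add_distrib, Finset.sum_const, Finset.card_range, nsmul_eq_mul,
      ← Finset.mul_sum]
    gcongr
    refine (sum_exp_neg_le (by positivity) (by linarith) s N).trans ?_
    have e2 : 2 / (a * γ / 12) = 24 / (a * γ) := by field_simp; norm_num
    rw [e2]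
    gcongr
  -- This lets the Poisson boundary terms be merged with those carrying γ⁻¹.
  have hCAγ : CA ≤ γ⁻¹ := by
    rw [← one_div, le_div_iff₀ hγ]
    linarith
  set F := simpleRate p α n with hF
  have hsα : 0 < √α := Real.sqrt_pos.2 hα
  have hsγ : 0 < √γ := Real.sqrt_pos.2 hγ
  have hsn : 0 < √(n : ℝ) := Real.sqrt_pos.2 hn0
  have hsα2 : √α * √α = α := Real.mul_self_sqrt hα.le
  have hsγ2 : √γ * √γ = γ := Real.mul_self_sqrt hγ.le
  have hsn2 : √(n : ℝ) * √(n : ℝ) = n := Real.mul_self_sqrt hn0.le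
  have hsN2 : √(N : ℝ) * √(N : ℝ) = N := Real.mul_self_sqrt hN0.le
  have hsp2 : √p * √p = p := Real.mul_self_sqrt hp0.le
  have hge : g = √p * √γ := Real.sqrt_mul hp0.le γ
  have hαγ' : √α ≤ √γ := Real.sqrt_le_sqrt hαγ
  have hs2 : √(2 : ℝ) ≤ 3 / 2 := by
    rw [Real.sqrt_le_left (by norm_num)]; norm_num
  have hs22 : √(2 : ℝ) * √2 = 2 := Real.mul_self_sqrt (by norm_num)
  have hγα' : √γ ≤ √2 * √α := by
    rw [← Real.sqrt_mul (by norm_num)]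
    exact Real.sqrt_le_sqrt hγα
  have hnN : √(n : ℝ) ≤ √2 * √N := by
    rw [← Real.sqrt_mul (by norm_num)]
    exact Real.sqrt_le_sqrt hN2
  have s1 : 0 ≤ p * √√(n : ℝ) / n := by positivity
  have s2 : 0 ≤ √p / (√α * n) := by positivity
  have s3 : 0 ≤ p * √α / √n := by positivity
  have s4 : 0 ≤ √p * (α * √α) := by positivity
  have hFdef : F = p * √√(n : ℝ) / n + √p / (√α * n) + p * √α / √n + √p * (α * √α) := rfl
  have hF0 : 0 ≤ F := by rw [hFdef]; positivity
  -- `f1`, `f2`, `f3` match the three orders of the remainder with the last three summands of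
  -- `simpleRate`, using n ≤ 2N and α ≤ γ ≤ 2α.
  have f1 : γ⁻¹ * g ≤ N * (2 * F) := by
    calc γ⁻¹ * g = √p / √γ := by
          rw [hge, show γ⁻¹ = (√γ * √γ)⁻¹ by rw [hsγ2]]
          field_simp
      _ ≤ √p / √α := by gcongr
      _ = n * (√p / (√α * n)) := by field_simp
      _ ≤ (2 * N) * F := by
          gcongr
          linarith
      _ = _ := by ring
  have f2 : √p * √N * g ≤ N * (2 * F) := by
    calc √p * √N * g = p * √N * √γ := by
          rw [hge]
          linear_combination (√(N : ℝ) * √γ) * hsp2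
      _ ≤ p * √N * (√2 * √α) := by gcongr
      _ = √2 * √n * √N * (p * √α / √n) := by field_simp
      _ ≤ √2 * (√2 * √N) * √N * F := by
          gcongr
          linarith
      _ = (√2 * √2) * (√N * √N) * F := by ring
      _ = _ := by rw [hs22, hsN2]; ring
  have f3 : γ * g ≤ 3 * F := by
    calc γ * g ≤ (2 * α) * (√p * (3 / 2 * √α)) := by
          rw [hge]
          gcongr
          exact hγα'.trans (by gcongr)
      _ = 3 * (√p * (α * √α)) := by ring
      _ ≤ 3 * F := by
          gcongr
          linarith
  set T := K1 * E * δ with hT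
  have hT0 : 0 ≤ T := by positivity
  have hu : γ⁻¹ * T ≤ N * (2 * ((α * n)⁻¹ * T)) := by
    calc γ⁻¹ * T ≤ α⁻¹ * T := by gcongr
      _ = n * ((α * n)⁻¹ * T) := by field_simp
      _ ≤ (2 * N) * ((α * n)⁻¹ * T) := by gcongr
      _ = _ := by ring
  have b1 : γ⁻¹ * (r s + r (s + N)) ≤ 4 * (γ⁻¹ * T) + 2 * K2 * (γ⁻¹ * g) := by
    have : γ⁻¹ * (r s + r (s + N)) ≤ γ⁻¹ * (4 * K1 * E * δ + 2 * K2 * g) := by gcongr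
    refine this.trans (le_of_eq ?_)
    rw [hT]; ring
  have b3 : 3 * t * CA * (r s + r (s + N)) ≤ 3 * t * (4 * (γ⁻¹ * T) + 2 * K2 * (γ⁻¹ * g)) := by
    calc 3 * t * CA * (r s + r (s + N)) ≤ 3 * t * γ⁻¹ * (r s + r (s + N)) := by gcongr
      _ = 3 * t * (γ⁻¹ * (r s + r (s + N))) := by ring
      _ ≤ _ := by gcongr
  have b2 : 120 * t * CA * K1 * E * δ / (a * γ) = 120 * t * CA / a * (γ⁻¹ * T) := by
    rw [hT]; field_simp
  have b4 : γ * (3 * t * CA ^ 2 * ∑ i ∈ Finset.range N, r (s + i)) ≤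
      144 * t * CA / a * (γ⁻¹ * T) + 3 * t * CA ^ 2 * K2 * N * (γ * g) := by
    calc _ ≤ γ * (3 * t * CA ^ 2 * (K1 * E * (2 * δ * (24 / (a * γ))) + N * (K2 * g))) := by
          gcongr
      _ = 144 * t * CA / a * (CA * T) + 3 * t * CA ^ 2 * K2 * N * (γ * g) := by
          rw [hT]; field_simp; ring
      _ ≤ _ := by gcongr
  have c1 : (4 + 12 * t + 264 * t * CA / a) * (γ⁻¹ * T) ≤
      (4 + 12 * t + 264 * t * CA / a) * (N * (2 * ((α * n)⁻¹ * T))) := by gcongr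
  have c2 : (2 + 6 * t) * K2 * (γ⁻¹ * g) ≤ (2 + 6 * t) * K2 * (N * (2 * F)) := by gcongr
  have c3 : 12 * t * CA * K2 * (√p * √N * g) ≤ 12 * t * CA * K2 * (N * (2 * F)) := by gcongr
  have c4 : 3 * t * CA ^ 2 * K2 * N * (γ * g) ≤ 3 * t * CA ^ 2 * K2 * N * (3 * F) := by gcongr
  have efin : N * (transientConst t a κ CA * (α * n)⁻¹ * E * δ + stationaryConst t CA C * F)
      = (4 + 12 * t + 264 * t * CA / a) * (N * (2 * ((α * n)⁻¹ * T)))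
        + ((2 + 6 * t) * K2 * (N * (2 * F)) + 12 * t * CA * K2 * (N * (2 * F))
        + 3 * t * CA ^ 2 * K2 * N * (3 * F)) := by
    rw [transientConst, stationaryConst, hT]
    ring
  have e264 : (4 + 12 * t + 264 * t * CA / a) * (γ⁻¹ * T) = 4 * (γ⁻¹ * T) + 12 * t * (γ⁻¹ * T)
      + 120 * t * CA / a * (γ⁻¹ * T) + 144 * t * CA / a * (γ⁻¹ * T) := by ring
  rw [efin]
  rw [b2] at hmart
  linarith

end Rates

/-! ### Consequences of the assumptions and of the step-size threshold -/

section Thresholds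

variable {Z : Type u} [MeasurableSpace Z] {d : ℕ}

/-- A bounded linear stochastic approximation problem, centred at its solution. -/
lemma LSAAssumptions.exists_centredProblem {Q : Kernel Z Z} [IsMarkovKernel Q] {π : Measure Z}
    [IsProbabilityMeasure π] {tmix : ℕ} (hQ : UniformlyGeometricallyErgodic Q π tmix)
    {A : Z → Mat d} {b : Z → Vec d} {Abar : Mat d} {bbar θs : Vec d} (hd : 1 ≤ d)
    (h : LSAAssumptions π A b Abar bbar θs) :
    ∃ P, CentredProblem Q π tmix A Abar (noise A b Abar bbar θs) P (decayRate Abar) (kappa Abar)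
      (boundA A Abar) (⨆ z, ‖noise A b Abar bbar θs z‖) := by
  obtain ⟨P, hP⟩ := exists_isAdaptedForm hd h.hurwitz
  have hAm : StronglyMeasurable A := h.measurable_A.stronglyMeasurable
  have hbm : StronglyMeasurable b := h.measurable_b.stronglyMeasurable
  have hA : ∀ z, ‖A z‖ ≤ boundA A Abar := fun z =>
    (le_ciSup h.bounded_A z).trans (le_max_left _ _)
  have hA2 : ∀ z, ‖A z - Abar‖ ≤ boundA A Abar := fun z =>
    (le_ciSup h.bounded_A_sub z).trans (le_max_right _ _)
  have hn : ∀ z, ‖noise A b Abar bbar θs z‖ ≤ ⨆ z, ‖noise A b Abar bbar θs z‖ := fun z =>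
    le_ciSup h.bounded_noise z
  have hM : ‖Abar‖ ≤ boundA A Abar := by
    rw [← h.mean_A]
    exact norm_integral_le_of_bound (by rwa [h.mean_A])
  have hAsm : StronglyMeasurable fun z => A z - Abar := hAm.sub stronglyMeasurable_const
  have hAθ : StronglyMeasurable fun z => (A z - Abar) θs :=
    (ContinuousLinearMap.apply ℝ (Vec d) θs).continuous.comp_stronglyMeasurable hAsm
  have hnm : StronglyMeasurable (noise A b Abar bbar θs) :=
    hAθ.sub (hbm.sub stronglyMeasurable_const)
  have hAi : Integrable A π := integrable_of_bound hAm hA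
  have hAsi : Integrable (fun z => A z - Abar) π := integrable_of_bound hAsm hA2
  have hni : Integrable (noise A b Abar bbar θs) π := integrable_of_bound hnm hn
  have hA0 : ∫ z, (A z - Abar) ∂π = 0 := by
    rw [integral_sub hAi (integrable_const _), h.mean_A]
    simp
  have hAθi : Integrable (fun z => (A z - Abar) θs) π := hAsi.apply_continuousLinearMap θs
  -- Integrability of `b` is not among the assumptions; it follows from boundedness of the noise and
  -- of A − Ā.
  have hbsi : Integrable (fun z => b z - bbar) π := by
    refine (hAθi.sub hni).congr (Filter.Eventually.of_forall fun z => ?_)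
    simp [noise]
  have hbi : Integrable b π := by
    refine (hbsi.add (integrable_const bbar)).congr (Filter.Eventually.of_forall fun z => ?_)
    simp
  have hn0 : ∫ z, noise A b Abar bbar θs z ∂π = 0 := by
    simp only [noise]
    rw [integral_sub hAθi hbsi, ← ContinuousLinearMap.integral_apply hAsi, hA0,
      integral_sub hbi (integrable_const _), h.mean_b]
    simp
  exact ⟨P, ⟨hQ, hP, hP.a_le hd hM, hM, hAm, hnm, hA, hA2, hn, hA0, hn0⟩⟩

/-- The block length, in units of the mixing time. -/
def blockFactor (a κ CA : ℝ) : ℕ := ⌈8 * √κ * CA / a⌉₊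

lemma le_blockFactor {a κ CA : ℝ} (ha : 0 < a) (hκ : 1 ≤ κ) (hCA : 0 < CA) :
    8 * CA ≤ a * blockFactor a κ CA ∧ 1 ≤ blockFactor a κ CA := by
  have hs : 1 ≤ √κ := Real.one_le_sqrt.2 hκ
  have h1 : 8 * √κ * CA / a ≤ blockFactor a κ CA := Nat.le_ceil _
  constructor
  · rw [div_le_iff₀ ha] at h1
    have : 8 * 1 * CA ≤ 8 * √κ * CA := by gcongr
    linarith
  · exact Nat.one_le_iff_ne_zero.2 (Nat.ceil_pos.2 (by positivity)).ne'

/-- The consequences of the step size threshold. -/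
lemma of_lt_alphaInfB {M : Mat d} {CA p α : ℝ} {tmix : ℕ} (hd : 1 ≤ d) (ht : 0 < tmix)
    (ha : 0 < decayRate M) (hκ : 1 ≤ kappa M) (hCA : 0 < CA) (hp : 2 ≤ p) (hα : 0 < α)
    (h : α < alphaInfB M CA tmix p) :
    α ≤ 1 ∧ α * decayRate M * p ≤ 1 ∧
      24 * p * CA ^ 2 * (2 * α * (blockFactor (decayRate M) (kappa M) CA * tmix : ℕ))
        ≤ decayRate M := by
  set a := decayRate M with hadef
  have ht1 : (1 : ℝ) ≤ tmix := by exact_mod_cast ht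
  have ht0 : (0 : ℝ) < tmix := by linarith
  have hp0 : 0 < p := by linarith
  obtain ⟨hh1, hh2⟩ := le_blockFactor ha hκ hCA
  set H := blockFactor a (kappa M) CA with hH
  have hH1 : (1 : ℝ) ≤ H := by exact_mod_cast hh2
  rw [alphaInfB, ← div_eq_mul_inv, lt_div_iff₀ ht0, lt_min_iff, lt_min_iff] at h
  obtain ⟨⟨h1, h2⟩, h3⟩ := h
  have hαt : α ≤ α * tmix := le_mul_of_one_le_right hα.le ht1
  refine ⟨?_, ?_, ?_⟩
  · have : 1 / (1 + CA) ≤ 1 := by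
      rw [div_le_one (by linarith)]; linarith
    linarith
  · rw [lt_div_iff₀ (by positivity)] at h3
    have : α * (a * p) ≤ α * tmix * (a * p) := by gcongr
    linarith
  · have hlog : 0 ≤ Real.log d := Real.log_nonneg (by exact_mod_cast hd)
    -- From the matrix threshold only the part a/(12 C_Γ q) is needed, with C_Γ ≥ 4C_A²h and with
    -- log d bounded below by zero.
    have hΓ : 4 * CA ^ 2 * H ≤ CGamma M CA := by
      have hb : blockLength M CA = H := rfl
      rw [CGamma, hb]
      have hs : 1 ≤ √(kappa M) := Real.one_le_sqrt.2 hκ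
      gcongr
      have : 1 * CA ≤ √(kappa M) * CA := by gcongr
      linarith
    have hΓ0 : 0 < CGamma M CA := lt_of_lt_of_le (by positivity) hΓ
    have h4 := h1.trans_le (min_le_right _ _)
    rw [lt_div_iff₀ (by positivity), lt_div_iff₀ (by positivity)] at h4
    have h5 : α * tmix * (p * (1 + 0)) * (12 * (4 * CA ^ 2 * H)) ≤
        α * tmix * (p * (1 + Real.log d)) * (12 * CGamma M CA) := by gcongr
    push_cast
    linarith

end Thresholds

/-! ### Richardson–Romberg cancellation and assembly -/

section Main

variable {Z : Type u} [MeasurableSpace Z] {d : ℕ}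

omit [MeasurableSpace Z] in
lemma averaged_sub_eq {A : Z → Mat d} {b : Z → Vec d} {Abar : Mat d} {bbar θs : Vec d}
    (hs : Abar θs = bbar) (α : ℝ) (θ₀ : Vec d) {n : ℕ} (hn : 1 ≤ n) (ω : ℕ → Z) :
    averaged A b α θ₀ n ω - θs = ((n - n / 2 : ℕ) : ℝ)⁻¹ • ∑ i ∈ Finset.range (n - n / 2),
      err A (noise A b Abar bbar θs) α (θ₀ - θs) ω (n / 2 + i) := by
  have hN : ((n - n / 2 : ℕ) : ℝ) = (n : ℝ) - ((n / 2 : ℕ) : ℝ) :=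
    Nat.cast_sub (Nat.div_le_self _ _)
  have hN0 : ((n - n / 2 : ℕ) : ℝ) ≠ 0 := by
    rw [Nat.cast_ne_zero]; omega
  simp only [← iterate_sub_eq_err hs]
  rw [averaged, ← hN, Finset.sum_Ico_eq_sum_range, Finset.sum_sub_distrib, Finset.sum_const,
    Finset.card_range, smul_sub, ← Nat.cast_smul_eq_nsmul ℝ, inv_smul_smul₀ hN0]

/-- The term linear in the step size occurs with coefficient 2·α − 2α = 0, because both averages run
along the same path; the leading noise sum occurs with coefficient −(2 − 1). -/
lemma map_richardsonRomberg_sub_eq (Q : Kernel Z Z) {A : Z → Mat d} {b : Z → Vec d}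
    {Abar : Mat d} {bbar θs : Vec d} (hs : Abar θs = bbar) {α : ℝ} (hα : 0 < α) (θ₀ : Vec d)
    {n : ℕ} (hn : 1 ≤ n) (ω : ℕ → Z) :
    Abar (richardsonRomberg A b α θ₀ n ω - θs) = ((n - n / 2 : ℕ) : ℝ)⁻¹ •
      ((2 : ℝ) • remainder Q A Abar (noise A b Abar bbar θs) α (θ₀ - θs) (n / 2) (n - n / 2) ω
        - remainder Q A Abar (noise A b Abar bbar θs) (2 * α) (θ₀ - θs) (n / 2) (n - n / 2) ω
        - ∑ i ∈ Finset.range (n - n / 2), noise A b Abar bbar θs (ω (n / 2 + i + 1))) := by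
  have h1 : richardsonRomberg A b α θ₀ n ω - θs = (2 : ℝ) • (averaged A b α θ₀ n ω - θs)
      - (averaged A b (2 * α) θ₀ n ω - θs) := by
    rw [richardsonRomberg]; module
  rw [h1, averaged_sub_eq hs α θ₀ hn, averaged_sub_eq hs (2 * α) θ₀ hn, map_sub, map_smul, map_smul,
    map_smul, map_sum, map_sum, sum_map_err_eq Q A Abar _ hα.ne',
    sum_map_err_eq Q A Abar _ (by positivity)]
  module

/-- The constant of the fluctuation rate. -/
def fluctuationConst (tmix : ℕ) (a κ CA S : ℝ) : ℝ :=
  8 * (3 * stationaryConst tmix CA (stabilityConst (blockFactor a κ CA * tmix) tmix a κ CA S)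
    + 2 * rosenthalConst tmix (S + 1))

/-- The window has n/2 ≤ N ≤ n, so the leading constant is at most 8e² ≤ 24e, well below the allowed
120e. -/
lemma mainTerm_le {p v CR : ℝ} (hp : 0 ≤ p) (hv : 0 ≤ v) (hCR : 0 ≤ CR) {n N : ℕ} (hn : 1 ≤ n)
    (hN : N = n - n / 2) {α : ℝ} (hα : 0 ≤ α) :
    (N : ℝ)⁻¹ * (4 * Real.exp 2 * √(p * (N * v)) + CR * (p * √√N)) ≤
      2 * (60 * Real.exp 1) * √v * p ^ (1 / 2 : ℝ) * (n : ℝ) ^ (-(1 / 2) : ℝ)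
        + 2 * CR * simpleRate p α n := by
  have hn0 : (0 : ℝ) < n := by exact_mod_cast hn
  have hN2 : (n : ℝ) ≤ 2 * N := by exact_mod_cast (by omega : n ≤ 2 * N)
  have hNn : (N : ℝ) ≤ n := by exact_mod_cast (by omega : N ≤ n)
  have hN0 : (0 : ℝ) < N := by linarith
  have hNinv : (N : ℝ)⁻¹ ≤ 2 * (n : ℝ)⁻¹ := by
    rw [← div_eq_mul_inv, inv_le_comm₀ hN0 (by positivity), inv_div]
    linarith
  have e3 : (n : ℝ) ^ (-(1 / 2) : ℝ) = (√n)⁻¹ := by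
    rw [Real.rpow_neg hn0.le, ← Real.sqrt_eq_rpow]
  have hsn : 0 < √(n : ℝ) := Real.sqrt_pos.2 hn0
  have hsn2 : √(n : ℝ) * √(n : ℝ) = n := Real.mul_self_sqrt hn0.le
  rw [e3, ← Real.sqrt_eq_rpow, mul_add]
  refine add_le_add ?_ ?_
  · have h1 : (N : ℝ)⁻¹ * (4 * Real.exp 2 * √(p * (N * v))) ≤
        2 * (n : ℝ)⁻¹ * (4 * Real.exp 2 * √(p * (n * v))) := by gcongr
    refine h1.trans ?_
    have h2 : √(p * (n * v)) = √p * (√n * √v) := by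
      rw [Real.sqrt_mul hp, Real.sqrt_mul hn0.le]
    have h3 : Real.exp 2 ≤ 3 * Real.exp 1 := by
      rw [show (2 : ℝ) = 1 + 1 by norm_num, Real.exp_add]
      have := Real.exp_one_lt_d9
      gcongr
      linarith
    rw [h2, show (n : ℝ)⁻¹ = (√n * √n)⁻¹ by rw [hsn2]]
    calc 2 * (√(n : ℝ) * √n)⁻¹ * (4 * Real.exp 2 * (√p * (√n * √v)))
        = 8 * Real.exp 2 * √v * √p * (√n)⁻¹ := by field_simp; ring
      _ ≤ 8 * (3 * Real.exp 1) * √v * √p * (√n)⁻¹ := by gcongr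
      _ = 24 * (Real.exp 1 * √v * √p * (√n)⁻¹) := by ring
      _ ≤ 120 * (Real.exp 1 * √v * √p * (√n)⁻¹) := by
          gcongr
          norm_num
      _ = _ := by ring
  · have h1 : (N : ℝ)⁻¹ * (CR * (p * √√N)) ≤ 2 * (n : ℝ)⁻¹ * (CR * (p * √√n)) := by gcongr
    refine h1.trans ?_
    have h2 : p * √√(n : ℝ) / n ≤ simpleRate p α n := by
      unfold simpleRate
      have s2 : 0 ≤ √p / (√α * n) := by positivity
      have s3 : 0 ≤ p * √α / √n := by positivity
      have s4 : 0 ≤ √p * (α * √α) := by positivity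
      linarith
    calc 2 * (n : ℝ)⁻¹ * (CR * (p * √√n)) = 2 * CR * (p * √√(n : ℝ) / n) := by ring
      _ ≤ _ := by gcongr

variable {Q : Kernel Z Z} [IsMarkovKernel Q] {π : Measure Z} [IsProbabilityMeasure π] {t : ℕ}
  {A : Z → Mat d} {M : Mat d} {ε : Z → Vec d} {P : Mat d} {a κ CA S : ℝ}

/-- Stated for all γ in [α, 2α] with a bound in terms of α alone, so that it covers both averages at
once. The smallness hypothesis is accordingly imposed at 2α. -/
lemma CentredProblem.hasMomentBound_remainder_rate [MeasurableSingletonClass Z]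
    (h : CentredProblem Q π t A M ε P a κ CA S) (ξ : Measure Z) [IsProbabilityMeasure ξ]
    {p α γ : ℝ} (hp : 2 ≤ p) (hα : 0 < α) (hα1 : α ≤ 1) (hap : α * a * p ≤ 1)
    (hαγ : α ≤ γ) (hγα : γ ≤ 2 * α)
    (hsmall : 24 * p * CA ^ 2 * (2 * α * (blockFactor a κ CA * t : ℕ)) ≤ a) (e₀ : Vec d)
    {n : ℕ} (hn : 1 ≤ n) :
    HasMomentBound (remainder Q A M ε γ e₀ (n / 2) (n - n / 2)) p (chainLaw Q ξ)
      ((n - n / 2 : ℕ) * (transientConst t a κ CA * (α * n)⁻¹ * ‖e₀‖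
        * Real.exp (-(α * a * n) / 24)
        + stationaryConst t CA (stabilityConst (blockFactor a κ CA * t) t a κ CA S)
          * simpleRate p α n)) := by
  have ha := h.a_pos
  have hCA := h.CA_pos
  have hκ := h.adapted.one_le_kappa
  have hγ : 0 < γ := hα.trans_le hαγ
  have ht := h.ergodic.tmix_pos
  obtain ⟨hh1, hh2⟩ := le_blockFactor ha hκ hCA
  set m := blockFactor a κ CA * t with hm
  have hm1 : 1 ≤ m := Nat.one_le_iff_ne_zero.2 (by positivity)
  have hmt : 8 * CA * t ≤ a * m := by
    have : 8 * CA * t ≤ a * blockFactor a κ CA * t := by gcongr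
    rw [hm]
    push_cast
    linarith
  have hsm : 24 * p * CA ^ 2 * (γ * m) ≤ a := by
    refine le_trans ?_ hsmall
    gcongr
  have hmpos : (1 : ℝ) ≤ m := by exact_mod_cast hm1
  obtain ⟨-, hx48, -, -, -⟩ := block_small (by positivity) hp ha h.a_le rfl hsm
  have hγCA : γ * CA ≤ 1 := by
    have : γ * 1 * CA ≤ γ * m * CA := by gcongr
    linarith
  have hγ2 : γ ≤ 2 := by linarith
  refine (h.hasMomentBound_remainder ξ hp hγ
    (fun k => h.hasMomentBound_err ξ hp hγ hγ2 hm1 hmt hsm e₀ k) (n / 2) (n - n / 2)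
    (h.hasMomentBound_matrixMart ξ hp hγ hγ2 hm1 hmt hsm e₀ (n / 2) (n - n / 2))).mono ?_
  exact remainder_bound_le ha hα hαγ hγα hp hap hCA.le hγCA (by linarith)
    (h.stabilityConst_nonneg m) (norm_nonneg _) (by positivity) hn rfl rfl rfl

end Main

end MarkovLSA

end

/-! ### The main theorem -/

theorem mainTheorem1 :
    ∃ Cfl Ctr : ℕ → ℝ → ℝ → ℝ → ℝ → ℝ,
    ∀ (d : ℕ) (_ : 1 ≤ d)
      (Z : Type u) [TopologicalSpace Z] [PolishSpace Z] [MeasurableSpace Z] [BorelSpace Z]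
      (Q : Kernel Z Z) [IsMarkovKernel Q] (π : Measure Z) [IsProbabilityMeasure π] (tmix : ℕ)
      (_ : MarkovLSA.UniformlyGeometricallyErgodic Q π tmix)
      (A : Z → MarkovLSA.Mat d) (b : Z → MarkovLSA.Vec d)
      (Abar : MarkovLSA.Mat d) (bbar θs : MarkovLSA.Vec d)
      (_ : MarkovLSA.LSAAssumptions π A b Abar bbar θs)
      (a κ CA supε : ℝ) (_ : a = MarkovLSA.decayRate Abar) (_ : κ = MarkovLSA.kappa Abar)
      (_ : CA = MarkovLSA.boundA A Abar)
      (_ : supε = ⨆ z, ‖MarkovLSA.noise A b Abar bbar θs z‖),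
      (Summable fun ℓ : ℕ =>
        MarkovLSA.autoCov Q π (MarkovLSA.noise A b Abar bbar θs) (ℓ + 1)) ∧
      ∀ (p : ℝ) (_ : 2 ≤ p) (n : ℕ) (_ : tmix ≤ n)
        (α : ℝ) (_ : 0 < α) (_ : α < MarkovLSA.alphaInfB Abar CA tmix p)
        (ξ : Measure Z) [IsProbabilityMeasure ξ] (θ₀ : MarkovLSA.Vec d),
        eLpNorm (fun ω => Abar (MarkovLSA.richardsonRomberg A b α θ₀ n ω - θs))
            (ENNReal.ofReal p) (MarkovLSA.chainLaw Q ξ) ≤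
          ENNReal.ofReal
            (2 * (60 * Real.exp 1)
                * √(MarkovLSA.markovCov Q π (MarkovLSA.noise A b Abar bbar θs)).trace
                * p ^ (1 / 2 : ℝ) * (n : ℝ) ^ (-(1 / 2) : ℝ)
              + Cfl tmix a κ CA supε * MarkovLSA.fluctuationRate a p α n
              + Ctr tmix a κ CA supε * (α * n)⁻¹ * ‖θ₀ - θs‖ * Real.exp (-(α * a * n) / 24)) := by
  refine ⟨MarkovLSA.fluctuationConst,
    fun tmix a κ CA _ => 3 * MarkovLSA.transientConst tmix a κ CA, ?_⟩
  intro d hd Z _ _ _ _ Q _ π _ tmix hQ A b Abar bbar θs hLSA a κ CA supε ha hκ hCA hsup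
  obtain ⟨P, hP⟩ := hLSA.exists_centredProblem hQ hd
  rw [← ha, ← hκ, ← hCA, ← hsup] at hP
  have hnm := hP.stronglyMeasurable_noise
  have hnb := hP.norm_noise_le
  have hn0 := hP.integral_noise
  refine ⟨(summable_nat_add_iff 1).2 (hQ.summable_autoCov hnm hnb hn0), ?_⟩
  intro p hp n hn α hα hαlt ξ _ θ₀
  have hn1 : 1 ≤ n := le_trans hQ.tmix_pos hn
  have ha0 := hP.a_pos
  have hCA0 := hP.CA_pos
  have hκ1 := hP.adapted.one_le_kappa
  have hS := hP.S_nonneg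
  have hthr := MarkovLSA.of_lt_alphaInfB hd hQ.tmix_pos (ha ▸ ha0) (hκ ▸ hκ1) hCA0 hp hα hαlt
  rw [← ha, ← hκ] at hthr
  obtain ⟨hα1, hap, hsmall⟩ := hthr
  have hrem1 := hP.hasMomentBound_remainder_rate ξ hp hα hα1 hap le_rfl (by linarith) hsmall
    (θ₀ - θs) hn1
  have hrem2 := hP.hasMomentBound_remainder_rate ξ hp hα hα1 hap (γ := 2 * α) (by linarith) le_rfl
    hsmall (θ₀ - θs) hn1
  have hp1 : 1 ≤ p := by linarith
  have hN1 : 1 ≤ n - n / 2 := by omega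
  -- The Rosenthal bound needs a strictly positive bound on the function, while `supε` may vanish;
  -- the leading term does not see this enlargement.
  have hnb1 : ∀ z, ‖MarkovLSA.noise A b Abar bbar θs z‖ ≤ supε + 1 := fun z =>
    (hnb z).trans (by linarith)
  have hv := hQ.integral_condVar_nonneg hnm hnb hn0
  have hCR : 0 ≤ MarkovLSA.rosenthalConst tmix (supε + 1) := by
    unfold MarkovLSA.rosenthalConst
    positivity
  have hros : MarkovLSA.HasMomentBound (fun ω : ℕ → Z => ∑ i ∈ Finset.range (n - n / 2),
      MarkovLSA.noise A b Abar bbar θs (ω (n / 2 + i + 1))) p (MarkovLSA.chainLaw Q ξ) _ :=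
    ⟨(Finset.stronglyMeasurable_fun_sum _ fun i _ =>
      hnm.comp_measurable (measurable_pi_apply _)).aestronglyMeasurable, by positivity,
      hQ.eLpNorm_sum_le ξ hnm hnb1 hn0 (by linarith) hp (n / 2) hN1⟩
  have hall := (((hrem1.const_smul zero_le_two).sub hrem2 hp1).sub hros hp1).const_smul
    (inv_nonneg.2 (Nat.cast_nonneg (n - n / 2)))
  simp only [MarkovLSA.map_richardsonRomberg_sub_eq Q hLSA.solution hα θ₀ hn1]
  refine hall.eLpNorm_le.trans (ENNReal.ofReal_le_ofReal ?_)
  have hmain := MarkovLSA.mainTerm_le (by linarith : 0 ≤ p) hv hCR hn1 rfl hα.le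
  have hrate := MarkovLSA.simpleRate_le ha0 hp hα hap hn1
  have hC0 := hP.stabilityConst_nonneg (MarkovLSA.blockFactor a κ CA * tmix)
  have hstat : 0 ≤ MarkovLSA.stationaryConst tmix CA (MarkovLSA.stabilityConst
      (MarkovLSA.blockFactor a κ CA * tmix) tmix a κ CA supε) := by
    unfold MarkovLSA.stationaryConst
    positivity
  rw [hQ.trace_markovCov hnm hnb hn0]
  have hNpos : (0 : ℝ) < (n - n / 2 : ℕ) := by exact_mod_cast hN1
  have hrate2 := mul_le_mul_of_nonneg_left hrate (by positivity : 0 ≤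
    3 * MarkovLSA.stationaryConst tmix CA (MarkovLSA.stabilityConst
      (MarkovLSA.blockFactor a κ CA * tmix) tmix a κ CA supε)
    + 2 * MarkovLSA.rosenthalConst tmix (supε + 1))
  set Φ := MarkovLSA.stationaryConst tmix CA (MarkovLSA.stabilityConst
      (MarkovLSA.blockFactor a κ CA * tmix) tmix a κ CA supε)
  set T := MarkovLSA.transientConst tmix a κ CA * (α * n)⁻¹ * ‖θ₀ - θs‖
    * Real.exp (-(α * a * n) / 24) with hT
  -- The remainders at steps α and 2α enter with weights 2 and 1, hence the factor 3 in both
  -- constants.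
  have e1 : ∀ N x y : ℝ, 0 < N → N⁻¹ * (2 * (N * x) + N * x + y) = 3 * x + N⁻¹ * y := by
    intro N x y hN
    field_simp
    ring
  rw [e1 _ _ _ hNpos]
  unfold MarkovLSA.fluctuationConst
  have e2 : 3 * MarkovLSA.transientConst tmix a κ CA * (α * n)⁻¹ * ‖θ₀ - θs‖
    * Real.exp (-(α * a * n) / 24) = 3 * T := by rw [hT]; ring
  rw [e2]
  linarith
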